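/- An odd unimodal sequence of size $n$ is a sequence $a_1\le\dots\le a_r\le \bar c\ge b_1\ge\dots\ge b_s$ ($r,s\ge 0$) of odd positive integers with a distinguished peak $\bar c$ and $\bar c+\sum_i a_i+\sum_i b_i=n$. For $n\ge1$ let $\mathbf P_n$ be the uniform probability measure on the (finite, non-empty) set of odd unimodal sequences of size $n$. Let $X_k^{[L]}$ (resp. $X_k^{[R]}$) be the number of indices $i$ with $a_i=k$ (resp. $b_i=k$), i.e. the number of parts equal to $k$ to the left (resp. right) of the peak, and let $B=\sqrt6/\pi$. **Theorem 1.5.** (i) Let $k_n\in\mathbb N_0$ with $k_n=o(n^{1/4})$, and for every $n$ let $v_{n,2k-1}^{[j]}\in[0,\infty)$ be given for $1\le k\le k_n$ and $j\in\{L,R\}$. Then $$\lim_{n\to\infty}\left(\mathbf P_n\left(\frac{(2k-1)X_{2k-1}^{[j]}}{B\sqrt n}\le v_{n,2k-1}^{[j]}\ \text{ for all } 1\le k\le k_n,\ j\in\{L,R\}\right)-\prod_{\substack{1\le k\le k_n\\ j\in\{L,R\}}}\int_0^{v_{n,2k-1}^{[j]}}e^{-u}\,du\right)=0 .$$ (ii)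 Let $k_n\ge1$ be integers with $k_n=o(n^{1/2})$, and let $v^{[L]},v^{[R]}\in\mathbb R$. Then $$\lim_{n\to\infty}\mathbf P_n\left(\frac{(2k_n-1)X_{2k_n-1}^{[L]}}{B\sqrt n}\le v^{[L]},\ \frac{(2k_n-1)X_{2k_n-1}^{[R]}}{B\sqrt n}\le v^{[R]}\right)=\left(1-e^{-\max(v^{[L]},0)}\right)\left(1-e^{-\max(v^{[R]},0)}\right).$$ (iii) Let $c>0$ and $v^{[L]},v^{[R]}\in\mathbb N_0$. Then, as $n\to\infty$ through those $n$ for which $\lfloor c\sqrt n\rfloor$ is odd, with $2k-1=\lfloor c\sqrt n\rfloor$, $$\lim_{n\to\infty}\mathbf P_n\left(X_{2k-1}^{[L]}\le v^{[L]},\ X_{2k-1}^{[R]}\le v^{[R]}\right)=\left(1-e^{-\frac cB(v^{[L]}+1)}\right)\left(1-e^{-\frac cB(v^{[R]}+1)}\right).$$ -/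

import Mathlib

open Filter Topology Asymptotics MeasureTheory ProbabilityTheory

/-- The two sides of the peak. -/
inductive Side where
  | L : Side
  | R : Side
  deriving DecidableEq

instance : Fintype Side where
  elems := {Side.L, Side.R}
  complete := fun j => by cases j <;> simp

/-- An odd unimodal sequence `a₁ ≤ … ≤ a_r ≤ c ≥ b₁ ≥ … ≥ b_s` with distinguished peak `c`, all of
whose entries are odd positive integers; `r = 0` and `s = 0` are allowed. -/
structure OddUnimodalSeq where
  left : List ℕ
  peak : ℕ
  right : List ℕ
  left_sorted : left.Pairwise (· ≤ ·)
  left_le_peak : ∀ a ∈ left, a ≤ peak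
  right_sorted : right.Pairwise (· ≥ ·)
  right_le_peak : ∀ b ∈ right, b ≤ peak
  left_odd : ∀ a ∈ left, Odd a
  peak_odd : Odd peak
  right_odd : ∀ b ∈ right, Odd b

namespace OddUnimodalSeq

/-- The size (weight): the sum of all entries, the peak included. -/
def size (s : OddUnimodalSeq) : ℕ := s.left.sum + s.peak + s.right.sum

/-- The entries on a given side of the peak (the peak itself is on neither side). -/
def parts (s : OddUnimodalSeq) : Side → List ℕ
  | Side.L => s.left
  | Side.R => s.right

/-- `X j k s` is the number of entries of `s` on the side `j` of the peak that are equal to `k`. -/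
def X (j : Side) (k : ℕ) (s : OddUnimodalSeq) : ℕ := (s.parts j).count k

instance : MeasurableSpace OddUnimodalSeq := ⊤

instance : MeasurableSingletonClass OddUnimodalSeq := ⟨fun _ => trivial⟩

/-- The set of odd unimodal sequences of size `n`. -/
def ofSize (n : ℕ) : Set OddUnimodalSeq := {s | s.size = n}

theorem finite_ofSize (n : ℕ) : (ofSize n).Finite := by
  have hsum : ∀ s : ofSize n, (s.1.left ++ s.1.peak :: s.1.right).sum = n := by
    rintro ⟨s, hs⟩
    have h : s.left.sum + s.peak + s.right.sum = n := hs
    simp only [List.sum_append, List.sum_cons]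
    omega
  have hpos : ∀ s : OddUnimodalSeq, ∀ i ∈ s.left ++ s.peak :: s.right, 0 < i := by
    intro s i hi
    simp only [List.mem_append, List.mem_cons] at hi
    rcases hi with h | h | h
    · exact (s.left_odd i h).pos
    · exact h ▸ s.peak_odd.pos
    · exact (s.right_odd i h).pos
  let f : ofSize n → Composition n × Fin (n + 1) := fun s =>
    (⟨s.1.left ++ s.1.peak :: s.1.right, fun {i} hi => hpos s.1 i hi, hsum s⟩,
      ⟨s.1.left.length, by
        have h1 : (s.1.left ++ s.1.peak :: s.1.right).length ≤ n :=
          (List.length_le_sum_of_one_le _ (fun i hi => hpos s.1 i hi)).trans (hsum s).le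
        simp only [List.length_append, List.length_cons] at h1
        omega⟩)
  have hf : Function.Injective f := by
    rintro ⟨⟨l, p, r, _, _, _, _, _, _, _⟩, _⟩ ⟨⟨l', p', r', _, _, _, _, _, _, _⟩, _⟩ h
    simp only [f, Prod.mk.injEq, Composition.mk.injEq, Fin.mk.injEq] at h
    obtain ⟨h1, h2⟩ := List.append_inj h.1 h.2
    simp only [List.cons.injEq] at h2
    obtain ⟨h2, h3⟩ := h2
    subst h1 h2 h3
    rfl
  exact Set.finite_coe_iff.mp (Finite.of_injective f hf)

theorem nonempty_ofSize {n : ℕ} (hn : 1 ≤ n) : (ofSize n).Nonempty := by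
  refine ⟨⟨List.replicate (n - 1) 1, 1, [], by simp, ?_, by simp, by simp, ?_, odd_one, by simp⟩, ?_⟩
  · intro a ha
    rw [List.eq_of_mem_replicate ha]
  · intro a ha
    rw [List.eq_of_mem_replicate ha]
    exact odd_one
  · simp [ofSize, size, Nat.sub_add_cancel hn]

/-- The uniform probability measure on the odd unimodal sequences of size `n`. -/
noncomputable def P (n : ℕ) : Measure OddUnimodalSeq := uniformOn (ofSize n)

theorem isProbabilityMeasure_P {n : ℕ} (hn : 1 ≤ n) : IsProbabilityMeasure (P n) :=
  isProbabilityMeasure_uniformOn (finite_ofSize n) (nonempty_ofSize hn)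

theorem P_real_apply (n : ℕ) (A : Set OddUnimodalSeq) :
    (P n).real A = ((ofSize n ∩ A).ncard : ℝ) / (ofSize n).ncard := by
  classical
  rw [Measure.real, P, uniformOn, cond_apply (finite_ofSize n).measurableSet,
    Measure.count_apply_finite _ (finite_ofSize n),
    Measure.count_apply_finite _ ((finite_ofSize n).inter_of_left A),
    Set.ncard_eq_toFinset_card _ (finite_ofSize n),
    Set.ncard_eq_toFinset_card _ ((finite_ofSize n).inter_of_left A)]
  simp [ENNReal.toReal_mul, ENNReal.toReal_inv, div_eq_inv_mul]

/-- The constant `B = √6 / π`. -/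
noncomputable def B : ℝ := √6 / Real.pi

end OddUnimodalSeq

/-! Fix `t = tilt n = π / √(6 n) = 1 / (B √n)` and let every odd `k` occur on each side an
independent geometric number of times, with ratio `exp (-t k)`. Conditioned on its total size, this
Boltzmann model is uniform on pairs of multisets of odd numbers. The theorem says that, for few
enough parts, neither the peak nor the conditioning on the size is felt: the multiplicities remain
almost independent and geometric. The limits in the statement are then limits of products of
geometric distribution functions.

The peak is handled by an identity. If `P_c` is the generating function of the pairs with parts at
most `c`, then `P_c (1 - q^c)^2` is the generating function of the pairs with parts below `c`, and
`q^c P_c` counts the sequences with peak `c`. Summing over `c` telescopes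
(`card_multisetPairs_telescope`): twice the number of sequences is the number of pairs plus a term
from pairs with equal maxima. That term is negligible (`eventually_tiedCount_le`), because the
largest part is typically much larger than `1 / t`, so that the factor `exp (-t c)` is small. The
same identity, with a finite set `R` of parts removed, bounds from below the number of sequences
with prescribed multiplicities on `R`; peaks at most `L / t` cost only an exponentially small amount
(`eventually_boltzNorm_le`).

The conditioning is handled by Fourier inversion. The total size has mean `n + O(1 / t)` and
standard deviation of order `t^(-3/2)`. Third-order Gaussian comparison near the origin and a
uniform decay bound elsewhere (`norm_boltzChar_le`) show that size `n` has probability at least a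
constant times `σ = t^(3/2)` (`eventually_le_boltzMass`). Deleting `R` and shifting the size by `m`
changes the probability by `O((m + |R| / t) σ^2)` (`abs_boltzMass_sdiff_sub_le`), a relative error
`O(m σ + |R| √t)`. As `m` is typically at most of order `|R| / t`, this vanishes when `|R| =
o(n^(1/4))`.

Only one-sided estimates are needed: a lower bound for the point masses, on a set carrying almost
all of a product of geometric laws, already forces closeness in total variation
(`abs_measureReal_sub_le_of_singleton`). -/

/-! ### Characteristic functions of geometric laws -/

/-- The mean of the geometric law on `ℕ` with success probability `1 - exp (-x)`. -/
noncomputable def meanOcc (x : ℝ) : ℝ := 1 / (Real.exp x - 1)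

/-- The variance of the geometric law on `ℕ` with success probability `1 - exp (-x)`. -/
noncomputable def varOcc (x : ℝ) : ℝ := meanOcc x * (1 + meanOcc x)

/-- The characteristic function of a geometric law, in terms of its mean. -/
noncomputable def geomChar (μ α : ℝ) : ℂ := 1 / (1 - μ * (Complex.exp (Complex.I * α) - 1))

/-- Both `|e^{iα} - 1|^2` and `-2 Re (e^{iα} - 1)` equal `4 sin^2 (α/2)`, with weights `μ^2` and
`μ`. Thus the decay of the characteristic function is governed by the variance `μ (1 + μ)`. -/
theorem normSq_geomChar_denom (μ α : ℝ) :
    ‖1 - (μ : ℂ) * (Complex.exp (Complex.I * α) - 1)‖ ^ 2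
      = 1 + 4 * (μ * (1 + μ)) * Real.sin (α / 2) ^ 2 := by
  have h1 : Complex.exp (Complex.I * α) = Real.cos α + Real.sin α * Complex.I := by
    rw [mul_comm, Complex.exp_mul_I, Complex.ofReal_cos, Complex.ofReal_sin]
  rw [← Complex.normSq_eq_norm_sq, h1, Complex.normSq_apply]
  simp only [Complex.sub_re, Complex.one_re, Complex.mul_re, Complex.ofReal_re, Complex.add_re,
    Complex.I_re, Complex.I_im, Complex.ofReal_im, Complex.sub_im, Complex.one_im, Complex.mul_im,
    Complex.add_im]
  have h2 : Real.cos α = 1 - 2 * Real.sin (α / 2) ^ 2 := by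
    have := Real.cos_sq_add_sin_sq (α / 2)
    have h := Real.cos_two_mul (α / 2)
    rw [show 2 * (α / 2) = α by ring] at h
    linarith
  have h3 := Real.sin_sq_add_cos_sq α
  have h4 : Real.sin α ^ 2 = 1 - (1 - 2 * Real.sin (α / 2) ^ 2) ^ 2 := by rw [← h2]; linarith
  rw [h2]
  ring_nf
  rw [h4]
  ring_nf

theorem norm_geomChar_sq (μ α : ℝ) :
    ‖geomChar μ α‖ ^ 2 = (1 + 4 * (μ * (1 + μ)) * Real.sin (α / 2) ^ 2)⁻¹ := by
  rw [geomChar, norm_div, norm_one, div_pow, normSq_geomChar_denom, one_pow, one_div]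

theorem one_le_norm_geomChar_denom {μ : ℝ} (hμ : 0 ≤ μ) (α : ℝ) :
    1 ≤ ‖1 - (μ : ℂ) * (Complex.exp (Complex.I * α) - 1)‖ := by
  have h := normSq_geomChar_denom μ α
  have h2 : 0 ≤ 4 * (μ * (1 + μ)) * Real.sin (α / 2) ^ 2 := by positivity
  nlinarith [norm_nonneg (1 - (μ : ℂ) * (Complex.exp (Complex.I * α) - 1))]

theorem geomChar_denom_ne_zero {μ : ℝ} (hμ : 0 ≤ μ) (α : ℝ) :
    1 - (μ : ℂ) * (Complex.exp (Complex.I * α) - 1) ≠ 0 := by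
  have := one_le_norm_geomChar_denom hμ α
  intro h
  rw [h, norm_zero] at this
  linarith

theorem norm_geomChar_le_one {μ : ℝ} (hμ : 0 ≤ μ) (α : ℝ) : ‖geomChar μ α‖ ≤ 1 := by
  rw [geomChar, norm_div, norm_one]
  exact (div_le_one (by linarith [one_le_norm_geomChar_denom hμ α])).2
    (one_le_norm_geomChar_denom hμ α)

theorem norm_geomChar_sub_one_le {μ : ℝ} (hμ : 0 ≤ μ) (α : ℝ) :
    ‖geomChar μ α - 1‖ ≤ μ * |α| := by
  have h := geomChar_denom_ne_zero hμ α
  have h1 : geomChar μ α - 1 = geomChar μ α * (μ * (Complex.exp (Complex.I * α) - 1)) := by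
    rw [geomChar]; field_simp; ring
  rw [h1, norm_mul, norm_mul, Complex.norm_real, Real.norm_of_nonneg hμ]
  have h2 := Real.norm_exp_I_mul_ofReal_sub_one_le (x := α)
  rw [Real.norm_eq_abs] at h2
  calc _ ≤ 1 * (μ * |α|) := by gcongr; exact norm_geomChar_le_one hμ α
    _ = _ := one_mul _

theorem hasDerivAt_exp_I_mul (x : ℝ) :
    HasDerivAt (fun y : ℝ => Complex.exp (Complex.I * y))
      (Complex.I * Complex.exp (Complex.I * x)) x := by
  have h : HasDerivAt (fun y : ℝ => Complex.I * (y : ℂ)) (Complex.I * 1) x :=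
    (Complex.ofRealCLM.hasDerivAt (x := x)).const_mul Complex.I
  simpa [mul_comm] using h.cexp

theorem norm_sub_zero_le_of_deriv_le {f f' : ℝ → ℂ} (hf : ∀ x, HasDerivAt f (f' x) x) {α C : ℝ}
    (hC : ∀ x, |x| ≤ |α| → ‖f' x‖ ≤ C) : ‖f α - f 0‖ ≤ C * |α| := by
  have h := (convex_closedBall (0 : ℝ) |α|).norm_image_sub_le_of_norm_hasDerivWithin_le
    (f := f) (f' := f') (C := C) (fun x _ => (hf x).hasDerivWithinAt)
    (fun x hx => hC x (by simpa using hx)) (x := 0) (y := α) (by simp) (by simp)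
  simpa using h

theorem norm_exp_I_mul_sub_one_sub_le (α : ℝ) :
    ‖Complex.exp (Complex.I * α) - 1 - Complex.I * α‖ ≤ α ^ 2 := by
  have h := norm_sub_zero_le_of_deriv_le
    (f := fun x : ℝ => Complex.exp (Complex.I * x) - 1 - Complex.I * x)
    (f' := fun x : ℝ => Complex.I * Complex.exp (Complex.I * x) - Complex.I * 1)
    (fun x => ((hasDerivAt_exp_I_mul x).sub_const 1).sub
      ((Complex.ofRealCLM.hasDerivAt (x := x)).const_mul Complex.I))
    (α := α) (C := |α|) (fun x hx => by
      rw [← mul_sub, norm_mul, Complex.norm_I, one_mul]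
      have := Real.norm_exp_I_mul_ofReal_sub_one_le (x := x)
      rw [Real.norm_eq_abs] at this
      exact this.trans hx)
  simpa [← pow_two] using h

/-- Third-order comparison of a geometric characteristic function with the Gaussian one of the same
mean and variance. -/
theorem norm_geomChar_sub_gaussian_le {μ : ℝ} (hμ : 0 ≤ μ) (α : ℝ) :
    ‖geomChar μ α - Complex.exp (Complex.I * (μ * α) - (μ * (1 + μ)) * α ^ 2 / 2)‖
      ≤ μ * (1 + μ) * (1 + 2 * μ) * |α| ^ 3 := by
  set w : ℝ → ℂ := fun x => Complex.I * (μ * x) - (μ * (1 + μ)) * x ^ 2 / 2 with hw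
  have hwd : ∀ x : ℝ, HasDerivAt w (Complex.I * (μ * 1) - (μ * (1 + μ)) * (2 * x) / 2) x := by
    intro x
    have h1 := Complex.ofRealCLM.hasDerivAt (x := x)
    have h2 := ((h1.pow 2).const_mul ((μ : ℂ) * (1 + μ))).div_const 2
    have h3 := ((h1.const_mul (μ : ℂ)).const_mul Complex.I).sub h2
    exact h3.congr_deriv (by simp)
  have hwn : ∀ x : ℝ, ‖Complex.exp (w x)‖ ≤ 1 := by
    intro x
    have : w x = ((-(μ * (1 + μ) * x ^ 2 / 2) : ℝ) : ℂ) + ((μ * x : ℝ) : ℂ) * Complex.I := by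
      simp only [hw]; push_cast; ring
    rw [Complex.norm_exp, this]
    simp only [Complex.add_re, Complex.ofReal_re, Complex.re_ofReal_mul, Complex.I_re, mul_zero,
      add_zero, Real.exp_le_one_iff]
    have : 0 ≤ μ * (1 + μ) * x ^ 2 := by positivity
    linarith
  set e : ℝ → ℂ := fun x => Complex.exp (Complex.I * x) with he
  -- The Gaussian times the denominator of `geomChar` equals `1` at the origin. Because mean and
  -- variance match, its derivative is `O(x^2)`; integrating gives the cubic error, and multiplying
  -- by `geomChar`, of modulus at most `1`, returns to the difference itself.
  have hF : ∀ x : ℝ, HasDerivAt (fun y : ℝ => Complex.exp (w y) * (1 - μ * (e y - 1)))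
      (Complex.exp (w x) * ((μ * (1 + μ)) *
        (-Complex.I * (e x - 1 - Complex.I * x) + μ * x * (e x - 1)))) x := by
    intro x
    have h1 := ((((hasDerivAt_exp_I_mul x).sub_const 1).const_mul (μ : ℂ)).const_sub 1)
    refine ((hwd x).cexp.mul h1).congr_deriv ?_
    simp only [he]
    have : Complex.I * Complex.I = -1 := Complex.I_mul_I
    linear_combination (-Complex.exp (w x) * (μ * (1 + μ)) * x) * this
  have h := norm_sub_zero_le_of_deriv_le hF (α := α) (C := μ * (1 + μ) * (1 + 2 * μ) * α ^ 2) (by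
    intro x hx
    have hx2 : x ^ 2 ≤ α ^ 2 := sq_le_sq.2 hx
    have h1 := norm_exp_I_mul_sub_one_sub_le x
    have h2 := Real.norm_exp_I_mul_ofReal_sub_one_le (x := x)
    have h3 : ‖-Complex.I * (e x - 1 - Complex.I * x) + μ * x * (e x - 1)‖
        ≤ (1 + 2 * μ) * α ^ 2 := by
      refine (norm_add_le _ _).trans ?_
      rw [norm_mul, norm_mul, norm_mul, norm_neg, Complex.norm_I, Complex.norm_real,
        Complex.norm_real, Real.norm_of_nonneg hμ]
      have h4 : ‖x‖ * ‖e x - 1‖ ≤ ‖x‖ * ‖x‖ := by gcongr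
      rw [← pow_two, Real.norm_eq_abs, sq_abs] at h4
      rw [Real.norm_eq_abs] at *
      nlinarith
    rw [norm_mul, norm_mul]
    have h5 : ‖(μ : ℂ) * (1 + μ)‖ = μ * (1 + μ) := by
      rw [← Complex.ofReal_one, ← Complex.ofReal_add, ← Complex.ofReal_mul, Complex.norm_real,
        Real.norm_of_nonneg (by positivity)]
    rw [h5]
    calc _ ≤ 1 * (μ * (1 + μ) * ((1 + 2 * μ) * α ^ 2)) := by gcongr; exact hwn x
      _ = _ := by ring)
  have hd := geomChar_denom_ne_zero hμ α
  have h0 : geomChar μ α - Complex.exp (w α)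
      = -geomChar μ α * (Complex.exp (w α) * (1 - μ * (e α - 1)) - 1) := by
    simp only [geomChar, he]; field_simp; ring
  have h00 : Complex.exp (w 0) * (1 - μ * (e 0 - 1)) = 1 := by simp [hw, he]
  rw [h00] at h
  change ‖geomChar μ α - Complex.exp (w α)‖ ≤ _
  rw [h0, norm_mul, norm_neg]
  calc _ ≤ 1 * (μ * (1 + μ) * (1 + 2 * μ) * α ^ 2 * |α|) := by
        gcongr; exact norm_geomChar_le_one hμ α
    _ = _ := by rw [pow_succ |α| 2, sq_abs]; ring

/-! ### Estimates for the mean and variance of a geometric law -/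

/-- This is `x/2 ≤ sinh (x/2)` multiplied by `2 exp (x/2)`. It yields the exponential decay that
makes the sums over all parts converge. -/
theorem mul_exp_half_le_exp_sub_one {x : ℝ} (hx : 0 ≤ x) :
    x * Real.exp (x / 2) ≤ Real.exp x - 1 := by
  have h := Real.self_le_sinh_iff.2 (show 0 ≤ x / 2 by linarith)
  rw [Real.sinh_eq] at h
  have h1 : Real.exp x = Real.exp (x / 2) * Real.exp (x / 2) := by rw [← Real.exp_add]; ring_nf
  have h2 : Real.exp (x / 2) * Real.exp (-(x / 2)) = 1 := by rw [← Real.exp_add]; simp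
  nlinarith [Real.exp_pos (x / 2)]

theorem meanOcc_pos {x : ℝ} (hx : 0 < x) : 0 < meanOcc x :=
  one_div_pos.2 (by linarith [Real.add_one_lt_exp hx.ne'])

theorem varOcc_pos {x : ℝ} (hx : 0 < x) : 0 < varOcc x := by
  have := meanOcc_pos hx
  unfold varOcc; positivity

theorem mul_meanOcc_le {x : ℝ} (hx : 0 < x) : x * meanOcc x ≤ Real.exp (-(x / 2)) := by
  have h := mul_exp_half_le_exp_sub_one hx.le
  have h0 : 0 < Real.exp x - 1 := by linarith [Real.add_one_lt_exp hx.ne']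
  rw [meanOcc, mul_one_div, div_le_iff₀ h0, Real.exp_neg, inv_mul_eq_div, le_div_iff₀ (Real.exp_pos _)]
  exact h

theorem meanOcc_le {x : ℝ} (hx : 0 < x) : meanOcc x ≤ 1 / x := by
  unfold meanOcc
  gcongr
  linarith [Real.add_one_le_exp x]

theorem exp_neg_le_inv_pow_two {x : ℝ} (hx : 0 ≤ x) : (x + 1) * (x + 2) * Real.exp (-(x / 2)) ≤
    200 * Real.exp (-(x / 4)) := by
  have h1 : Real.exp (-(x / 2)) = Real.exp (-(x / 4)) * Real.exp (-(x / 4)) := by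
    rw [← Real.exp_add]; ring_nf
  have h2 : (x + 1) * (x + 2) ≤ 200 * Real.exp (x / 4) := by
    have := Real.quadratic_le_exp_of_nonneg (show 0 ≤ x / 4 by linarith)
    nlinarith
  have h3 : Real.exp (x / 4) * Real.exp (-(x / 4)) = 1 := by rw [← Real.exp_add]; simp
  rw [h1]
  have h4 := Real.exp_pos (-(x / 4))
  calc _ = ((x + 1) * (x + 2) * Real.exp (-(x / 4))) * Real.exp (-(x / 4)) := by ring
    _ ≤ (200 * Real.exp (x / 4) * Real.exp (-(x / 4))) * Real.exp (-(x / 4)) := by gcongr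
    _ = _ := by rw [mul_assoc 200, h3, mul_one]

/-- With `y = x * meanOcc x ≤ exp (-x/2) ≤ 1`, the left side is `y (x + y) (x + 2 y)`. Half of the
exponential decay absorbs the polynomial. -/
theorem cube_mul_varOcc_le {x : ℝ} (hx : 0 < x) :
    x ^ 3 * (varOcc x * (1 + 2 * meanOcc x)) ≤ 200 * Real.exp (-(x / 4)) := by
  have h1 := mul_meanOcc_le hx
  have h0 := meanOcc_pos hx
  have h2 : Real.exp (-(x / 2)) ≤ 1 := Real.exp_le_one_iff.2 (by linarith)
  refine le_trans ?_ (exp_neg_le_inv_pow_two hx.le)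
  have e : x ^ 3 * (varOcc x * (1 + 2 * meanOcc x))
    = (x * meanOcc x) * ((x + x * meanOcc x) * (x + 2 * (x * meanOcc x))) := by
    unfold varOcc; ring
  have hy : 0 ≤ x * meanOcc x := by positivity
  rw [e, mul_comm ((x + 1) * (x + 2))]
  gcongr <;> linarith

theorem sq_mul_varOcc_le {x : ℝ} (hx : 0 < x) :
    x ^ 2 * varOcc x ≤ 200 * Real.exp (-(x / 4)) := by
  have h1 := mul_meanOcc_le hx
  have h0 := meanOcc_pos hx
  have h2 : Real.exp (-(x / 2)) ≤ 1 := Real.exp_le_one_iff.2 (by linarith)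
  refine le_trans ?_ (exp_neg_le_inv_pow_two hx.le)
  have e : x ^ 2 * varOcc x = (x * meanOcc x) * ((x + x * meanOcc x) * 1) := by
    unfold varOcc; ring
  have hy : 0 ≤ x * meanOcc x := by positivity
  rw [e, mul_comm ((x + 1) * (x + 2))]
  gcongr <;> linarith

/-- The variance is `e^x / (e^x - 1)^2`, and `e^x - 1 ≤ 2 x` on `(0, 1]`. With `x = t k`, this range
covers the parts up to the scale `1 / t`, which suffice for the decay of the characteristic
function. -/
theorem le_varOcc {x : ℝ} (hx : 0 < x) (hx1 : x ≤ 1) : 1 / (4 * x ^ 2) ≤ varOcc x := by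
  have h0 : 0 < Real.exp x - 1 := by linarith [Real.add_one_lt_exp hx.ne']
  have h1 : varOcc x = Real.exp x / (Real.exp x - 1) ^ 2 := by
    unfold varOcc meanOcc; field_simp; ring
  have h2 : Real.exp x - 1 ≤ 2 * x := by
    have := Real.abs_exp_sub_one_le (x := x) (by rw [abs_of_pos hx]; exact hx1)
    rw [abs_of_pos h0, abs_of_pos hx] at this
    exact this
  rw [h1, div_le_div_iff₀ (by positivity) (by positivity)]
  have : (Real.exp x - 1) ^ 2 ≤ (2 * x) ^ 2 := by gcongr
  nlinarith [Real.add_one_le_exp x, sq_nonneg x]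

/-! ### Uniform decay of the characteristic function of the total size -/

/-- The characteristic function of `∑ k (x + x')`, over the `k` in `S`, where the `x`, `x'` are
independent geometric variables of parameter `exp (- t k)`. -/
noncomputable def boltzChar (t : ℝ) (S : Finset ℕ) (θ : ℝ) : ℂ :=
  ∏ k ∈ S, geomChar (meanOcc (t * k)) (k * θ) ^ 2

theorem norm_boltzChar (t : ℝ) (S : Finset ℕ) (θ : ℝ) :
    ‖boltzChar t S θ‖ = ∏ k ∈ S, (1 + 4 * varOcc (t * k) * Real.sin (k * θ / 2) ^ 2)⁻¹ := by
  rw [boltzChar, norm_prod]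
  exact Finset.prod_congr rfl fun k _ => by rw [norm_pow, norm_geomChar_sq, varOcc]

theorem norm_boltzChar_le_one {t : ℝ} (ht : 0 < t) {S : Finset ℕ} (hS : ∀ k ∈ S, 0 < k) (θ : ℝ) :
    ‖boltzChar t S θ‖ ≤ 1 := by
  rw [boltzChar, norm_prod]
  refine Finset.prod_le_one (fun _ _ => norm_nonneg _) fun k hk => ?_
  rw [norm_pow]
  have : (0 : ℝ) < k := by exact_mod_cast hS k hk
  exact pow_le_one₀ (norm_nonneg _) (norm_geomChar_le_one (meanOcc_pos (by positivity)).le _)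

/-- All factors have modulus at most `1`, so only those with `t k ≤ 1` are kept, and there `4 varOcc
(t k) ≥ 1 / (t k)^2`. -/
theorem norm_boltzChar_mul_prod_le {t : ℝ} (ht : 0 < t) {S : Finset ℕ} (hS : ∀ k ∈ S, 0 < k)
    {I : Finset ℕ} (hI : ∀ i ∈ I, 2 * i + 1 ∈ S) (hI1 : ∀ i ∈ I, t * (2 * i + 1) ≤ 1) (θ : ℝ) :
    ‖boltzChar t S θ‖ * ∏ i ∈ I, (1 + Real.sin ((2 * i + 1) * θ / 2) ^ 2 / (t * (2 * i + 1)) ^ 2)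
      ≤ 1 := by
  have hinj : Set.InjOn (fun i : ℕ => 2 * i + 1) I := fun a _ b _ h => by simpa using h
  have hsub : I.image (fun i => 2 * i + 1) ⊆ S := by
    intro k hk
    obtain ⟨i, hi, rfl⟩ := Finset.mem_image.1 hk
    exact hI i hi
  have h1 : ∀ k ∈ S, 1 ≤ 1 + 4 * varOcc (t * k) * Real.sin (k * θ / 2) ^ 2 := by
    intro k hk
    have hk0 : (0 : ℝ) < k := by exact_mod_cast hS k hk
    have := varOcc_pos (show 0 < t * k by positivity)
    have : 0 ≤ 4 * varOcc (t * k) * Real.sin (k * θ / 2) ^ 2 := by positivity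
    linarith
  have h2 : ∏ i ∈ I, (1 + Real.sin ((2 * i + 1) * θ / 2) ^ 2 / (t * (2 * i + 1)) ^ 2)
      ≤ ∏ k ∈ S, (1 + 4 * varOcc (t * (k : ℕ)) * Real.sin (k * θ / 2) ^ 2) := by
    calc _ ≤ ∏ k ∈ I.image (fun i => 2 * i + 1),
          (1 + 4 * varOcc (t * (k : ℕ)) * Real.sin (k * θ / 2) ^ 2) := by
          rw [Finset.prod_image hinj]
          refine Finset.prod_le_prod (fun i _ => by positivity) fun i hi => ?_
          have hx : 0 < t * (2 * i + 1) := by positivity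
          have h := le_varOcc hx (hI1 i hi)
          push_cast
          have : 1 / (t * (2 * i + 1)) ^ 2 ≤ 4 * varOcc (t * (2 * i + 1)) := by
            calc _ = 4 * (1 / (4 * (t * (2 * (i : ℝ) + 1)) ^ 2)) := by field_simp
              _ ≤ _ := by linarith
          rw [div_eq_mul_one_div, mul_comm]
          gcongr
      _ ≤ _ := by
          refine Finset.prod_le_prod_of_subset_of_one_le hsub
            (fun k hk => by linarith [h1 k (hsub hk)]) fun k hk _ => h1 k hk
  rw [norm_boltzChar, Finset.prod_inv_distrib, inv_mul_le_iff₀, mul_one]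
  · exact h2
  · exact Finset.prod_pos fun k hk => by linarith [h1 k hk]

/-- Product-to-sum telescoping. It bounds the cosine sum by `1 / (2 |sin θ|)`, which gives
cancellation away from `0` and `±π`. -/
theorem sin_mul_sum_cos (θ : ℝ) (N : ℕ) :
    Real.sin θ * ∑ i ∈ Finset.range N, Real.cos ((2 * i + 1) * θ) = Real.sin (2 * N * θ) / 2 := by
  induction N with
  | zero => simp
  | succ N ih =>
    rw [Finset.sum_range_succ, mul_add, ih]
    push_cast
    have h1 : 2 * ((N : ℝ) + 1) * θ = (2 * N + 1) * θ + θ := by ring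
    have h2 : 2 * (N : ℝ) * θ = (2 * N + 1) * θ - θ := by ring
    rw [h1, h2, Real.sin_add, Real.sin_sub]
    ring

theorem two_rpow_sum_le_prod {ι : Type*} (I : Finset ι) (f : ι → ℝ) (h0 : ∀ i ∈ I, 0 ≤ f i)
    (h1 : ∀ i ∈ I, f i ≤ 1) : (2 : ℝ) ^ (∑ i ∈ I, f i) ≤ ∏ i ∈ I, (1 + f i) := by
  rw [Real.rpow_sum_of_pos (by norm_num)]
  refine Finset.prod_le_prod (fun i _ => by positivity) fun i hi => ?_
  have := rpow_one_add_le_one_add_mul_self (s := 1) (by norm_num) (h0 i hi) (h1 i hi)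
  rw [mul_one] at this
  norm_num at this
  exact this

/-- Away from the main peak, the characteristic function is exponentially small. -/
theorem norm_boltzChar_le_of_sum {t : ℝ} (ht : 0 < t) {S : Finset ℕ} (hS : ∀ k ∈ S, 0 < k)
    {M : ℕ} (hM : 4 * M * t ≤ 1) (hM' : 1 ≤ 16 * M * t)
    {I : Finset ℕ} (hI : ∀ i ∈ I, 2 * i + 1 ∈ S) (hI1 : ∀ i ∈ I, i < 2 * M) {θ : ℝ}
    (hθ : |θ| ≤ Real.pi)
    (hsum : (M : ℝ) / 8 ≤ ∑ i ∈ I, Real.sin ((2 * i + 1) * θ / 2) ^ 2) :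
    ‖boltzChar t S θ‖ ≤ 720 * 16 ^ 6 * 50000 ^ 2 / (1 + θ ^ 2 / t ^ 3) ^ 2 := by
  have hI2 : ∀ i ∈ I, t * (2 * i + 1) ≤ 1 := by
    intro i hi
    have : (i : ℝ) + 1 ≤ 2 * M := by exact_mod_cast hI1 i hi
    calc t * (2 * i + 1) ≤ t * (4 * M) := by gcongr; linarith
      _ ≤ 1 := by linarith
  have h := norm_boltzChar_mul_prod_le ht hS hI hI2 θ
  -- Each factor is at least `1 + sin^2 ≥ 2^(sin^2)`, the denominators `(t (2i+1))^2` being at most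
  -- `1`; then `log 2 > 1/2`.
  have hexp : Real.exp (M / 16) ≤
      ∏ i ∈ I, (1 + Real.sin ((2 * i + 1) * θ / 2) ^ 2 / (t * (2 * i + 1)) ^ 2) := by
    calc Real.exp (M / 16) ≤ (2 : ℝ) ^ ((M : ℝ) / 8) := by
          rw [Real.rpow_def_of_pos (by norm_num), Real.exp_le_exp]
          have := Real.log_two_gt_d9
          have hM0 : (0 : ℝ) ≤ M := Nat.cast_nonneg M
          nlinarith
      _ ≤ (2 : ℝ) ^ (∑ i ∈ I, Real.sin ((2 * i + 1) * θ / 2) ^ 2) :=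
          Real.rpow_le_rpow_of_exponent_le (by norm_num) hsum
      _ ≤ ∏ i ∈ I, (1 + Real.sin ((2 * i + 1) * θ / 2) ^ 2) :=
          two_rpow_sum_le_prod I _ (fun i _ => sq_nonneg _) fun i _ => Real.sin_sq_le_one _
      _ ≤ _ := by
          refine Finset.prod_le_prod (fun i _ => by positivity) fun i hi => ?_
          have h3 : (t * (2 * i + 1)) ^ 2 ≤ 1 := pow_le_one₀ (by positivity) (hI2 i hi)
          have h4 := le_div_self (sq_nonneg (Real.sin ((2 * i + 1) * θ / 2))) (by positivity) h3
          linarith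
  have hMp : (0 : ℝ) < M := by
    by_contra h0
    have : (M : ℝ) = 0 := le_antisymm (not_lt.1 h0) (Nat.cast_nonneg M)
    rw [this] at hM'; norm_num at hM'
  -- The sixth power is what is needed: `(1 + θ^2 / t^3)^2` is at most of order `M^6`, since `1 / t
  -- ≤ 16 M` and `θ^2 ≤ 10`.
  have hpow : ((M : ℝ) / 16) ^ 6 / 720 ≤ Real.exp (M / 16) := by
    have := Real.pow_div_factorial_le_exp (x := (M : ℝ) / 16) (by positivity) 6
    norm_num [Nat.factorial] at this ⊢
    exact this
  have hM1 : (1 : ℝ) ≤ M := by exact_mod_cast hMp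
  have hu : 1 + θ ^ 2 / t ^ 3 ≤ 50000 * (M : ℝ) ^ 3 := by
    have h5 : 1 / t ^ 3 ≤ (16 * M) ^ 3 := by
      rw [← one_div_pow]
      have : 1 / t ≤ 16 * M := by rw [div_le_iff₀ ht]; exact hM'
      gcongr
    have h6 : θ ^ 2 ≤ 10 := by
      have : θ ^ 2 ≤ Real.pi ^ 2 := by
        rw [← sq_abs θ]; gcongr
      have := Real.pi_lt_d2
      have := Real.pi_pos
      nlinarith
    calc 1 + θ ^ 2 / t ^ 3 = 1 + θ ^ 2 * (1 / t ^ 3) := by ring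
      _ ≤ 1 + 10 * (16 * (M : ℝ)) ^ 3 := by gcongr
      _ ≤ _ := by nlinarith [one_le_pow₀ (n := 3) hM1]
  have hnn := norm_nonneg (boltzChar t S θ)
  have hu0 : 0 < 1 + θ ^ 2 / t ^ 3 := by positivity
  rw [le_div_iff₀ (by positivity)]
  have h7 : ‖boltzChar t S θ‖ * (((M : ℝ) / 16) ^ 6 / 720) ≤ 1 :=
    le_trans (by gcongr; exact hpow.trans hexp) h
  calc ‖boltzChar t S θ‖ * (1 + θ ^ 2 / t ^ 3) ^ 2
      ≤ ‖boltzChar t S θ‖ * (50000 * (M : ℝ) ^ 3) ^ 2 := by gcongr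
    _ = ‖boltzChar t S θ‖ * (((M : ℝ) / 16) ^ 6 / 720) * (720 * 16 ^ 6 * 50000 ^ 2) := by ring
    _ ≤ 1 * (720 * 16 ^ 6 * 50000 ^ 2) := by gcongr
    _ = _ := by ring

theorem sum_sin_sq_odd (θ : ℝ) (N : ℕ) :
    ∑ i ∈ Finset.range N, Real.sin ((2 * i + 1) * θ / 2) ^ 2
      = N / 2 - (∑ i ∈ Finset.range N, Real.cos ((2 * i + 1) * θ)) / 2 := by
  have : ∀ i : ℕ, Real.sin ((2 * i + 1) * θ / 2) ^ 2
      = 1 / 2 - Real.cos ((2 * i + 1) * θ) / 2 := by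
    intro i
    rw [Real.sin_sq_eq_half_sub]
    ring_nf
  simp_rw [this]
  rw [Finset.sum_sub_distrib, Finset.sum_div]
  simp; ring

/-- Here `M` is of order `1 / t`, and at most `M / 4` of the first `2 M` odd numbers are missing
from `S`. Away from `0` and `±π`, and also near `±π`, the `sin^2` sum is linear in `M`; near `0` a
direct product estimate applies. The square in the denominator is essential later: it leaves an
integrable bound after multiplication by `|θ|`. -/
theorem norm_boltzChar_le {t : ℝ} (ht : 0 < t) {S : Finset ℕ} (hS : ∀ k ∈ S, 0 < k)
    {M : ℕ} (hM4 : 4 ≤ M) (hM : 4 * M * t ≤ 1) (hM' : 1 ≤ 16 * M * t)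
    (hcard : 4 * ((Finset.range (2 * M)).filter (fun i => 2 * i + 1 ∉ S)).card ≤ M) {θ : ℝ}
    (hθ : |θ| ≤ Real.pi) :
    ‖boltzChar t S θ‖ ≤ 720 * 16 ^ 6 * 50000 ^ 2 / (1 + θ ^ 2 / t ^ 3) ^ 2 := by
  set J := (Finset.range (2 * M)).filter (fun i => 2 * i + 1 ∉ S) with hJ
  have hM4' : (4 : ℝ) ≤ M := by exact_mod_cast hM4
  have hcard' : 4 * (J.card : ℝ) ≤ M := by exact_mod_cast hcard
  have hM0 : (0 : ℝ) < M := by linarith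
  set I₁ := (Finset.range M).filter (fun i => 2 * i + 1 ∈ S) with hI₁
  have hI₁S : ∀ i ∈ I₁, 2 * i + 1 ∈ S := fun i hi => (Finset.mem_filter.1 hi).2
  have hI₁M : ∀ i ∈ I₁, i < M := fun i hi => Finset.mem_range.1 (Finset.mem_filter.1 hi).1
  have hI₁c : 3 * (M : ℝ) / 4 ≤ I₁.card := by
    have h1 := Finset.card_filter_add_card_filter_not (s := Finset.range M)
      (fun i => 2 * i + 1 ∈ S)
    have h2 : ((Finset.range M).filter (fun i => ¬ 2 * i + 1 ∈ S)).card ≤ J.card := by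
      refine Finset.card_le_card (Finset.filter_subset_filter _ ?_)
      intro i hi
      simp only [Finset.mem_range] at hi ⊢
      omega
    rw [Finset.card_range, ← hI₁] at h1
    have h3 : (M : ℝ) ≤ I₁.card + J.card := by
      exact_mod_cast (by omega : M ≤ I₁.card + J.card)
    linarith
  -- If `|sin θ| ≥ 1 / (2M)`, the cosine sum over `2 M` terms is at most `M`. Hence the full `sin^2`
  -- sum is at least `M / 2`, and the missing indices remove at most `M / 4`.
  rcases le_or_gt (1 / (2 * M : ℝ)) |Real.sin θ| with hsin | hsin
  · set I := (Finset.range (2 * M)).filter (fun i => 2 * i + 1 ∈ S) with hI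
    refine norm_boltzChar_le_of_sum ht hS hM hM' (I := I)
      (fun i hi => (Finset.mem_filter.1 hi).2)
      (fun i hi => Finset.mem_range.1 (Finset.mem_filter.1 hi).1) hθ ?_
    have h1 := Finset.sum_filter_add_sum_filter_not (Finset.range (2 * M))
      (fun i => 2 * i + 1 ∈ S) (fun i => Real.sin ((2 * i + 1) * θ / 2) ^ 2)
    have h2 : ∑ i ∈ J, Real.sin ((2 * i + 1) * θ / 2) ^ 2 ≤ J.card := by
      have := Finset.sum_le_card_nsmul J (fun i : ℕ => Real.sin ((2 * i + 1) * θ / 2) ^ 2) 1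
        (fun i _ => Real.sin_sq_le_one _)
      simpa using this
    rw [sum_sin_sq_odd] at h1
    have h3 := sin_mul_sum_cos θ (2 * M)
    set c := ∑ i ∈ Finset.range (2 * M), Real.cos ((2 * i + 1) * θ) with hc
    have h4 : |Real.sin θ| * |c| ≤ 1 / 2 := by
      rw [← abs_mul, h3, abs_div, abs_of_pos (two_pos : (0 : ℝ) < 2)]
      gcongr
      exact Real.abs_sin_le_one _
    have h5 : |c| ≤ M := by
      have : 1 / (2 * M : ℝ) * |c| ≤ 1 / 2 := le_trans (by gcongr) h4
      rw [one_div_mul_eq_div, div_le_iff₀ (by positivity)] at this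
      linarith
    have h6 := (abs_le.1 h5).2
    push_cast at h1
    change _ + ∑ i ∈ J, Real.sin ((2 * i + 1) * θ / 2) ^ 2 = _ at h1
    linarith
  · have hpi := Real.pi_pos
    rcases le_or_gt |θ| (Real.pi / 2) with hsmall | hbig
    -- Near the origin all angles `(2i+1) θ / 2` with `i < M` lie in `[-π/2, π/2]`, and Jordan's
    -- inequality bounds every factor below by `1 + θ^2 / (π t)^2`, uniformly in `i`.
    · have hθM : |θ| ≤ Real.pi / (4 * M) := by
        have h1 := Real.mul_abs_le_abs_sin hsmall
        have h2 : 2 / Real.pi * |θ| ≤ 1 / (2 * M) := h1.trans hsin.le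
        rw [div_mul_eq_mul_div, div_le_iff₀ hpi] at h2
        rw [show Real.pi / (4 * M : ℝ) = (1 / (2 * M) * Real.pi) / 2 by field_simp; norm_num]
        linarith
      set y := θ ^ 2 / (Real.pi ^ 2 * t ^ 2) with hy
      have hI2 : ∀ i ∈ I₁, t * (2 * i + 1) ≤ 1 := by
        intro i hi
        have : (i : ℝ) + 1 ≤ M := by exact_mod_cast hI₁M i hi
        calc t * (2 * i + 1) ≤ t * (4 * M) := by gcongr; linarith
          _ ≤ 1 := by linarith
      have h := norm_boltzChar_mul_prod_le ht hS hI₁S hI2 θ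
      have h1 : (1 + y) ^ I₁.card
          ≤ ∏ i ∈ I₁, (1 + Real.sin ((2 * i + 1) * θ / 2) ^ 2 / (t * (2 * i + 1)) ^ 2) := by
        rw [← Finset.prod_const]
        refine Finset.prod_le_prod (fun i _ => by positivity) fun i hi => ?_
        have hi1 : (i : ℝ) + 1 ≤ M := by exact_mod_cast hI₁M i hi
        have hle : |(2 * i + 1) * θ / 2| ≤ Real.pi / 2 := by
          rw [abs_div, abs_mul, abs_of_pos (show (0 : ℝ) < 2 * i + 1 by positivity),
            abs_of_pos (two_pos : (0 : ℝ) < 2)]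
          have : (2 * (i : ℝ) + 1) * |θ| ≤ (4 * M) * (Real.pi / (4 * M)) := by
            gcongr; linarith
          rw [mul_div_cancel₀ _ (by positivity)] at this
          linarith
        have hs := Real.mul_abs_le_abs_sin hle
        have hs2 : (2 / Real.pi * |(2 * i + 1) * θ / 2|) ^ 2 ≤ Real.sin ((2 * i + 1) * θ / 2) ^ 2 := by
          rw [← sq_abs (Real.sin _)]
          gcongr
        rw [mul_pow, sq_abs] at hs2
        have : y ≤ Real.sin ((2 * i + 1) * θ / 2) ^ 2 / (t * (2 * i + 1)) ^ 2 := by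
          rw [le_div_iff₀ (by positivity)]
          refine le_trans (le_of_eq ?_) hs2
          rw [hy]; field_simp
        linarith
      have hy0 : 0 ≤ y := by positivity
      -- Bernoulli's inequality with half the exponent, then squared, since a square is wanted. It
      -- requires `card / 2 ≥ 1`, guaranteed by `M ≥ 4`.
      have h2 : (1 + 3 * M / 8 * y) ^ 2 ≤ (1 + y) ^ I₁.card := by
        have hc1 : 1 ≤ (I₁.card : ℝ) / 2 := by linarith
        have h3 := one_add_mul_self_le_rpow_one_add (s := y) (by linarith) hc1
        have h4 : (1 + y) ^ I₁.card = ((1 + y) ^ ((I₁.card : ℝ) / 2)) ^ 2 := by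
          rw [← Real.rpow_natCast, ← Real.rpow_natCast, ← Real.rpow_mul (by linarith)]
          norm_num
        rw [h4]
        refine pow_le_pow_left₀ (by positivity) (le_trans ?_ h3) 2
        have : 3 * M / 8 * y ≤ I₁.card / 2 * y := mul_le_mul_of_nonneg_right (by linarith) hy0
        linarith
      have h5 : θ ^ 2 / t ^ 3 / 500 ≤ 3 * M / 8 * y := by
        have hp : Real.pi ^ 2 ≤ 10 := by nlinarith [Real.pi_lt_d2]
        have : 1 / 10 ≤ 1 / Real.pi ^ 2 := by gcongr
        calc θ ^ 2 / t ^ 3 / 500 = (θ ^ 2 / t ^ 3) * (1 / 500) := by ring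
          _ ≤ (θ ^ 2 / t ^ 3) * (3 / 8 * (1 / 16) * (1 / 10)) := by gcongr; norm_num
          _ ≤ (θ ^ 2 / t ^ 3) * (3 / 8 * (M * t) * (1 / Real.pi ^ 2)) := by gcongr; linarith
          _ = _ := by rw [hy]; field_simp
      have h6 : ‖boltzChar t S θ‖ * (1 + θ ^ 2 / t ^ 3 / 500) ^ 2 ≤ 1 := by
        refine le_trans ?_ h
        gcongr
        exact le_trans (by gcongr) (h2.trans h1)
      rw [le_div_iff₀ (by positivity)]
      have h7 : (1 + θ ^ 2 / t ^ 3) ^ 2 ≤ 500 ^ 2 * (1 + θ ^ 2 / t ^ 3 / 500) ^ 2 := by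
        rw [← mul_pow]
        gcongr
        have : 0 ≤ θ ^ 2 / t ^ 3 := by positivity
        linarith
      calc _ ≤ ‖boltzChar t S θ‖ * (500 ^ 2 * (1 + θ ^ 2 / t ^ 3 / 500) ^ 2) := by gcongr
        _ = ‖boltzChar t S θ‖ * (1 + θ ^ 2 / t ^ 3 / 500) ^ 2 * 500 ^ 2 := by ring
        _ ≤ 1 * 500 ^ 2 := by gcongr
        _ ≤ _ := by norm_num
    -- Near `±π` oddness enters: `cos ((2i+1) θ) = -cos ((2i+1) (π - |θ|)) ≤ 0`, so every `sin^2` is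
    -- at least `1/2` and there is no second peak.
    · refine norm_boltzChar_le_of_sum ht hS hM hM' hI₁S (fun i hi => by have := hI₁M i hi; omega)
        hθ ?_
      have hη : Real.pi - |θ| ≤ Real.pi / (4 * M) := by
        have h0 : abs (Real.pi - |θ|) ≤ Real.pi / 2 := by rw [abs_le]; constructor <;> linarith
        have h1 := Real.mul_abs_le_abs_sin h0
        have h2 : |Real.sin (Real.pi - |θ|)| = |Real.sin θ| := by
          rw [Real.sin_pi_sub]
          rcases abs_choice θ with h | h <;> rw [h]
          rw [Real.sin_neg, abs_neg]
        rw [h2, abs_of_nonneg (by linarith)] at h1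
        have h2 := h1.trans hsin.le
        rw [div_mul_eq_mul_div, div_le_iff₀ hpi] at h2
        rw [show Real.pi / (4 * M : ℝ) = (1 / (2 * M) * Real.pi) / 2 by field_simp; norm_num]
        linarith
      have hhalf : ∀ i ∈ I₁, 1 / 2 ≤ Real.sin ((2 * i + 1) * θ / 2) ^ 2 := by
        intro i hi
        have hi1 : (i : ℝ) + 1 ≤ M := by exact_mod_cast hI₁M i hi
        have e1 : Real.cos ((2 * i + 1) * θ) = -Real.cos ((2 * i + 1) * (Real.pi - |θ|)) := by
          have e2 : Real.cos ((2 * i + 1) * θ) = Real.cos ((2 * i + 1) * |θ|) := by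
            rcases abs_choice θ with h | h <;> rw [h]
            rw [mul_neg, Real.cos_neg]
          rw [e2, show (2 * (i : ℝ) + 1) * (Real.pi - |θ|)
            = (Real.pi - (2 * i + 1) * |θ|) + i * (2 * Real.pi) by ring,
            Real.cos_add_nat_mul_two_pi, Real.cos_pi_sub, neg_neg]
        have h3 : 0 ≤ Real.cos ((2 * i + 1) * (Real.pi - |θ|)) := by
          have h4 : (2 * (i : ℝ) + 1) * (Real.pi - |θ|) ≤ (2 * M) * (Real.pi / (4 * M)) := by
            gcongr
            linarith
          rw [show (2 * M : ℝ) * (Real.pi / (4 * M)) = Real.pi / 2 by field_simp; norm_num] at h4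
          have h5 : 0 ≤ (2 * (i : ℝ) + 1) * (Real.pi - |θ|) :=
            mul_nonneg (by positivity) (by linarith)
          exact Real.cos_nonneg_of_neg_pi_div_two_le_of_le (by linarith) h4
        rw [Real.sin_sq_eq_half_sub, show 2 * ((2 * (i : ℝ) + 1) * θ / 2) = (2 * i + 1) * θ by ring,
          e1]
        linarith
      have := Finset.card_nsmul_le_sum I₁ _ _ hhalf
      rw [nsmul_eq_mul] at this
      linarith

theorem continuous_geomChar {μ : ℝ} (hμ : 0 ≤ μ) : Continuous (geomChar μ) := by
  unfold geomChar
  refine Continuous.div continuous_const ?_ (geomChar_denom_ne_zero hμ)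
  fun_prop

theorem continuous_boltzChar {t : ℝ} (ht : 0 < t) {S : Finset ℕ} (hS : ∀ k ∈ S, 0 < k) :
    Continuous (boltzChar t S) := by
  unfold boltzChar
  refine continuous_finsetProd _ fun k hk => ?_
  have hk : (0 : ℝ) < k := by exact_mod_cast hS k hk
  exact ((continuous_geomChar (meanOcc_pos (by positivity)).le).comp (by fun_prop)).pow 2

/-! ### Fourier coefficients: size, stability and a lower bound -/

/-- The `m`-th Fourier coefficient, without the factor `1 / (2 π)`, of the characteristic
function. -/
noncomputable def boltzCoeff (t : ℝ) (S : Finset ℕ) (m : ℕ) : ℂ :=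
  ∫ θ in -Real.pi..Real.pi, boltzChar t S θ * Complex.exp (-(Complex.I * (m * θ : ℝ)))

theorem integral_inv_one_add_div_sq_le {σ : ℝ} (hσ : 0 < σ) :
    ∫ θ in -Real.pi..Real.pi, (1 + θ ^ 2 / σ ^ 2)⁻¹ ≤ Real.pi * σ := by
  have h := intervalIntegral.integral_comp_div (a := -Real.pi) (b := Real.pi)
    (fun x : ℝ => (1 + x ^ 2)⁻¹) hσ.ne'
  simp only [div_pow] at h
  rw [h, integral_inv_one_add_sq, smul_eq_mul, mul_comm]
  have h1 := Real.arctan_lt_pi_div_two (Real.pi / σ)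
  have h2 := Real.neg_pi_div_two_lt_arctan (-Real.pi / σ)
  gcongr
  linarith

theorem continuous_inv_one_add_div_sq (σ : ℝ) :
    Continuous fun θ : ℝ => (1 + θ ^ 2 / σ ^ 2)⁻¹ := by
  refine Continuous.inv₀ (by fun_prop) fun θ => ?_
  positivity

theorem norm_exp_neg_I_mul (x : ℝ) : ‖Complex.exp (-(Complex.I * (x : ℝ)))‖ = 1 := by
  rw [← mul_neg, ← Complex.ofReal_neg, Complex.norm_exp_I_mul_ofReal]

theorem norm_boltzCoeff_le {t : ℝ} {S : Finset ℕ} {σ D : ℝ} (hσ : 0 < σ) (hD : 0 ≤ D)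
    (hdom : ∀ θ, |θ| ≤ Real.pi → ‖boltzChar t S θ‖ ≤ D / (1 + θ ^ 2 / σ ^ 2) ^ 2) (m : ℕ) :
    ‖boltzCoeff t S m‖ ≤ D * Real.pi * σ := by
  have hpi := Real.pi_pos
  calc ‖boltzCoeff t S m‖ ≤ ∫ θ in -Real.pi..Real.pi, D * (1 + θ ^ 2 / σ ^ 2)⁻¹ := by
        refine intervalIntegral.norm_integral_le_of_norm_le (by linarith) ?_
          (((continuous_inv_one_add_div_sq σ).const_smul D).intervalIntegrable _ _)
        refine Eventually.of_forall fun θ hθ => ?_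
        rw [norm_mul, norm_exp_neg_I_mul, mul_one]
        refine (hdom θ (abs_le.2 ⟨hθ.1.le, hθ.2⟩)).trans ?_
        rw [div_eq_mul_inv]
        have h1 : 1 ≤ 1 + θ ^ 2 / σ ^ 2 := by
          have : 0 ≤ θ ^ 2 / σ ^ 2 := by positivity
          linarith
        gcongr
        exact le_self_pow₀ h1 two_ne_zero
    _ = D * ∫ θ in -Real.pi..Real.pi, (1 + θ ^ 2 / σ ^ 2)⁻¹ :=
        intervalIntegral.integral_const_mul _ _
    _ ≤ D * (Real.pi * σ) := by gcongr; exact integral_inv_one_add_div_sq_le hσ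
    _ = _ := by ring

/-- There are `2 |R|` factors of modulus at most `1`, each within `|θ| / t` of `1`, because `k *
meanOcc (t k) ≤ 1 / t` for every `k`. -/
theorem norm_sub_boltzChar_le {t : ℝ} (ht : 0 < t) {R : Finset ℕ} (hR : ∀ k ∈ R, 0 < k) (θ : ℝ) :
    ‖boltzChar t R θ - 1‖ ≤ 2 * R.card / t * |θ| := by
  classical
  induction R using Finset.induction_on with
  | empty => simp [boltzChar]
  | insert k R hk ih =>
    have hk0 : (0 : ℝ) < k := by exact_mod_cast hR k (Finset.mem_insert_self k R)
    have ih := ih fun i hi => hR i (Finset.mem_insert_of_mem hi)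
    have hμ := meanOcc_pos (show 0 < t * k by positivity)
    set z := geomChar (meanOcc (t * k)) (k * θ) with hz
    have h1 : ‖z - 1‖ ≤ |θ| / t := by
      refine (norm_geomChar_sub_one_le hμ.le _).trans ?_
      rw [abs_mul, abs_of_pos hk0]
      have := meanOcc_le (show 0 < t * k by positivity)
      calc _ ≤ 1 / (t * k) * (k * |θ|) := by gcongr
        _ = _ := by field_simp
    have h2 : ‖z‖ ≤ 1 := norm_geomChar_le_one hμ.le _
    have e : boltzChar t (insert k R) θ - 1
        = z ^ 2 * (boltzChar t R θ - 1) + z * (z - 1) + (z - 1) := by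
      rw [boltzChar, Finset.prod_insert hk, ← boltzChar]; ring
    rw [e, Finset.card_insert_of_notMem hk]
    refine (norm_add_le _ _).trans ?_
    have h3 : ‖z ^ 2 * (boltzChar t R θ - 1)‖ ≤ 1 * (2 * R.card / t * |θ|) := by
      rw [norm_mul, norm_pow]
      gcongr
      exact pow_le_one₀ (norm_nonneg _) h2
    have h4 : ‖z * (z - 1)‖ ≤ 1 * (|θ| / t) := by
      rw [norm_mul]; gcongr
    have h5 := norm_add_le (z ^ 2 * (boltzChar t R θ - 1)) (z * (z - 1))
    push_cast
    have e2 : 2 * ((R.card : ℝ) + 1) / t * |θ| = 2 * R.card / t * |θ| + |θ| / t + |θ| / t := by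
      field_simp; ring
    rw [e2]
    linarith

theorem boltzChar_sdiff_mul {t : ℝ} {S R : Finset ℕ} (h : R ⊆ S) (θ : ℝ) :
    boltzChar t (S \ R) θ * boltzChar t R θ = boltzChar t S θ :=
  Finset.prod_sdiff h

/-- Shifting the size by `m` and restoring `R` multiply the integrand by functions within `m |θ|`
and `(2 |R| / t) |θ|` of `1`. As the integral lives on `|θ|` of order `σ`, the difference gains a
factor `σ` over the trivial bound. -/
theorem norm_boltzCoeff_sdiff_sub_le {t : ℝ} (ht : 0 < t) {S R : Finset ℕ} (hS : ∀ k ∈ S, 0 < k)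
    (hRS : R ⊆ S) {σ D : ℝ} (hσ : 0 < σ) (hD : 0 ≤ D)
    (hdom : ∀ θ, |θ| ≤ Real.pi → ‖boltzChar t (S \ R) θ‖ ≤ D / (1 + θ ^ 2 / σ ^ 2) ^ 2)
    {n m : ℕ} (hm : m ≤ n) :
    ‖boltzCoeff t (S \ R) (n - m) - boltzCoeff t S n‖
      ≤ (m + 2 * R.card / t) * (D * Real.pi * σ ^ 2) := by
  have hpi := Real.pi_pos
  have hSR : ∀ k ∈ S \ R, 0 < k := fun k hk => hS k (Finset.mem_sdiff.1 hk).1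
  have hcont : ∀ (T : Finset ℕ) (x : ℕ), (∀ k ∈ T, 0 < k) → Continuous fun θ : ℝ =>
      boltzChar t T θ * Complex.exp (-(Complex.I * (x * θ : ℝ))) := fun T x hT =>
    (continuous_boltzChar ht hT).mul (by fun_prop)
  rw [boltzCoeff, boltzCoeff, ← intervalIntegral.integral_sub
    ((hcont _ _ hSR).intervalIntegrable _ _) ((hcont _ _ hS).intervalIntegrable _ _)]
  set K : ℝ := m + 2 * R.card / t with hK
  have hK0 : 0 ≤ K := by positivity
  calc _ ≤ ∫ θ in -Real.pi..Real.pi, (K * D * σ) * (1 + θ ^ 2 / σ ^ 2)⁻¹ := by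
        refine intervalIntegral.norm_integral_le_of_norm_le (by linarith) ?_
          (((continuous_inv_one_add_div_sq σ).const_smul (K * D * σ)).intervalIntegrable _ _)
        refine Eventually.of_forall fun θ hθ => ?_
        have e : boltzChar t (S \ R) θ * Complex.exp (-(Complex.I * ((n - m : ℕ) * θ : ℝ)))
            - boltzChar t S θ * Complex.exp (-(Complex.I * (n * θ : ℝ)))
            = boltzChar t (S \ R) θ * Complex.exp (-(Complex.I * (n * θ : ℝ))) *
              ((Complex.exp (Complex.I * (m * θ : ℝ)) - 1) - (boltzChar t R θ - 1)) := by
          rw [← boltzChar_sdiff_mul hRS]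
          have : Complex.exp (-(Complex.I * ((n - m : ℕ) * θ : ℝ)))
              = Complex.exp (-(Complex.I * (n * θ : ℝ))) * Complex.exp (Complex.I * (m * θ : ℝ)) := by
            rw [← Complex.exp_add]
            push_cast [Nat.cast_sub hm]
            ring_nf
          rw [this]; ring
        rw [e, norm_mul, norm_mul, norm_exp_neg_I_mul, mul_one]
        have h1 : ‖(Complex.exp (Complex.I * (m * θ : ℝ)) - 1) - (boltzChar t R θ - 1)‖
            ≤ K * |θ| := by
          refine (norm_sub_le _ _).trans ?_
          have h2 := Real.norm_exp_I_mul_ofReal_sub_one_le (x := m * θ)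
          rw [Real.norm_eq_abs, abs_mul, Nat.abs_cast] at h2
          have h3 := norm_sub_boltzChar_le ht (fun k hk => hS k (hRS hk)) θ (R := R)
          rw [hK, add_mul]
          exact add_le_add h2 h3
        have hx : 0 ≤ θ ^ 2 / σ ^ 2 := by positivity
        -- The factor `|θ|` consumes one of the two powers in the decay bound and leaves an
        -- integrable function.
        have h4 : |θ| ≤ σ * (1 + θ ^ 2 / σ ^ 2) := by
          have : σ * (1 + θ ^ 2 / σ ^ 2) - |θ| = σ * ((|θ| / σ - 1 / 2) ^ 2 + 3 / 4) := by
            rw [← sq_abs θ]; field_simp; ring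
          have h0 : 0 ≤ σ * ((|θ| / σ - 1 / 2) ^ 2 + 3 / 4) := by positivity
          linarith
        calc _ ≤ D / (1 + θ ^ 2 / σ ^ 2) ^ 2 * (K * (σ * (1 + θ ^ 2 / σ ^ 2))) := by
              gcongr
              · exact hdom θ (abs_le.2 ⟨hθ.1.le, hθ.2⟩)
              · exact h1.trans (by gcongr)
          _ = _ := by field_simp
    _ = (K * D * σ) * ∫ θ in -Real.pi..Real.pi, (1 + θ ^ 2 / σ ^ 2)⁻¹ :=
        intervalIntegral.integral_const_mul _ _
    _ ≤ (K * D * σ) * (Real.pi * σ) := by gcongr; exact integral_inv_one_add_div_sq_le hσ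
    _ = _ := by ring

/-- A function that is dominated and nearly Gaussian near the origin has a large integral. -/
theorem le_re_integral_of_near_gaussian {g : ℝ → ℂ} (hg : Continuous g) {σ a A D V E c : ℝ}
    (hσ : 0 < σ) (ha : a = A * σ) (hA : 1 ≤ A) (haπ : a ≤ Real.pi) (hD : 0 ≤ D) (hV : 0 ≤ V)
    (hVc : V * σ ^ 2 ≤ c)
    (hdom : ∀ θ, |θ| ≤ Real.pi → ‖g θ‖ ≤ D / (1 + θ ^ 2 / σ ^ 2) ^ 2)
    (hgauss : ∀ θ, |θ| ≤ a → ‖g θ - Real.exp (-(V * θ ^ 2 / 2))‖ ≤ E) :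
    2 * σ * Real.exp (-(c / 2)) - 2 * a * E - D * Real.pi * σ / (1 + A ^ 2)
      ≤ (∫ θ in -Real.pi..Real.pi, g θ).re := by
  have hpi := Real.pi_pos
  have hσa : σ ≤ a := by rw [ha]; nlinarith
  have ha0 : 0 < a := hσ.trans_le hσa
  -- On `a ≤ |θ| ≤ π` this dominates `‖g‖`, so `Re g + T` is nonnegative there and the integral may
  -- be restricted to `[-a, a]`. The total integral of `T` is the tail error.
  set T : ℝ → ℝ := fun θ => D / (1 + A ^ 2) * (1 + θ ^ 2 / σ ^ 2)⁻¹ with hT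
  have hTc : Continuous T := (continuous_inv_one_add_div_sq σ).const_smul (D / (1 + A ^ 2))
  have hT0 : ∀ θ, 0 ≤ T θ := fun θ => by simp only [hT]; positivity
  have hre : Continuous fun θ => (g θ).re := Complex.continuous_re.comp hg
  have hF : Continuous fun θ => (g θ).re + T θ := hre.add hTc
  have hi := fun x y => hF.intervalIntegrable (μ := volume) x y
  have htail : ∀ θ, a ≤ |θ| → |θ| ≤ Real.pi → 0 ≤ (g θ).re + T θ := by
    intro θ h1 h2
    have h3 := hdom θ h2
    have h4 := Complex.abs_re_le_norm (g θ)
    have h5 : D / (1 + θ ^ 2 / σ ^ 2) ^ 2 ≤ T θ := by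
      simp only [hT]
      have h6 : A ^ 2 ≤ θ ^ 2 / σ ^ 2 := by
        rw [le_div_iff₀ (by positivity), ← mul_pow, ← ha, ← sq_abs θ]
        gcongr
      have h7 : 0 ≤ θ ^ 2 / σ ^ 2 := by positivity
      rw [pow_two, ← div_div, div_eq_mul_inv (D / _)]
      gcongr
    have := (abs_le.1 (h4.trans (h3.trans h5))).1
    linarith
  have e1 : (∫ θ in -Real.pi..Real.pi, g θ).re = ∫ θ in -Real.pi..Real.pi, (g θ).re := by
    exact (Complex.reCLM.intervalIntegral_comp_comm (hg.intervalIntegrable _ _)).symm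
  have e2 : ∫ θ in -Real.pi..Real.pi, ((g θ).re + T θ)
      = (∫ θ in -Real.pi..Real.pi, (g θ).re) + ∫ θ in -Real.pi..Real.pi, T θ :=
    intervalIntegral.integral_add (hre.intervalIntegrable _ _) (hTc.intervalIntegrable _ _)
  have e3 : ∫ θ in -Real.pi..Real.pi, T θ ≤ D * Real.pi * σ / (1 + A ^ 2) := by
    simp only [hT]
    rw [intervalIntegral.integral_const_mul]
    calc _ ≤ D / (1 + A ^ 2) * (Real.pi * σ) := by
          gcongr; exact integral_inv_one_add_div_sq_le hσ
      _ = _ := by ring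
  have e4 : ∫ θ in -a..a, ((g θ).re + T θ) ≤ ∫ θ in -Real.pi..Real.pi, ((g θ).re + T θ) := by
    rw [← intervalIntegral.integral_add_adjacent_intervals (hi (-Real.pi) (-a)) (hi (-a) Real.pi),
      ← intervalIntegral.integral_add_adjacent_intervals (hi (-a) a) (hi a Real.pi)]
    have h1 : 0 ≤ ∫ θ in -Real.pi..-a, ((g θ).re + T θ) :=
      intervalIntegral.integral_nonneg (by linarith) fun θ hθ => by
        have : |θ| = -θ := abs_of_nonpos (by linarith [hθ.2])
        exact htail θ (by rw [this]; linarith [hθ.2]) (by rw [this]; linarith [hθ.1])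
    have h2 : 0 ≤ ∫ θ in a..Real.pi, ((g θ).re + T θ) :=
      intervalIntegral.integral_nonneg haπ fun θ hθ => by
        have : |θ| = θ := abs_of_nonneg (by linarith [hθ.1])
        exact htail θ (by rw [this]; exact hθ.1) (by rw [this]; exact hθ.2)
    linarith
  have hG : Continuous fun θ : ℝ => Real.exp (-(V * θ ^ 2 / 2)) := by fun_prop
  have e5 : (∫ θ in -a..a, Real.exp (-(V * θ ^ 2 / 2))) - 2 * a * E
      ≤ ∫ θ in -a..a, ((g θ).re + T θ) := by
    have : ∫ θ in -a..a, (Real.exp (-(V * θ ^ 2 / 2)) - E)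
        = (∫ θ in -a..a, Real.exp (-(V * θ ^ 2 / 2))) - 2 * a * E := by
      rw [intervalIntegral.integral_sub (hG.intervalIntegrable _ _)
        (continuous_const.intervalIntegrable _ _), intervalIntegral.integral_const, smul_eq_mul]
      ring
    rw [← this]
    refine intervalIntegral.integral_mono_on (by linarith)
      ((hG.sub continuous_const).intervalIntegrable _ _) (hi _ _) fun θ hθ => ?_
    have h1 := (Complex.abs_re_le_norm _).trans (hgauss θ (abs_le.2 hθ))
    rw [Complex.sub_re, Complex.ofReal_re] at h1
    linarith [(abs_le.1 h1).1, hT0 θ]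
  -- Only the order `σ` matters, so the Gaussian is kept on `[-σ, σ]` alone, where `V θ^2 ≤ c`.
  have e6 : 2 * σ * Real.exp (-(c / 2)) ≤ ∫ θ in -a..a, Real.exp (-(V * θ ^ 2 / 2)) := by
    calc 2 * σ * Real.exp (-(c / 2)) = ∫ _ in -σ..σ, Real.exp (-(c / 2)) := by
          rw [intervalIntegral.integral_const, smul_eq_mul]; ring
      _ ≤ ∫ θ in -σ..σ, Real.exp (-(V * θ ^ 2 / 2)) := by
          refine intervalIntegral.integral_mono_on (by linarith)
            (continuous_const.intervalIntegrable _ _) (hG.intervalIntegrable _ _) fun θ hθ => ?_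
          have : θ ^ 2 ≤ σ ^ 2 := sq_le_sq' hθ.1 hθ.2
          rw [Real.exp_le_exp]
          nlinarith
      _ ≤ _ := by
          refine intervalIntegral.integral_mono_interval (by linarith) (by linarith) hσa ?_
            (hG.intervalIntegrable _ _)
          exact Eventually.of_forall fun θ => (Real.exp_pos _).le
  rw [e1]
  linarith

/-! ### Gaussian approximation of the total size -/

theorem sum_exp_neg_le {c : ℝ} (hc : 0 < c) {S : Finset ℕ} (hS : ∀ k ∈ S, 0 < k) :
    ∑ k ∈ S, Real.exp (-(c * k)) ≤ 1 / c := by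
  have h1 : ∀ k : ℕ, Real.exp (-(c * k)) = Real.exp (-c) ^ k := fun k => by
    rw [← Real.exp_nat_mul]; ring_nf
  have hlt : Real.exp (-c) < 1 := Real.exp_lt_one_iff.2 (by linarith)
  have hsub : S ⊆ insert 0 S := Finset.subset_insert 0 S
  have h0 : 0 ∉ S := fun h => lt_irrefl 0 (hS 0 h)
  have h2 := (hasSum_geometric_of_lt_one (Real.exp_pos (-c)).le hlt)
  have h3 := sum_le_hasSum (insert 0 S) (fun k _ => by positivity) h2
  rw [Finset.sum_insert h0, pow_zero] at h3
  simp_rw [h1]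
  have h4 : (1 - Real.exp (-c))⁻¹ ≤ 1 + 1 / c := by
    have h5 : 1 - Real.exp (-c) = (Real.exp c - 1) / Real.exp c := by
      rw [Real.exp_neg]; field_simp
    have h6 : 0 < Real.exp c - 1 := by linarith [Real.add_one_lt_exp hc.ne']
    rw [h5, inv_div, div_le_iff₀ h6]
    have h7 := Real.add_one_le_exp c
    have : Real.exp c = (1 + 1 / (Real.exp c - 1)) * (Real.exp c - 1) := by
      field_simp; ring
    calc Real.exp c = (1 + 1 / (Real.exp c - 1)) * (Real.exp c - 1) := this
      _ ≤ _ := by gcongr; linarith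
  linarith

theorem sum_cube_varOcc_le {t : ℝ} (ht : 0 < t) {S : Finset ℕ} (hS : ∀ k ∈ S, 0 < k) :
    ∑ k ∈ S, (k : ℝ) ^ 3 * (varOcc (t * k) * (1 + 2 * meanOcc (t * k))) ≤ 800 / t ^ 4 := by
  calc _ ≤ ∑ k ∈ S, 200 / t ^ 3 * Real.exp (-(t / 4 * k)) := by
        refine Finset.sum_le_sum fun k hk => ?_
        have hk : (0 : ℝ) < k := by exact_mod_cast hS k hk
        have h := cube_mul_varOcc_le (show 0 < t * k by positivity)
        rw [show t * (k : ℝ) / 4 = t / 4 * k by ring] at h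
        rw [div_mul_eq_mul_div, le_div_iff₀ (by positivity)]
        refine le_trans (le_of_eq ?_) h
        ring
    _ = 200 / t ^ 3 * ∑ k ∈ S, Real.exp (-(t / 4 * k)) := by rw [Finset.mul_sum]
    _ ≤ 200 / t ^ 3 * (1 / (t / 4)) := by
        gcongr; exact sum_exp_neg_le (by positivity) hS
    _ = _ := by field_simp; norm_num

theorem sum_sq_varOcc_le {t : ℝ} (ht : 0 < t) {S : Finset ℕ} (hS : ∀ k ∈ S, 0 < k) :
    ∑ k ∈ S, (k : ℝ) ^ 2 * varOcc (t * k) ≤ 800 / t ^ 3 := by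
  calc _ ≤ ∑ k ∈ S, 200 / t ^ 2 * Real.exp (-(t / 4 * k)) := by
        refine Finset.sum_le_sum fun k hk => ?_
        have hk : (0 : ℝ) < k := by exact_mod_cast hS k hk
        have h := sq_mul_varOcc_le (show 0 < t * k by positivity)
        rw [show t * (k : ℝ) / 4 = t / 4 * k by ring] at h
        rw [div_mul_eq_mul_div, le_div_iff₀ (by positivity)]
        refine le_trans (le_of_eq ?_) h
        ring
    _ = 200 / t ^ 2 * ∑ k ∈ S, Real.exp (-(t / 4 * k)) := by rw [Finset.mul_sum]
    _ ≤ 200 / t ^ 2 * (1 / (t / 4)) := by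
        gcongr; exact sum_exp_neg_le (by positivity) hS
    _ = _ := by field_simp; norm_num

theorem norm_prod_sq_sub_prod_sq_le {ι : Type*} (S : Finset ι) (z w : ι → ℂ)
    (hz : ∀ i ∈ S, ‖z i‖ ≤ 1) (hw : ∀ i ∈ S, ‖w i‖ ≤ 1) :
    ‖∏ i ∈ S, z i ^ 2 - ∏ i ∈ S, w i ^ 2‖ ≤ ∑ i ∈ S, 2 * ‖z i - w i‖ := by
  classical
  induction S using Finset.induction_on with
  | empty => simp
  | insert k S hk ih =>
    have ih := ih (fun i hi => hz i (Finset.mem_insert_of_mem hi))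
      fun i hi => hw i (Finset.mem_insert_of_mem hi)
    have hzk := hz k (Finset.mem_insert_self k S)
    have hwk := hw k (Finset.mem_insert_self k S)
    rw [Finset.prod_insert hk, Finset.prod_insert hk, Finset.sum_insert hk]
    have hP : ‖∏ i ∈ S, w i ^ 2‖ ≤ 1 := by
      rw [norm_prod]
      refine Finset.prod_le_one (fun _ _ => norm_nonneg _) fun i hi => ?_
      rw [norm_pow]
      exact pow_le_one₀ (norm_nonneg _) (hw i (Finset.mem_insert_of_mem hi))
    have e : z k ^ 2 * ∏ i ∈ S, z i ^ 2 - w k ^ 2 * ∏ i ∈ S, w i ^ 2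
        = z k ^ 2 * (∏ i ∈ S, z i ^ 2 - ∏ i ∈ S, w i ^ 2)
          + (z k - w k) * (z k + w k) * ∏ i ∈ S, w i ^ 2 := by ring
    rw [e]
    have h1 : ‖z k ^ 2 * (∏ i ∈ S, z i ^ 2 - ∏ i ∈ S, w i ^ 2)‖
        ≤ 1 * ∑ i ∈ S, 2 * ‖z i - w i‖ := by
      rw [norm_mul, norm_pow]
      gcongr
      exact pow_le_one₀ (norm_nonneg _) hzk
    have h2 : ‖(z k - w k) * (z k + w k) * ∏ i ∈ S, w i ^ 2‖ ≤ ‖z k - w k‖ * 2 * 1 := by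
      rw [norm_mul, norm_mul]
      gcongr
      exact (norm_add_le _ _).trans (by linarith)
    refine (norm_add_le _ _).trans ?_
    linarith

/-- The mean of `∑ k (x + x')`. -/
noncomputable def boltzMean (t : ℝ) (S : Finset ℕ) : ℝ := 2 * ∑ k ∈ S, (k : ℝ) * meanOcc (t * k)

/-- The variance of `∑ k (x + x')`. -/
noncomputable def boltzVar (t : ℝ) (S : Finset ℕ) : ℝ := 2 * ∑ k ∈ S, (k : ℝ) ^ 2 * varOcc (t * k)

/-- The individual Gaussians multiply to the one with the total mean and variance. The cubic errors
add up, because all factors have modulus at most `1`, and `sum_cube_varOcc_le` bounds their sum. -/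
theorem norm_boltzChar_sub_gaussian_le {t : ℝ} (ht : 0 < t) {S : Finset ℕ} (hS : ∀ k ∈ S, 0 < k)
    (θ : ℝ) :
    ‖boltzChar t S θ - Complex.exp (Complex.I * (boltzMean t S * θ : ℝ))
        * Real.exp (-(boltzVar t S * θ ^ 2 / 2))‖
      ≤ 1600 / t ^ 4 * |θ| ^ 3 := by
  set w : ℕ → ℂ := fun k => Complex.exp (Complex.I * (meanOcc (t * k) * (k * θ : ℝ))
    - (meanOcc (t * k) * (1 + meanOcc (t * k))) * (k * θ : ℝ) ^ 2 / 2) with hw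
  have hμ : ∀ k ∈ S, 0 < meanOcc (t * k) := fun k hk => by
    have hk : (0 : ℝ) < k := by exact_mod_cast hS k hk
    exact meanOcc_pos (by positivity)
  have hprod : ∏ k ∈ S, w k ^ 2 = Complex.exp (Complex.I * (boltzMean t S * θ : ℝ))
        * Real.exp (-(boltzVar t S * θ ^ 2 / 2)) := by
    rw [Complex.ofReal_exp, ← Complex.exp_add]
    simp only [hw, ← Complex.exp_nat_mul]
    rw [← Complex.exp_sum]
    congr 1
    simp only [boltzMean, boltzVar, varOcc]
    push_cast
    rw [mul_assoc 2, Finset.sum_mul, mul_left_comm Complex.I, Finset.mul_sum, Finset.mul_sum,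
      mul_assoc 2, mul_div_assoc, Finset.sum_mul, Finset.sum_div, Finset.mul_sum,
      ← Finset.sum_neg_distrib, ← Finset.sum_add_distrib]
    refine Finset.sum_congr rfl fun k _ => ?_
    ring
  rw [← hprod]
  have hw1 : ∀ k ∈ S, ‖w k‖ ≤ 1 := by
    intro k hk
    have h1 := hμ k hk
    have : Complex.I * (meanOcc (t * k) * (k * θ : ℝ))
        - (meanOcc (t * k) * (1 + meanOcc (t * k))) * (k * θ : ℝ) ^ 2 / 2
        = ((-(meanOcc (t * k) * (1 + meanOcc (t * k)) * (k * θ) ^ 2 / 2) : ℝ) : ℂ)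
          + ((meanOcc (t * k) * (k * θ) : ℝ) : ℂ) * Complex.I := by push_cast; ring
    simp only [hw]
    rw [this, Complex.norm_exp]
    simp only [Complex.add_re, Complex.ofReal_re, Complex.re_ofReal_mul, Complex.I_re, mul_zero,
      add_zero, Real.exp_le_one_iff]
    have : 0 ≤ meanOcc (t * k) * (1 + meanOcc (t * k)) * (k * θ) ^ 2 := by positivity
    linarith
  refine (norm_prod_sq_sub_prod_sq_le S _ w
    (fun k hk => norm_geomChar_le_one (hμ k hk).le _) hw1).trans ?_
  calc _ ≤ ∑ k ∈ S, 2 * |θ| ^ 3 * ((k : ℝ) ^ 3 * (varOcc (t * k) * (1 + 2 * meanOcc (t * k)))) := by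
        refine Finset.sum_le_sum fun k hk => ?_
        have h := norm_geomChar_sub_gaussian_le (hμ k hk).le (k * θ)
        rw [abs_mul, Nat.abs_cast, mul_pow] at h
        calc _ ≤ 2 * (meanOcc (t * k) * (1 + meanOcc (t * k)) * (1 + 2 * meanOcc (t * k))
              * ((k : ℝ) ^ 3 * |θ| ^ 3)) := by gcongr
          _ = _ := by unfold varOcc; ring
    _ = 2 * |θ| ^ 3 * ∑ k ∈ S, ((k : ℝ) ^ 3 * (varOcc (t * k) * (1 + 2 * meanOcc (t * k)))) := by
        rw [Finset.mul_sum]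
    _ ≤ 2 * |θ| ^ 3 * (800 / t ^ 4) := by gcongr; exact sum_cube_varOcc_le ht hS
    _ = _ := by ring

/-- Local lower bound for the mass at `n`, when `n` is close to the mean. -/
theorem le_re_boltzCoeff {t : ℝ} (ht : 0 < t) {S : Finset ℕ} (hS : ∀ k ∈ S, 0 < k) {n : ℕ}
    {σ a A D δ : ℝ} (hσ : 0 < σ) (hσt : σ ^ 2 = t ^ 3) (ha : a = A * σ) (hA : 1 ≤ A)
    (haπ : a ≤ Real.pi) (hD : 0 ≤ D)
    (hdom : ∀ θ, |θ| ≤ Real.pi → ‖boltzChar t S θ‖ ≤ D / (1 + θ ^ 2 / σ ^ 2) ^ 2)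
    (hmean : |boltzMean t S - n| ≤ δ) :
    2 * σ * Real.exp (-800) - 2 * a * (1600 / t ^ 4 * a ^ 3 + a * δ)
      - D * Real.pi * σ / (1 + A ^ 2) ≤ (boltzCoeff t S n).re := by
  have hδ : 0 ≤ δ := (abs_nonneg _).trans hmean
  have hV0 : 0 ≤ boltzVar t S := by
    refine mul_nonneg zero_le_two (Finset.sum_nonneg fun k hk => ?_)
    have hk : (0 : ℝ) < k := by exact_mod_cast hS k hk
    have := varOcc_pos (show 0 < t * k by positivity)
    positivity
  have hV : boltzVar t S * σ ^ 2 ≤ 1600 := by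
    have h := sum_sq_varOcc_le ht hS
    rw [hσt, boltzVar]
    rw [le_div_iff₀ (by positivity)] at h
    linarith
  have h := le_re_integral_of_near_gaussian (c := 1600)
    (g := fun θ => boltzChar t S θ * Complex.exp (-(Complex.I * (n * θ : ℝ))))
    ((continuous_boltzChar ht hS).mul (by fun_prop)) (E := 1600 / t ^ 4 * a ^ 3 + a * δ)
    hσ ha hA haπ hD hV0 hV
    (fun θ hθ => by rw [norm_mul, norm_exp_neg_I_mul, mul_one]; exact hdom θ hθ)
    (fun θ hθ => by
      have h1 := norm_boltzChar_sub_gaussian_le ht hS θ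
      set G : ℝ := Real.exp (-(boltzVar t S * θ ^ 2 / 2)) with hG
      have hG1 : G ≤ 1 := by
        rw [hG, Real.exp_le_one_iff]
        have : 0 ≤ boltzVar t S * θ ^ 2 := by positivity
        linarith
      -- The error splits into the Gaussian approximation and the phase left over because the mean
      -- is not exactly `n`.
      have e : boltzChar t S θ * Complex.exp (-(Complex.I * (n * θ : ℝ))) - G
          = (boltzChar t S θ - Complex.exp (Complex.I * (boltzMean t S * θ : ℝ)) * G)
              * Complex.exp (-(Complex.I * (n * θ : ℝ)))
            + G * (Complex.exp (Complex.I * ((boltzMean t S - n) * θ : ℝ)) - 1) := by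
        have : Complex.exp (Complex.I * ((boltzMean t S - n) * θ : ℝ))
            = Complex.exp (Complex.I * (boltzMean t S * θ : ℝ))
              * Complex.exp (-(Complex.I * (n * θ : ℝ))) := by
          rw [← Complex.exp_add]; push_cast; ring_nf
        rw [this]; ring
      rw [e]
      refine (norm_add_le _ _).trans (add_le_add ?_ ?_)
      · rw [norm_mul, norm_exp_neg_I_mul, mul_one]
        exact h1.trans (by gcongr)
      · rw [norm_mul, Complex.norm_real, Real.norm_of_nonneg (Real.exp_pos _).le]
        have h2 := Real.norm_exp_I_mul_ofReal_sub_one_le (x := (boltzMean t S - n) * θ)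
        rw [Real.norm_eq_abs, abs_mul] at h2
        calc _ ≤ 1 * (δ * a) := by gcongr; exact h2.trans (by gcongr)
          _ = _ := by ring)
  rw [show (1600 : ℝ) / 2 = 800 by norm_num] at h
  exact h

/-! ### The mean of the total size -/

/-- The odd numbers up to `n`. -/
def oddsUpTo (n : ℕ) : Finset ℕ := (Finset.range (n + 1)).filter Odd

theorem mem_oddsUpTo {n k : ℕ} : k ∈ oddsUpTo n ↔ k ≤ n ∧ Odd k := by
  simp [oddsUpTo]

theorem pos_of_mem_oddsUpTo {n k : ℕ} (h : k ∈ oddsUpTo n) : 0 < k := (mem_oddsUpTo.1 h).2.pos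

theorem sum_oddsUpTo (n : ℕ) (f : ℕ → ℝ) :
    ∑ k ∈ oddsUpTo n, f k = ∑ i ∈ Finset.range ((n + 1) / 2), f (2 * i + 1) := by
  have : oddsUpTo n = (Finset.range ((n + 1) / 2)).image (fun i => 2 * i + 1) := by
    ext k
    simp only [mem_oddsUpTo, Finset.mem_image, Finset.mem_range]
    constructor
    · rintro ⟨h1, i, rfl⟩
      exact ⟨i, by omega, rfl⟩
    · rintro ⟨i, h1, rfl⟩
      exact ⟨by omega, i, rfl⟩
  rw [this, Finset.sum_image fun a _ b _ h => by simpa using h]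

/-- The reciprocal of `x / (e^x - 1)` is the slope of the chord of `exp` from `0` to `x`, increasing
by convexity. Monotonicity allows sums to be compared with integrals. -/
theorem antitoneOn_mul_meanOcc : AntitoneOn (fun x => x * meanOcc x) (Set.Ioi 0) := by
  intro x hx y hy hxy
  have hx' : (0 : ℝ) < x := hx
  have hy' : (0 : ℝ) < y := hy
  have h := convexOn_exp.secant_mono (a := 0) (x := x) (y := y) trivial trivial trivial
    hx'.ne' hy'.ne' hxy
  simp only [sub_zero, Real.exp_zero] at h
  have hpos : 0 < (Real.exp x - 1) / x :=
    div_pos (by linarith [Real.add_one_lt_exp hx'.ne']) hx'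
  have := one_div_le_one_div_of_le hpos h
  simpa only [meanOcc, one_div_div, mul_one_div] using this

theorem mul_meanOcc_le_one {x : ℝ} (hx : 0 < x) : x * meanOcc x ≤ 1 :=
  (mul_meanOcc_le hx).trans (Real.exp_le_one_iff.2 (by linarith))

theorem mul_meanOcc_nonneg {x : ℝ} (hx : 0 < x) : 0 ≤ x * meanOcc x :=
  mul_nonneg hx.le (meanOcc_pos hx).le

theorem continuousOn_mul_meanOcc : ContinuousOn (fun x => x * meanOcc x) (Set.Ioi 0) := by
  unfold meanOcc
  refine continuousOn_id.mul (continuousOn_const.div (by fun_prop) fun x hx => ?_)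
  have hx' : (0 : ℝ) < x := hx
  linarith [Real.add_one_lt_exp hx'.ne']

theorem integrableOn_mul_meanOcc : IntegrableOn (fun x => x * meanOcc x) (Set.Ioi 0) := by
  have h : IntegrableOn (fun x : ℝ => Real.exp (-(1 / 2) * x)) (Set.Ioi 0) :=
    integrableOn_exp_mul_Ioi (by norm_num) 0
  refine Integrable.mono' h
    (continuousOn_mul_meanOcc.aestronglyMeasurable measurableSet_Ioi) ?_
  refine (ae_restrict_iff' measurableSet_Ioi).2 (Eventually.of_forall fun x hx => ?_)
  rw [Real.norm_of_nonneg (mul_meanOcc_nonneg hx)]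
  exact (mul_meanOcc_le hx).trans (le_of_eq (by ring_nf))

/-- Expanding `1 / (e^x - 1)` as a geometric series, the integral is the Mellin transform at `2`,
namely `Γ(2) ζ(2)`. -/
theorem integral_mul_meanOcc : ∫ x in Set.Ioi (0 : ℝ), x * meanOcc x = Real.pi ^ 2 / 6 := by
  have h := hasSum_mellin (a := fun _ : ℕ => (1 : ℂ)) (p := fun i => (i : ℝ) + 1)
    (F := fun x => (meanOcc x : ℂ)) (s := 2) (fun i => Or.inr (by positivity)) (by norm_num)
    (fun x hx => by
      have hx' : (0 : ℝ) < x := hx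
      have hlt : Real.exp (-x) < 1 := Real.exp_lt_one_iff.2 (by linarith)
      have h1 := (hasSum_geometric_of_lt_one (Real.exp_pos (-x)).le hlt).mul_left (Real.exp (-x))
      have h2 : Real.exp (-x) * (1 - Real.exp (-x))⁻¹ = meanOcc x := by
        have : 0 < Real.exp x - 1 := by linarith [Real.add_one_lt_exp hx'.ne']
        have h3 : 1 - Real.exp (-x) = (Real.exp x - 1) / Real.exp x := by
          rw [Real.exp_neg]; field_simp
        rw [h3, meanOcc, Real.exp_neg]; field_simp
      rw [h2] at h1
      refine (Complex.hasSum_ofReal.2 h1).congr_fun fun i => ?_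
      rw [one_mul, ← Real.exp_nat_mul, ← Real.exp_add]
      congr 2
      ring)
    (by
      have := (summable_nat_add_iff 1).2 hasSum_zeta_two.summable
      simpa using this)
  have h0 : HasSum (fun i : ℕ => ((1 / ((i + 1 : ℕ) : ℝ) ^ 2 : ℝ) : ℂ))
      ((Real.pi ^ 2 / 6 : ℝ) : ℂ) := by
    rw [Complex.hasSum_ofReal]
    have := (hasSum_nat_add_iff' 1).2 hasSum_zeta_two
    simpa using this
  have h5 : mellin (fun x => (meanOcc x : ℂ)) 2 = ((Real.pi ^ 2 / 6 : ℝ) : ℂ) := by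
    refine h.unique (h0.congr_fun fun i => ?_)
    have : Complex.Gamma 2 = 1 := by
      simp
    rw [this]
    push_cast
    norm_num
  rw [mellin] at h5
  rw [← Complex.ofReal_inj, ← h5, ← integral_complex_ofReal]
  refine setIntegral_congr_fun measurableSet_Ioi fun x _ => ?_
  norm_num

theorem integral_mul_meanOcc_tail_le {T : ℝ} (hT : 0 < T) :
    ∫ x in Set.Ioi T, x * meanOcc x ≤ 4 / T := by
  have h : IntegrableOn (fun x : ℝ => Real.exp (-(1 / 2) * x)) (Set.Ioi T) :=
    integrableOn_exp_mul_Ioi (by norm_num) T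
  have hsub : Set.Ioi T ⊆ Set.Ioi 0 := Set.Ioi_subset_Ioi hT.le
  calc _ ≤ ∫ x in Set.Ioi T, Real.exp (-(1 / 2) * x) := by
        refine setIntegral_mono_on (integrableOn_mul_meanOcc.mono_set hsub) h measurableSet_Ioi
          fun x hx => ?_
        exact (mul_meanOcc_le (hsub hx)).trans (le_of_eq (by ring_nf))
    _ = 2 * Real.exp (-(T / 2)) := by
        rw [integral_exp_mul_Ioi (by norm_num)]
        ring_nf
    _ ≤ _ := by
        have := Real.add_one_le_exp (T / 2)
        rw [Real.exp_neg, ← div_eq_mul_inv, div_le_div_iff₀ (Real.exp_pos _) hT]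
        linarith

theorem abs_integral_mul_meanOcc_sub_le {t T : ℝ} (ht : 0 < t) (htT : t ≤ T) :
    |(∫ x in t..T, x * meanOcc x) - Real.pi ^ 2 / 6| ≤ t + 4 / T := by
  have hT := ht.trans_le htT
  have h1 := integral_mul_meanOcc_tail_le hT
  have h2 : 0 ≤ ∫ x in Set.Ioi T, x * meanOcc x :=
    setIntegral_nonneg measurableSet_Ioi fun x hx => mul_meanOcc_nonneg (hT.trans hx)
  have i0 := integrableOn_mul_meanOcc
  have e1 : ∫ x in Set.Ioi (0 : ℝ), x * meanOcc x
      = (∫ x in Set.Ioc 0 t, x * meanOcc x) + ∫ x in Set.Ioi t, x * meanOcc x := by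
    rw [← setIntegral_union (Set.Ioc_disjoint_Ioi le_rfl) measurableSet_Ioi
      (i0.mono_set Set.Ioc_subset_Ioi_self) (i0.mono_set (Set.Ioi_subset_Ioi ht.le)),
      Set.Ioc_union_Ioi_eq_Ioi ht.le]
  have e2 : ∫ x in Set.Ioi t, x * meanOcc x
      = (∫ x in Set.Ioc t T, x * meanOcc x) + ∫ x in Set.Ioi T, x * meanOcc x := by
    rw [← setIntegral_union (Set.Ioc_disjoint_Ioi le_rfl) measurableSet_Ioi
      (i0.mono_set (Set.Ioc_subset_Ioi_self.trans (Set.Ioi_subset_Ioi ht.le)))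
      (i0.mono_set (Set.Ioi_subset_Ioi hT.le)), Set.Ioc_union_Ioi_eq_Ioi htT]
  have h3 : 0 ≤ ∫ x in Set.Ioc 0 t, x * meanOcc x :=
    setIntegral_nonneg measurableSet_Ioc fun x hx => mul_meanOcc_nonneg hx.1
  have h4 : ∫ x in Set.Ioc 0 t, x * meanOcc x ≤ t := by
    calc _ ≤ ∫ _ in Set.Ioc 0 t, (1 : ℝ) := by
          refine setIntegral_mono_on (i0.mono_set Set.Ioc_subset_Ioi_self) (by simp)
            measurableSet_Ioc fun x hx => mul_meanOcc_le_one hx.1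
      _ = t := by simp [ht.le]
  rw [integral_mul_meanOcc] at e1
  rw [intervalIntegral.integral_of_le htT, abs_le]
  constructor <;> linarith

/-- Up to the factor `2 / t`, the mean is a sum of `x / (e^x - 1)` over points of mesh `2 t`, so its
main term is `π^2 / (6 t^2) = n`. An error `O(1 / t)` is harmless against fluctuations of order
`t^(-3/2)`. -/
theorem abs_boltzMean_sub_le {t : ℝ} (ht : 0 < t) {n : ℕ} (hn : 0 < n)
    (htn : t ^ 2 * n = Real.pi ^ 2 / 6) :
    |boltzMean t (oddsUpTo n) - n| ≤ 7 / t := by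
  set N := (n + 1) / 2 with hN
  set h : ℝ → ℝ := fun y => (t * (2 * y + 1)) * meanOcc (t * (2 * y + 1)) with hh
  have hsum : boltzMean t (oddsUpTo n) = 2 / t * ∑ i ∈ Finset.range N, h i := by
    rw [boltzMean, sum_oddsUpTo n (fun k => (k : ℝ) * meanOcc (t * k)), Finset.mul_sum,
      Finset.mul_sum]
    refine Finset.sum_congr rfl fun i _ => ?_
    simp only [hh]
    push_cast
    field_simp
  have hanti : AntitoneOn h (Set.Icc (0 : ℝ) (0 + N)) := by
    intro x hx y hy hxy
    have hx0 : 0 ≤ x := hx.1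
    have hy0 : 0 ≤ y := hy.1
    exact antitoneOn_mul_meanOcc (show 0 < t * (2 * x + 1) by positivity)
      (show 0 < t * (2 * y + 1) by positivity) (by gcongr)
  have hN1 : 1 ≤ N := by omega
  have hlow := hanti.integral_le_sum
  have hupp := hanti.sum_le_integral
  simp only [zero_add] at hlow hupp
  have hint : ∫ x in (0 : ℝ)..N, h x
      = (2 * t)⁻¹ * ∫ x in t..t * (2 * N + 1), x * meanOcc x := by
    have := intervalIntegral.integral_comp_mul_add (a := 0) (b := (N : ℝ))
      (fun x => x * meanOcc x) (show 2 * t ≠ 0 by positivity) t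
    rw [smul_eq_mul] at this
    rw [show t * (2 * (N : ℝ) + 1) = 2 * t * N + t by ring]
    rw [mul_zero, zero_add] at this
    rw [← this]
    refine intervalIntegral.integral_congr fun x _ => ?_
    simp only [hh]
    ring_nf
  -- The two monotone comparisons use sums shifted by one index, which differ by at most `h 0 ≤ 1`.
  have hshift : ∑ i ∈ Finset.range N, h i ≤ 1 + ∑ i ∈ Finset.range N, h ((i + 1 : ℕ) : ℝ) := by
    have h1 := Finset.sum_range_succ' (fun i : ℕ => h i) N
    have h2 := Finset.sum_range_succ (fun i : ℕ => h i) N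
    have h3 : h ((0 : ℕ) : ℝ) ≤ 1 := mul_meanOcc_le_one (by push_cast; positivity)
    have h4 : 0 ≤ h N := mul_meanOcc_nonneg (by positivity)
    linarith
  have hT : t * n ≤ t * (2 * N + 1) := by
    have : (n : ℝ) ≤ 2 * N + 1 := by exact_mod_cast (by omega : n ≤ 2 * N + 1)
    gcongr
  have hn' : (1 : ℝ) ≤ n := by exact_mod_cast hn
  have hb := abs_integral_mul_meanOcc_sub_le ht (T := t * (2 * N + 1)) (by nlinarith)
  set J := ∫ x in t..t * (2 * N + 1), x * meanOcc x with hJ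
  have h4T : 4 / (t * (2 * N + 1)) ≤ 4 * t := by
    have hp : 1 ≤ t ^ 2 * n := by
      rw [htn]; nlinarith [Real.pi_gt_three]
    rw [div_le_iff₀ (by positivity)]
    nlinarith
  have hb2 := abs_le.1 (hb.trans (add_le_add_right h4T t))
  have hnt : (n : ℝ) = 2 / t * ((2 * t)⁻¹ * (Real.pi ^ 2 / 6)) := by
    rw [← htn]; field_simp
  have hJ1 : (2 * t)⁻¹ * J ≤ (2 * t)⁻¹ * (Real.pi ^ 2 / 6) + 5 / 2 := by
    have : (2 * t)⁻¹ * J ≤ (2 * t)⁻¹ * (Real.pi ^ 2 / 6 + 5 * t) := by gcongr; linarith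
    rw [mul_add] at this
    refine this.trans (le_of_eq ?_)
    field_simp
  have hJ2 : (2 * t)⁻¹ * (Real.pi ^ 2 / 6) - 5 / 2 ≤ (2 * t)⁻¹ * J := by
    have : (2 * t)⁻¹ * (Real.pi ^ 2 / 6 - 5 * t) ≤ (2 * t)⁻¹ * J := by gcongr; linarith
    rw [mul_sub] at this
    refine le_trans (le_of_eq ?_) this
    field_simp
  rw [hint] at hlow hupp
  rw [hsum, hnt, ← mul_sub, abs_mul, abs_of_pos (show 0 < 2 / t by positivity)]
  -- Here `5/2` comes from truncating the integral, which costs `5 t`, divided by `2 t`, and `1`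
  -- from the sum-integral comparison.
  have : |∑ i ∈ Finset.range N, h i - (2 * t)⁻¹ * (Real.pi ^ 2 / 6)| ≤ 7 / 2 := by
    rw [abs_le]; constructor <;> linarith
  calc _ ≤ 2 / t * (7 / 2) := by gcongr
    _ = _ := by ring

/-! ### Counting pairs of multisets -/

/-- The finite multisets with sum `m` and all elements in `S` (for `S` consisting of positive
integers). -/
def multisetsOfSum (S : Finset ℕ) (m : ℕ) : Finset (Multiset ℕ) :=
  ((Finset.univ : Finset (Nat.Partition m)).image Nat.Partition.parts).filter fun s => ∀ a ∈ s, a ∈ S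

theorem mem_multisetsOfSum {S : Finset ℕ} (hS : ∀ k ∈ S, 0 < k) {m : ℕ} {s : Multiset ℕ} :
    s ∈ multisetsOfSum S m ↔ (∀ a ∈ s, a ∈ S) ∧ s.sum = m := by
  simp only [multisetsOfSum, Finset.mem_filter, Finset.mem_image, Finset.mem_univ, true_and]
  constructor
  · rintro ⟨⟨p, rfl⟩, h⟩
    exact ⟨h, p.parts_sum⟩
  · rintro ⟨h1, h2⟩
    exact ⟨⟨⟨s, fun hi => hS _ (h1 _ hi), h2⟩, rfl⟩, h1⟩

/-- Either `k` does not occur, or one copy of it can be erased. -/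
theorem card_multisetsOfSum_insert {S : Finset ℕ} (hS : ∀ k ∈ S, 0 < k) {k : ℕ} (hk : 0 < k)
    (hkS : k ∉ S) (m : ℕ) :
    (multisetsOfSum (insert k S) m).card = (multisetsOfSum S m).card
      + if k ≤ m then (multisetsOfSum (insert k S) (m - k)).card else 0 := by
  have hS' : ∀ i ∈ insert k S, 0 < i := by
    intro i hi
    rcases Finset.mem_insert.1 hi with rfl | hi
    · exact hk
    · exact hS i hi
  rw [← Finset.card_filter_add_card_filter_not (s := multisetsOfSum (insert k S) m)
    (fun s => k ∉ s)]
  congr 1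
  · congr 1
    ext s
    simp only [Finset.mem_filter, mem_multisetsOfSum hS, mem_multisetsOfSum hS', Finset.mem_insert]
    constructor
    · rintro ⟨⟨h1, h2⟩, h3⟩
      refine ⟨fun a ha => (h1 a ha).resolve_left ?_, h2⟩
      rintro rfl
      exact h3 ha
    · rintro ⟨h1, h2⟩
      exact ⟨⟨fun a ha => Or.inr (h1 a ha), h2⟩, fun h => hkS (h1 k h)⟩
  · split_ifs with h
    · refine Finset.card_bij' (fun s _ => s.erase k) (fun s _ => k ::ₘ s) ?_ ?_ ?_ ?_
      · intro s hs
        simp only [Finset.mem_filter, mem_multisetsOfSum hS', not_not] at hs ⊢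
        refine ⟨fun a ha => hs.1.1 a (Multiset.mem_of_mem_erase ha), ?_⟩
        have := Multiset.sum_erase hs.2
        omega
      · intro s hs
        simp only [Finset.mem_filter, mem_multisetsOfSum hS', not_not] at hs ⊢
        refine ⟨⟨fun a ha => ?_, ?_⟩, Multiset.mem_cons_self k s⟩
        · rcases Multiset.mem_cons.1 ha with rfl | ha
          · exact Finset.mem_insert_self _ _
          · exact hs.1 a ha
        · rw [Multiset.sum_cons, hs.2]; omega
      · intro s hs
        simp only [Finset.mem_filter, not_not] at hs
        exact Multiset.cons_erase hs.2
      · intro s _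
        exact Multiset.erase_cons_head k s
    · rw [Finset.card_eq_zero, Finset.filter_eq_empty_iff]
      intro s hs hks
      rw [not_not] at hks
      have h1 := Multiset.le_sum_of_mem hks
      have h2 := ((mem_multisetsOfSum hS').1 hs).2
      omega

theorem card_multisetsOfSum_empty (m : ℕ) :
    (multisetsOfSum ∅ m).card = if m = 0 then 1 else 0 := by
  have h : ∀ s, s ∈ multisetsOfSum ∅ m ↔ s = 0 ∧ m = 0 := by
    intro s
    rw [mem_multisetsOfSum (by simp)]
    constructor
    · rintro ⟨h1, h2⟩
      have : s = 0 := Multiset.eq_zero_of_forall_notMem fun a ha => by simpa using h1 a ha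
      subst this
      exact ⟨rfl, by simpa using h2.symm⟩
    · rintro ⟨rfl, rfl⟩
      simp
  split_ifs with hm
  · rw [Finset.card_eq_one]
    exact ⟨0, by ext s; rw [h, Finset.mem_singleton]; exact and_iff_left hm⟩
  · rw [Finset.card_eq_zero]
    exact Finset.eq_empty_of_forall_notMem fun s hs => hm ((h s).1 hs).2

/-- The pairs of multisets with total sum `m` and all elements in `S`. -/
def multisetPairs (S : Finset ℕ) (m : ℕ) : Finset (Multiset ℕ × Multiset ℕ) :=
  (Finset.HasAntidiagonal.antidiagonal m).biUnion fun p => multisetsOfSum S p.1 ×ˢ multisetsOfSum S p.2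

theorem mem_multisetPairs {S : Finset ℕ} (hS : ∀ k ∈ S, 0 < k) {m : ℕ}
    {p : Multiset ℕ × Multiset ℕ} : p ∈ multisetPairs S m ↔
      (∀ a ∈ p.1, a ∈ S) ∧ (∀ a ∈ p.2, a ∈ S) ∧ p.1.sum + p.2.sum = m := by
  simp only [multisetPairs, Finset.mem_biUnion, Finset.HasAntidiagonal.mem_antidiagonal, Finset.mem_product,
    mem_multisetsOfSum hS]
  constructor
  · rintro ⟨x, h1, ⟨h2, h3⟩, h4, h5⟩
    exact ⟨h2, h4, by omega⟩
  · rintro ⟨h1, h2, h3⟩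
    exact ⟨(p.1.sum, p.2.sum), h3, ⟨h1, rfl⟩, h2, rfl⟩

theorem card_multisetPairs {S : Finset ℕ} (hS : ∀ k ∈ S, 0 < k) (m : ℕ) :
    (multisetPairs S m).card
      = ∑ p ∈ Finset.HasAntidiagonal.antidiagonal m, (multisetsOfSum S p.1).card * (multisetsOfSum S p.2).card := by
  rw [multisetPairs, Finset.card_biUnion]
  · simp_rw [Finset.card_product]
  · intro x _ y _ hxy
    rw [Function.onFun, Finset.disjoint_left]
    intro p hp hq
    simp only [Finset.mem_product, mem_multisetsOfSum hS] at hp hq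
    exact hxy (Prod.ext (hp.1.2.symm.trans hq.1.2) (hp.2.2.symm.trans hq.2.2))

open PowerSeries in
/-- The generating function of the multisets with elements in `S`, by their sum. -/
noncomputable def partSeries (S : Finset ℕ) : ℂ⟦X⟧ :=
  PowerSeries.mk fun m => ((multisetsOfSum S m).card : ℂ)

open PowerSeries in
theorem partSeries_insert_mul {S : Finset ℕ} (hS : ∀ k ∈ S, 0 < k) {k : ℕ} (hk : 0 < k)
    (hkS : k ∉ S) : partSeries (insert k S) * (1 - X ^ k) = partSeries S := by
  ext m
  rw [mul_sub, mul_one, map_sub, coeff_mul_X_pow', partSeries, partSeries, coeff_mk, coeff_mk,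
    coeff_mk, card_multisetsOfSum_insert hS hk hkS]
  split_ifs <;> simp

theorem partSeries_empty : partSeries ∅ = 1 := by
  ext m
  rw [partSeries, PowerSeries.coeff_mk, card_multisetsOfSum_empty, PowerSeries.coeff_one]
  split_ifs <;> simp

theorem coeff_partSeries_sq {S : Finset ℕ} (hS : ∀ k ∈ S, 0 < k) (m : ℕ) :
    PowerSeries.coeff m (partSeries S ^ 2) = ((multisetPairs S m).card : ℂ) := by
  rw [pow_two, PowerSeries.coeff_mul, card_multisetPairs hS]
  simp [partSeries]

/-- The coefficients of `P_{S ∪ {k}}^2 (1 - X^k)^2 = P_S^2`, where `P_S` is `partSeries S`; the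
negative term is moved across to stay in `ℕ`. -/
theorem card_multisetPairs_insert {S : Finset ℕ} (hS : ∀ k ∈ S, 0 < k) {k : ℕ} (hk : 0 < k)
    (hkS : k ∉ S) (m : ℕ) :
    (multisetPairs (insert k S) m).card
        + (if 2 * k ≤ m then (multisetPairs (insert k S) (m - 2 * k)).card else 0)
      = (multisetPairs S m).card
        + 2 * (if k ≤ m then (multisetPairs (insert k S) (m - k)).card else 0) := by
  have hS' : ∀ i ∈ insert k S, 0 < i := by
    intro i hi
    rcases Finset.mem_insert.1 hi with rfl | hi
    · exact hk
    · exact hS i hi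
  have h := partSeries_insert_mul hS hk hkS
  have h2 : partSeries (insert k S) ^ 2 + partSeries (insert k S) ^ 2 * PowerSeries.X ^ (2 * k)
      = partSeries S ^ 2 + 2 * (partSeries (insert k S) ^ 2 * PowerSeries.X ^ k) := by
    rw [← h]; ring
  have h3 := congrArg (PowerSeries.coeff m) h2
  rw [two_mul (partSeries (insert k S) ^ 2 * PowerSeries.X ^ k)] at h3
  simp only [map_add, PowerSeries.coeff_mul_X_pow', coeff_partSeries_sq hS,
    coeff_partSeries_sq hS'] at h3
  rw [two_mul (ite _ _ _)]
  exact_mod_cast h3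

theorem oddsUpTo_succ_of_odd {n : ℕ} (h : Odd (n + 1)) :
    oddsUpTo (n + 1) = insert (n + 1) (oddsUpTo n) := by
  ext k
  simp only [Finset.mem_insert, mem_oddsUpTo]
  constructor
  · rintro ⟨h1, h2⟩
    rcases Nat.lt_or_ge n k with h3 | h3
    · left; omega
    · exact Or.inr ⟨h3, h2⟩
  · rintro (rfl | ⟨h1, h2⟩)
    · exact ⟨le_rfl, h⟩
    · exact ⟨by omega, h2⟩

theorem oddsUpTo_succ_of_not_odd {n : ℕ} (h : ¬ Odd (n + 1)) : oddsUpTo (n + 1) = oddsUpTo n := by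
  ext k
  simp only [mem_oddsUpTo]
  refine ⟨fun ⟨h1, h2⟩ => ⟨?_, h2⟩, fun ⟨h1, h2⟩ => ⟨by omega, h2⟩⟩
  rcases Nat.lt_or_ge n k with h3 | h3
  · have : k = n + 1 := by omega
    exact absurd (this ▸ h2) h
  · exact h3

/-- Classifying the pairs of multisets by their common maximum counts those in which the maximum
occurs on both sides twice. -/
theorem card_multisetPairs_telescope {R : Finset ℕ} {ρ : ℕ} (hR : ∀ k ∈ R, k ≤ ρ) (m : ℕ) {n : ℕ}
    (hn : ρ ≤ n) :
    (multisetPairs (oddsUpTo n \ R) m).card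
        + ∑ c ∈ (oddsUpTo n).filter (ρ < ·),
          (if 2 * c ≤ m then (multisetPairs (oddsUpTo c \ R) (m - 2 * c)).card else 0)
      = (multisetPairs (oddsUpTo ρ \ R) m).card
        + 2 * ∑ c ∈ (oddsUpTo n).filter (ρ < ·),
          (if c ≤ m then (multisetPairs (oddsUpTo c \ R) (m - c)).card else 0) := by
  induction n, hn using Nat.le_induction with
  | base =>
    have : (oddsUpTo ρ).filter (ρ < ·) = ∅ := by
      rw [Finset.filter_eq_empty_iff]
      intro k hk
      have := (mem_oddsUpTo.1 hk).1
      omega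
    simp [this]
  | succ n hn ih =>
    by_cases hodd : Odd (n + 1)
    · have hnR : n + 1 ∉ R := fun h => by have := hR _ h; omega
      have hnO : n + 1 ∉ oddsUpTo n := fun h => by have := (mem_oddsUpTo.1 h).1; omega
      have h1 := card_multisetPairs_insert (S := oddsUpTo n \ R)
        (fun k hk => pos_of_mem_oddsUpTo (Finset.mem_sdiff.1 hk).1) (Nat.succ_pos n)
        (fun h => hnO (Finset.mem_sdiff.1 h).1) m
      have e : insert (n + 1) (oddsUpTo n \ R) = oddsUpTo (n + 1) \ R := by
        rw [oddsUpTo_succ_of_odd hodd, Finset.insert_sdiff_of_notMem _ hnR]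
      have e2 : (oddsUpTo (n + 1)).filter (ρ < ·)
          = insert (n + 1) ((oddsUpTo n).filter (ρ < ·)) := by
        rw [oddsUpTo_succ_of_odd hodd, Finset.filter_insert, if_pos (by omega)]
      have e3 : n + 1 ∉ (oddsUpTo n).filter (ρ < ·) := fun h => hnO (Finset.mem_filter.1 h).1
      rw [Nat.succ_eq_add_one, e] at h1
      rw [e2, Finset.sum_insert e3, Finset.sum_insert e3]
      omega
    · rw [oddsUpTo_succ_of_not_odd hodd]
      exact ih

/-! ### From sequences to pairs of multisets -/

namespace OddUnimodalSeq

theorem ext_of_coe {s s' : OddUnimodalSeq} (h1 : s.peak = s'.peak)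
    (h2 : (s.left : Multiset ℕ) = s'.left) (h3 : (s.right : Multiset ℕ) = s'.right) : s = s' := by
  have hl : s.left = s'.left :=
    (Multiset.coe_eq_coe.1 h2).eq_of_pairwise' s.left_sorted s'.left_sorted
  have hr : s.right = s'.right :=
    (Multiset.coe_eq_coe.1 h3).eq_of_pairwise' s.right_sorted s'.right_sorted
  obtain ⟨l, p, r, _, _, _, _, _, _, _⟩ := s
  obtain ⟨l', p', r', _, _, _, _, _, _, _⟩ := s'
  simp only at h1 hl hr
  subst h1 hl hr
  rfl

/-- The peak and the two multisets determine the sorted lists. This direction suffices, as the total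
count only enters as a denominator to be bounded above. -/
theorem ncard_ofSize_le (n : ℕ) : (ofSize n).ncard ≤
    ∑ c ∈ oddsUpTo n, (multisetPairs (oddsUpTo c) (n - c)).card := by
  rw [← Finset.card_sigma, ← Set.ncard_coe_finset]
  refine Set.ncard_le_ncard_of_injOn
    (fun s => (⟨s.peak, (s.left : Multiset ℕ), (s.right : Multiset ℕ)⟩ :
      (_ : ℕ) × (Multiset ℕ × Multiset ℕ))) ?_ ?_ (Finset.finite_toSet _)
  · intro s hs
    have hs : s.left.sum + s.peak + s.right.sum = n := hs
    simp only [Finset.coe_sigma, Set.mem_sigma_iff, Finset.mem_coe]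
    refine ⟨mem_oddsUpTo.2 ⟨by omega, s.peak_odd⟩, ?_⟩
    rw [mem_multisetPairs fun k hk => pos_of_mem_oddsUpTo hk]
    refine ⟨fun a ha => ?_, fun a ha => ?_, ?_⟩
    · exact mem_oddsUpTo.2 ⟨s.left_le_peak a ha, s.left_odd a ha⟩
    · exact mem_oddsUpTo.2 ⟨s.right_le_peak a ha, s.right_odd a ha⟩
    · simp only [Multiset.sum_coe]; omega
  · intro s _ s' _ h
    simp only [Sigma.mk.injEq, heq_eq_eq, Prod.mk.injEq] at h
    exact ext_of_coe h.1 h.2.1 h.2.2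

/-- The sequence with given peak and given multisets of parts on the two sides. -/
def ofMultisets (c : ℕ) (l r : Multiset ℕ) (hc : Odd c) (hl : ∀ a ∈ l, a ∈ oddsUpTo c)
    (hr : ∀ a ∈ r, a ∈ oddsUpTo c) : OddUnimodalSeq where
  left := l.sort (· ≤ ·)
  peak := c
  right := r.sort (· ≥ ·)
  left_sorted := l.pairwise_sort _
  left_le_peak a ha := (mem_oddsUpTo.1 (hl a ((Multiset.mem_sort _).1 ha))).1
  right_sorted := r.pairwise_sort _
  right_le_peak a ha := (mem_oddsUpTo.1 (hr a ((Multiset.mem_sort _).1 ha))).1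
  left_odd a ha := (mem_oddsUpTo.1 (hl a ((Multiset.mem_sort _).1 ha))).2
  peak_odd := hc
  right_odd a ha := (mem_oddsUpTo.1 (hr a ((Multiset.mem_sort _).1 ha))).2

/-- The multiset with `x k` copies of each `k ∈ R`. -/
def blockOf (R : Finset ℕ) (x : ℕ → ℕ) : Multiset ℕ := ∑ k ∈ R, Multiset.replicate (x k) k

theorem mem_of_mem_blockOf {R : Finset ℕ} {x : ℕ → ℕ} {a : ℕ} (h : a ∈ blockOf R x) : a ∈ R := by
  rw [blockOf, Multiset.mem_sum] at h
  obtain ⟨k, hk, h⟩ := h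
  rw [Multiset.eq_of_mem_replicate h]
  exact hk

theorem sum_blockOf (R : Finset ℕ) (x : ℕ → ℕ) : (blockOf R x).sum = ∑ k ∈ R, k * x k := by
  rw [blockOf, Multiset.sum_sum]
  simp [mul_comm]

theorem count_blockOf {R : Finset ℕ} {x : ℕ → ℕ} {a : ℕ} (ha : a ∈ R) :
    (blockOf R x).count a = x a := by
  rw [blockOf, Multiset.count_sum']
  simp [Multiset.count_replicate, ha]

/-- When the peak `c` exceeds `ρ`, every part in `R` is allowed below it, so the prescribed block
can be added to any pair that avoids `R`. Peaks at most `ρ` are discarded, which only lowers the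
count. -/
theorem sum_card_le_ncard {R : Finset ℕ} {ρ n : ℕ} (hR : ∀ k ∈ R, k ≤ ρ) (hRo : ∀ k ∈ R, Odd k)
    (x : Side → ℕ → ℕ) (hm : ∑ k ∈ R, k * x Side.L k + ∑ k ∈ R, k * x Side.R k ≤ n) :
    ∑ c ∈ (oddsUpTo n).filter (ρ < ·),
      (if c ≤ n - (∑ k ∈ R, k * x Side.L k + ∑ k ∈ R, k * x Side.R k) then
        (multisetPairs (oddsUpTo c \ R)
          (n - (∑ k ∈ R, k * x Side.L k + ∑ k ∈ R, k * x Side.R k) - c)).card else 0)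
      ≤ (ofSize n ∩ {s | ∀ k ∈ R, ∀ j, X j k s = x j k}).ncard := by
  set m := ∑ k ∈ R, k * x Side.L k + ∑ k ∈ R, k * x Side.R k with hmdef
  rw [← Finset.sum_filter, ← Finset.card_sigma, ← Set.ncard_coe_finset]
  have key : ∀ p ∈ (((oddsUpTo n).filter (ρ < ·)).filter (· ≤ n - m)).sigma
      (fun c => multisetPairs (oddsUpTo c \ R) (n - m - c)),
      Odd p.1 ∧ (∀ k ∈ R, k ∈ oddsUpTo p.1) ∧ p.1 ≤ n - m ∧ (∀ a ∈ p.2.1, a ∈ oddsUpTo p.1 \ R) ∧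
        (∀ a ∈ p.2.2, a ∈ oddsUpTo p.1 \ R) ∧ p.2.1.sum + p.2.2.sum = n - m - p.1 := by
    intro p hp
    rw [Finset.mem_sigma, Finset.mem_filter, Finset.mem_filter, mem_multisetPairs
      fun k hk => pos_of_mem_oddsUpTo (Finset.mem_sdiff.1 hk).1] at hp
    obtain ⟨⟨⟨h1, h2⟩, h3⟩, h4⟩ := hp
    exact ⟨(mem_oddsUpTo.1 h1).2, fun k hk => mem_oddsUpTo.2 ⟨by have := hR k hk; omega, hRo k hk⟩,
      h3, h4⟩
  have hadd : ∀ {c : ℕ} {l : Multiset ℕ} {y : ℕ → ℕ}, (∀ k ∈ R, k ∈ oddsUpTo c) →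
      (∀ a ∈ l, a ∈ oddsUpTo c \ R) → ∀ a ∈ l + blockOf R y, a ∈ oddsUpTo c := by
    intro c l y h1 h2 a ha
    rcases Multiset.mem_add.1 ha with h | h
    · exact (Finset.mem_sdiff.1 (h2 a h)).1
    · exact h1 a (mem_of_mem_blockOf h)
  refine Set.ncard_le_ncard_of_injOn
    -- The alternative is a dummy value making the map total; it is never taken on the set
    -- considered.
    (fun p => if h : _ then ofMultisets p.1 (p.2.1 + blockOf R (x Side.L))
      (p.2.2 + blockOf R (x Side.R)) (key p h).1 (hadd (key p h).2.1 (key p h).2.2.2.1)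
      (hadd (key p h).2.1 (key p h).2.2.2.2.1) else ofMultisets 1 0 0 odd_one (by simp) (by simp))
    ?_ ?_ ((finite_ofSize n).inter_of_left _)
  · intro p hp
    rw [Finset.mem_coe] at hp
    simp only [dif_pos hp]
    obtain ⟨h1, h2, h3, h4, h5, h6⟩ := key p hp
    have hcount : ∀ {l : Multiset ℕ} {y : ℕ → ℕ}, (∀ a ∈ l, a ∈ oddsUpTo p.1 \ R) → ∀ k ∈ R,
        (l + blockOf R y).count k = y k := by
      intro l y hl k hk
      rw [Multiset.count_add, count_blockOf hk, Multiset.count_eq_zero_of_notMem, zero_add]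
      exact fun h => (Finset.mem_sdiff.1 (hl k h)).2 hk
    refine ⟨?_, fun k hk j => ?_⟩
    · change (Multiset.sort _ _).sum + p.1 + (Multiset.sort _ _).sum = n
      rw [← Multiset.sum_coe, ← Multiset.sum_coe, Multiset.sort_eq, Multiset.sort_eq,
        Multiset.sum_add, Multiset.sum_add, sum_blockOf, sum_blockOf]
      omega
    · cases j
      · change (Multiset.sort _ _).count k = _
        rw [← Multiset.coe_count, Multiset.sort_eq, hcount h4 k hk]
      · change (Multiset.sort _ _).count k = _
        rw [← Multiset.coe_count, Multiset.sort_eq, hcount h5 k hk]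
  · intro p hp p' hp' h
    rw [Finset.mem_coe] at hp hp'
    simp only [dif_pos hp, dif_pos hp'] at h
    have e1 : p.1 = p'.1 := congrArg peak h
    have e2 := congrArg (fun s : OddUnimodalSeq => (s.left : Multiset ℕ)) h
    have e3 := congrArg (fun s : OddUnimodalSeq => (s.right : Multiset ℕ)) h
    simp only [ofMultisets, Multiset.sort_eq, add_left_inj] at e2 e3
    exact Sigma.ext e1 (heq_of_eq (Prod.ext e2 e3))

end OddUnimodalSeq

/-! ### Point probabilities of the Boltzmann model as Fourier coefficients -/

/-- The power series `A` converges absolutely at `z`, with sum `v`. -/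
def EvaluatesTo (A : PowerSeries ℂ) (z v : ℂ) : Prop :=
  Summable (fun m => ‖PowerSeries.coeff m A * z ^ m‖) ∧
    HasSum (fun m => PowerSeries.coeff m A * z ^ m) v

theorem EvaluatesTo.mul {A A' : PowerSeries ℂ} {z v v' : ℂ} (h : EvaluatesTo A z v)
    (h' : EvaluatesTo A' z v') : EvaluatesTo (A * A') z (v * v') := by
  have e : ∀ m, PowerSeries.coeff m (A * A') * z ^ m
      = ∑ p ∈ Finset.HasAntidiagonal.antidiagonal m, (PowerSeries.coeff p.1 A * z ^ p.1)
        * (PowerSeries.coeff p.2 A' * z ^ p.2) := by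
    intro m
    rw [PowerSeries.coeff_mul, Finset.sum_mul]
    refine Finset.sum_congr rfl fun p hp => ?_
    rw [← Finset.HasAntidiagonal.mem_antidiagonal.1 hp, pow_add]
    ring
  have h1 := summable_norm_sum_mul_antidiagonal_of_summable_norm h.1 h'.1
  have h2 := tsum_mul_tsum_eq_tsum_sum_antidiagonal_of_summable_norm h.1 h'.1
  rw [h.2.tsum_eq, h'.2.tsum_eq] at h2
  refine ⟨?_, ?_⟩
  · simp_rw [e]; exact h1
  · simp_rw [e]; rw [h2]; exact h1.of_norm.hasSum

theorem evaluatesTo_one (z : ℂ) : EvaluatesTo 1 z 1 := by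
  have h : ∀ m ≠ 0, PowerSeries.coeff m (1 : PowerSeries ℂ) * z ^ m = 0 := fun m hm => by
    rw [PowerSeries.coeff_one, if_neg hm, zero_mul]
  refine ⟨(hasSum_single 0 fun m hm => by rw [h m hm, norm_zero]).summable, ?_⟩
  have := hasSum_single 0 h
  simpa using this

/-- The power series of `1 / (1 - X ^ k)`. -/
noncomputable def dilatedGeometric (k : ℕ) : PowerSeries ℂ :=
  PowerSeries.mk fun m => if k ∣ m then 1 else 0

theorem dilatedGeometric_mul {k : ℕ} (hk : 0 < k) :
    dilatedGeometric k * (1 - PowerSeries.X ^ k) = 1 := by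
  ext m
  rw [mul_sub, mul_one, map_sub, PowerSeries.coeff_mul_X_pow', dilatedGeometric,
    PowerSeries.coeff_mk, PowerSeries.coeff_mk, PowerSeries.coeff_one]
  by_cases hkm : k ≤ m
  · rw [if_pos hkm, if_neg (show m ≠ 0 by omega)]
    by_cases h : k ∣ m
    · rw [if_pos h, if_pos (Nat.dvd_sub h (dvd_refl k)), sub_self]
    · rw [if_neg h, if_neg, sub_self]
      intro h2
      exact h (by simpa [Nat.sub_add_cancel hkm] using Nat.dvd_add h2 (dvd_refl k))
  · rw [if_neg hkm, sub_zero]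
    by_cases h : m = 0
    · simp [h]
    · rw [if_neg h, if_neg fun h2 => hkm (Nat.le_of_dvd (by omega) h2)]

theorem evaluatesTo_dilatedGeometric {k : ℕ} (hk : 0 < k) {z : ℂ} (hz : ‖z‖ < 1) :
    EvaluatesTo (dilatedGeometric k) z (1 - z ^ k)⁻¹ := by
  have hzk : ‖z ^ k‖ < 1 := by rw [norm_pow]; exact pow_lt_one₀ (norm_nonneg _) hz hk.ne'
  have hinj : Function.Injective fun j : ℕ => k * j := fun a b h => by
    simpa [hk.ne'] using h
  have hout : ∀ m ∉ Set.range (fun j : ℕ => k * j),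
      PowerSeries.coeff m (dilatedGeometric k) * z ^ m = 0 := by
    intro m hm
    rw [dilatedGeometric, PowerSeries.coeff_mk, if_neg, zero_mul]
    rintro ⟨j, rfl⟩
    exact hm ⟨j, rfl⟩
  have hin : ∀ j : ℕ, PowerSeries.coeff (k * j) (dilatedGeometric k) * z ^ (k * j) = (z ^ k) ^ j := by
    intro j
    rw [dilatedGeometric, PowerSeries.coeff_mk, if_pos (dvd_mul_right k j), one_mul, pow_mul]
  constructor
  · rw [← hinj.summable_iff (f := fun m => ‖PowerSeries.coeff m (dilatedGeometric k) * z ^ m‖)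
      fun m hm => by rw [hout m hm, norm_zero]]
    simp only [Function.comp_def, hin]
    simp_rw [norm_pow (z ^ k)]
    exact summable_geometric_of_lt_one (norm_nonneg _) hzk
  · rw [← hinj.hasSum_iff hout]
    simp only [Function.comp_def, hin]
    exact hasSum_geometric_of_norm_lt_one hzk

theorem evaluatesTo_partSeries {S : Finset ℕ} (hS : ∀ k ∈ S, 0 < k) {z : ℂ} (hz : ‖z‖ < 1) :
    EvaluatesTo (partSeries S) z (∏ k ∈ S, (1 - z ^ k)⁻¹) := by
  induction S using Finset.induction_on with
  | empty => rw [partSeries_empty, Finset.prod_empty]; exact evaluatesTo_one z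
  | insert k S hk ih =>
    have hk0 := hS k (Finset.mem_insert_self k S)
    have hS' : ∀ i ∈ S, 0 < i := fun i hi => hS i (Finset.mem_insert_of_mem hi)
    have e : partSeries (insert k S) = dilatedGeometric k * partSeries S := by
      rw [← partSeries_insert_mul hS' hk0 hk, mul_left_comm, dilatedGeometric_mul hk0, mul_one]
    rw [e, Finset.prod_insert hk]
    exact (evaluatesTo_dilatedGeometric hk0 hz).mul (ih hS')

/-- The normalisation constant of the model with parts in `S` on both sides. -/
noncomputable def boltzNorm (t : ℝ) (S : Finset ℕ) : ℝ := ∏ k ∈ S, (1 - Real.exp (-(t * k))) ^ 2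

/-- The probability that the total size is `m`, in the model with parts in `S` on both sides. -/
noncomputable def boltzMass (t : ℝ) (S : Finset ℕ) (m : ℕ) : ℝ :=
  (multisetPairs S m).card * Real.exp (-(t * m)) * boltzNorm t S

/-- For `x = t k` and `α = k θ` this is the normalised Euler factor `1 / (1 - z^k)` at `z = exp (-t
+ iθ)`, the bridge between characteristic and generating functions. -/
theorem geomChar_meanOcc {x : ℝ} (hx : 0 < x) (α : ℝ) :
    geomChar (meanOcc x) α
      = (1 - Real.exp (-x)) * (1 - Complex.exp (-x + Complex.I * α))⁻¹ := by
  have h0 := geomChar_denom_ne_zero (meanOcc_pos hx).le α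
  have h1 : (Complex.exp x - 1) ≠ 0 := by
    have : Real.exp x - 1 ≠ 0 := by linarith [Real.add_one_lt_exp hx.ne']
    exact_mod_cast this
  have h2 : 1 - Complex.exp (-x + Complex.I * α)
      = (1 - Complex.exp (-x)) * (1 - meanOcc x * (Complex.exp (Complex.I * α) - 1)) := by
    rw [Complex.exp_add, Complex.exp_neg, meanOcc]
    push_cast
    have h3 := Complex.exp_ne_zero x
    field_simp
    ring
  have h4 : 1 - Complex.exp (-x) ≠ 0 := by
    rw [Complex.exp_neg]
    have h3 := Complex.exp_ne_zero x
    field_simp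
    exact div_ne_zero h1 h3
  rw [h2, geomChar]
  push_cast
  field_simp

theorem hasSum_boltzChar {t : ℝ} (ht : 0 < t) {S : Finset ℕ} (hS : ∀ k ∈ S, 0 < k) (θ : ℝ) :
    EvaluatesTo (partSeries S ^ 2) (Complex.exp (-t + Complex.I * θ))
      (∏ k ∈ S, (1 - Complex.exp (-t + Complex.I * θ) ^ k)⁻¹ ^ 2) ∧
    boltzChar t S θ = boltzNorm t S *
      ∏ k ∈ S, (1 - Complex.exp (-t + Complex.I * θ) ^ k)⁻¹ ^ 2 := by
  constructor
  · have hz : ‖Complex.exp (-t + Complex.I * θ)‖ < 1 := by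
      rw [Complex.norm_exp]
      simpa using ht
    have h := evaluatesTo_partSeries hS hz
    rw [Finset.prod_pow, pow_two, pow_two]
    exact h.mul h
  · rw [boltzChar, boltzNorm, Complex.ofReal_prod, ← Finset.prod_mul_distrib]
    refine Finset.prod_congr rfl fun k hk => ?_
    have hk : (0 : ℝ) < k := by exact_mod_cast hS k hk
    rw [geomChar_meanOcc (by positivity), ← Complex.exp_nat_mul, mul_pow]
    push_cast
    ring_nf

theorem integral_exp_int_mul (j m : ℕ) :
    ∫ θ in -Real.pi..Real.pi, Complex.exp (Complex.I * (j * θ : ℝ))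
      * Complex.exp (-(Complex.I * (m * θ : ℝ))) = if j = m then 2 * Real.pi else 0 := by
  have e : ∀ θ : ℝ, Complex.exp (Complex.I * (j * θ : ℝ)) * Complex.exp (-(Complex.I * (m * θ : ℝ)))
      = Complex.exp ((Complex.I * ((j : ℂ) - m)) * θ) := by
    intro θ
    rw [← Complex.exp_add]; push_cast; ring_nf
  simp_rw [e]
  split_ifs with h
  · subst h
    simp
    ring
  · have hc : Complex.I * ((j : ℂ) - m) ≠ 0 := by
      refine mul_ne_zero Complex.I_ne_zero (sub_ne_zero.2 ?_)
      exact_mod_cast h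
    rw [integral_exp_mul_complex hc]
    have : Complex.exp (Complex.I * ((j : ℂ) - m) * Real.pi)
        = Complex.exp (Complex.I * ((j : ℂ) - m) * (-Real.pi : ℝ)) := by
      rw [Complex.exp_eq_exp_iff_exists_int]
      exact ⟨(j : ℤ) - m, by push_cast; ring⟩
    rw [this, sub_self, zero_div, Complex.ofReal_zero]

/-- The generating function converges absolutely on the circle of radius `exp (-t)`. It can be
integrated term by term, and orthogonality of the exponentials isolates the coefficient at `m`. -/
theorem boltzCoeff_eq {t : ℝ} (ht : 0 < t) {S : Finset ℕ} (hS : ∀ k ∈ S, 0 < k) (m : ℕ) :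
    boltzCoeff t S m = ((2 * Real.pi * boltzMass t S m : ℝ) : ℂ) := by
  set a : ℕ → ℂ := fun j => boltzNorm t S * ((multisetPairs S j).card * Real.exp (-(t * j)))
    with ha
  set F : ℕ → C(ℝ, ℂ) := fun j => ⟨fun θ => a j * (Complex.exp (Complex.I * (j * θ : ℝ))
    * Complex.exp (-(Complex.I * (m * θ : ℝ)))), by fun_prop⟩ with hF
  have hterm : ∀ (θ : ℝ) (j : ℕ), boltzNorm t S * (PowerSeries.coeff j (partSeries S ^ 2)
      * Complex.exp (-t + Complex.I * θ) ^ j) * Complex.exp (-(Complex.I * (m * θ : ℝ)))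
      = F j θ := by
    intro θ j
    simp only [hF, ha, ContinuousMap.coe_mk]
    rw [coeff_partSeries_sq hS, ← Complex.exp_nat_mul, mul_add, Complex.exp_add]
    push_cast
    ring_nf
  have hnorm : ∀ (j : ℕ) (θ : ℝ), ‖F j θ‖ = ‖a j‖ := by
    intro j θ
    simp only [hF, ContinuousMap.coe_mk]
    rw [norm_mul (a j), norm_mul (Complex.exp _), Complex.norm_exp_I_mul_ofReal,
      norm_exp_neg_I_mul, mul_one, mul_one]
  have hsum : ∀ θ, HasSum (fun j => F j θ)
      (boltzChar t S θ * Complex.exp (-(Complex.I * (m * θ : ℝ)))) := by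
    intro θ
    obtain ⟨h1, h2⟩ := hasSum_boltzChar ht hS θ
    rw [h2]
    exact ((h1.2.mul_left (boltzNorm t S : ℂ)).mul_right _).congr_fun fun j => (hterm θ j).symm
  have hsummable : Summable fun j => ‖a j‖ := by
    have h1 := (hasSum_boltzChar ht hS 0).1.1.mul_left ‖(boltzNorm t S : ℂ)‖
    refine h1.congr fun j => ?_
    rw [← hnorm j 0, ← hterm 0 j, norm_mul _ (Complex.exp (-_)), norm_exp_neg_I_mul, mul_one,
      norm_mul (boltzNorm t S : ℂ)]
  have h := intervalIntegral.hasSum_integral_of_dominated_convergence (a := -Real.pi)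
    (b := Real.pi) (μ := volume) (F := fun j θ => F j θ) (fun j _ => ‖a j‖)
    (fun j => (F j).continuous.aestronglyMeasurable)
    (fun j => Eventually.of_forall fun θ _ => (hnorm j θ).le)
    (Eventually.of_forall fun _ _ => hsummable) (by simp)
    (Eventually.of_forall fun θ _ => hsum θ)
  have h2 : ∀ j, ∫ θ in -Real.pi..Real.pi, F j θ = a j * (if j = m then 2 * Real.pi else 0) := by
    intro j
    simp only [hF, ContinuousMap.coe_mk]
    rw [intervalIntegral.integral_const_mul, integral_exp_int_mul]
  simp_rw [h2] at h
  have h3 := hasSum_single (f := fun j => a j * ((if j = m then 2 * Real.pi else 0 : ℝ) : ℂ)) m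
    fun j hj => by simp [hj]
  rw [boltzCoeff, h.unique h3]
  simp only [if_true, ha, boltzMass]
  push_cast
  ring

/-- The constant of the uniform bound for the characteristic functions. -/
noncomputable def charConst : ℝ := 720 * 16 ^ 6 * 50000 ^ 2

theorem charConst_pos : 0 < charConst := by unfold charConst; norm_num

/-- With `M = ⌊1 / (4 t)⌋` the odd numbers below `4 M` are at most `1 / t ≤ c`. Among them only
elements of `R` can be missing, and `64 t |R| ≤ 1` keeps these below `M / 4`. -/
theorem norm_boltzChar_sdiff_le {t : ℝ} (ht : 0 < t) (ht1 : t ≤ 1 / 16) {c : ℕ} (hc : 1 ≤ t * c)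
    {R : Finset ℕ} (hR : 64 * t * R.card ≤ 1) {θ : ℝ} (hθ : |θ| ≤ Real.pi) :
    ‖boltzChar t (oddsUpTo c \ R) θ‖ ≤ charConst / (1 + θ ^ 2 / t ^ 3) ^ 2 := by
  set M := ⌊1 / (4 * t)⌋₊ with hM
  have h1 : (M : ℝ) ≤ 1 / (4 * t) := Nat.floor_le (by positivity)
  have h2 : 1 / (4 * t) < M + 1 := Nat.lt_floor_add_one _
  rw [le_div_iff₀ (by positivity)] at h1
  rw [div_lt_iff₀ (by positivity)] at h2
  have h3 : 1 ≤ 16 * M * t := by nlinarith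
  have h4 : 4 ≤ M := by
    refine Nat.le_floor ?_
    rw [le_div_iff₀ (by positivity)]
    push_cast
    linarith
  refine norm_boltzChar_le ht (fun k hk => pos_of_mem_oddsUpTo (Finset.mem_sdiff.1 hk).1) h4
    (by linarith) h3 ?_ hθ
  have h5 : ((Finset.range (2 * M)).filter (fun i => 2 * i + 1 ∉ oddsUpTo c \ R)).card ≤ R.card := by
    refine Finset.card_le_card_of_injOn (fun i => 2 * i + 1) ?_ fun a _ b _ h => by simpa using h
    intro i hi
    have hi := Finset.mem_filter.1 (Finset.mem_coe.1 hi)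
    by_contra hiR
    refine hi.2 (Finset.mem_sdiff.2 ⟨mem_oddsUpTo.2 ⟨?_, i, rfl⟩, hiR⟩)
    have h6 : (i : ℝ) + 1 ≤ 2 * M := by exact_mod_cast Finset.mem_range.1 hi.1
    have h7 : ((2 * i + 1 : ℕ) : ℝ) ≤ c := by
      push_cast
      have : t * (2 * i + 1) ≤ t * c := by nlinarith
      exact le_of_mul_le_mul_left this ht
    exact_mod_cast h7
  have h6 : (R.card : ℝ) * 4 ≤ M := by
    by_contra h
    push Not at h
    have : 16 * (M : ℝ) * t < 16 * (R.card * 4) * t := by gcongr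
    linarith
  have : ((4 * ((Finset.range (2 * M)).filter (fun i => 2 * i + 1 ∉ oddsUpTo c \ R)).card : ℕ) : ℝ)
      ≤ M := by
    push_cast
    have : (((Finset.range (2 * M)).filter (fun i => 2 * i + 1 ∉ oddsUpTo c \ R)).card : ℝ)
      ≤ R.card := by exact_mod_cast h5
    linarith
  exact_mod_cast this

theorem boltzNorm_nonneg (t : ℝ) (S : Finset ℕ) : 0 ≤ boltzNorm t S :=
  Finset.prod_nonneg fun _ _ => sq_nonneg _

theorem one_sub_exp_neg_mem {t : ℝ} (ht : 0 < t) {k : ℕ} (hk : 0 < k) :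
    0 < 1 - Real.exp (-(t * k)) ∧ 1 - Real.exp (-(t * k)) ≤ 1 := by
  have hk' : (0 : ℝ) < k := by exact_mod_cast hk
  have h1 : Real.exp (-(t * k)) < 1 := Real.exp_lt_one_iff.2 (by nlinarith [mul_pos ht hk'])
  exact ⟨by linarith, by linarith [Real.exp_pos (-(t * k))]⟩

theorem boltzNorm_pos {t : ℝ} (ht : 0 < t) {S : Finset ℕ} (hS : ∀ k ∈ S, 0 < k) :
    0 < boltzNorm t S :=
  Finset.prod_pos fun k hk => pow_pos (one_sub_exp_neg_mem ht (hS k hk)).1 2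

theorem boltzNorm_anti {t : ℝ} (ht : 0 < t) {S T : Finset ℕ} (hT : ∀ k ∈ T, 0 < k) (h : S ⊆ T) :
    boltzNorm t T ≤ boltzNorm t S :=
  Finset.prod_le_prod_of_subset_of_le_one h (fun _ _ => sq_nonneg _) fun k hk _ =>
    pow_le_one₀ (one_sub_exp_neg_mem ht (hT k hk)).1.le (one_sub_exp_neg_mem ht (hT k hk)).2

theorem boltzNorm_sdiff_mul {t : ℝ} {S R : Finset ℕ} (h : R ⊆ S) :
    boltzNorm t (S \ R) * boltzNorm t R = boltzNorm t S :=
  Finset.prod_sdiff h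

theorem boltzMass_nonneg (t : ℝ) (S : Finset ℕ) (m : ℕ) : 0 ≤ boltzMass t S m :=
  mul_nonneg (mul_nonneg (Nat.cast_nonneg _) (Real.exp_pos _).le) (boltzNorm_nonneg _ _)

theorem two_pi_mul_boltzMass {t : ℝ} (ht : 0 < t) {S : Finset ℕ} (hS : ∀ k ∈ S, 0 < k) (m : ℕ) :
    2 * Real.pi * boltzMass t S m = ‖boltzCoeff t S m‖ := by
  rw [boltzCoeff_eq ht hS, Complex.norm_real, Real.norm_of_nonneg]
  have := boltzMass_nonneg t S m
  positivity

theorem boltzMass_le_one {t : ℝ} (ht : 0 < t) {S : Finset ℕ} (hS : ∀ k ∈ S, 0 < k) (m : ℕ) :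
    boltzMass t S m ≤ 1 := by
  have hpi := Real.pi_pos
  have h : ‖boltzCoeff t S m‖ ≤ 1 * |Real.pi - -Real.pi| :=
    intervalIntegral.norm_integral_le_of_norm_le_const fun θ _ => by
      rw [norm_mul, norm_exp_neg_I_mul, mul_one]
      exact norm_boltzChar_le_one ht hS θ
  rw [← two_pi_mul_boltzMass ht hS, one_mul, sub_neg_eq_add, ← two_mul,
    abs_of_pos (by positivity)] at h
  exact le_of_mul_le_mul_left (by linarith) (show 0 < 2 * Real.pi by positivity)

theorem boltzMass_le {t : ℝ} (ht : 0 < t) (ht1 : t ≤ 1 / 16) {c : ℕ} (hc : 1 ≤ t * c) {σ : ℝ}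
    (hσ : 0 < σ) (hσt : σ ^ 2 = t ^ 3) (m : ℕ) :
    boltzMass t (oddsUpTo c) m ≤ charConst * σ := by
  have hpi := Real.pi_pos
  have hS : ∀ k ∈ oddsUpTo c, 0 < k := fun k hk => pos_of_mem_oddsUpTo hk
  have h := norm_boltzCoeff_le (t := t) (S := oddsUpTo c) hσ charConst_pos.le (fun θ hθ => by
    have := norm_boltzChar_sdiff_le ht ht1 hc (R := ∅) (by simp) hθ
    rwa [Finset.sdiff_empty, ← hσt] at this) m
  rw [← two_pi_mul_boltzMass ht hS] at h
  have h1 : 0 ≤ charConst * σ := mul_nonneg charConst_pos.le hσ.le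
  refine le_of_mul_le_mul_left (h.trans ?_) (show 0 < 2 * Real.pi by positivity)
  nlinarith

/-- With `σ = t^(3/2)`, the bound is `charConst * (m σ + 2 |R| √t)` times `σ`, hence small relative
to the mass itself when `m σ` and `|R| √t` are. -/
theorem abs_boltzMass_sdiff_sub_le {t : ℝ} (ht : 0 < t) (ht1 : t ≤ 1 / 16) {n : ℕ}
    (hn : 1 ≤ t * n) {R : Finset ℕ} (hRn : R ⊆ oddsUpTo n) (hR : 64 * t * R.card ≤ 1) {σ : ℝ}
    (hσ : 0 < σ) (hσt : σ ^ 2 = t ^ 3) {m : ℕ} (hm : m ≤ n) :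
    |boltzMass t (oddsUpTo n \ R) (n - m) - boltzMass t (oddsUpTo n) n|
      ≤ (m + 2 * R.card / t) * (charConst * σ ^ 2) := by
  have hpi := Real.pi_pos
  have hS : ∀ k ∈ oddsUpTo n, 0 < k := fun k hk => pos_of_mem_oddsUpTo hk
  have h := norm_boltzCoeff_sdiff_sub_le ht hS hRn hσ charConst_pos.le (fun θ hθ => by
    have := norm_boltzChar_sdiff_le ht ht1 hn hR hθ
    rwa [← hσt] at this) hm
  rw [boltzCoeff_eq ht hS, boltzCoeff_eq ht fun k hk => hS k (Finset.mem_sdiff.1 hk).1,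
    ← Complex.ofReal_sub, Complex.norm_real, Real.norm_eq_abs, ← mul_sub, abs_mul,
    abs_of_pos (show 0 < 2 * Real.pi by positivity)] at h
  have h1 : 0 ≤ (m + 2 * R.card / t) * (charConst * σ ^ 2) := by
    have := charConst_pos
    positivity
  refine le_of_mul_le_mul_left (h.trans ?_) (show 0 < 2 * Real.pi by positivity)
  nlinarith

/-! ### Choice of the parameter, and asymptotic bounds for the masses -/

/-- The parameter of the Boltzmann model of mean size about `n`. -/
noncomputable def tilt (n : ℕ) : ℝ := Real.pi / √(6 * n)

theorem tilt_pos {n : ℕ} (hn : 0 < n) : 0 < tilt n := by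
  have : (0 : ℝ) < n := by exact_mod_cast hn
  unfold tilt
  positivity

theorem tilt_sq_mul {n : ℕ} (hn : 0 < n) : tilt n ^ 2 * n = Real.pi ^ 2 / 6 := by
  have : (0 : ℝ) < n := by exact_mod_cast hn
  rw [tilt, div_pow, Real.sq_sqrt (by positivity)]
  field_simp

theorem tendsto_tilt : Tendsto tilt atTop (𝓝 0) := by
  have h : Tendsto (fun n : ℕ => √(6 * n)) atTop atTop :=
    Real.tendsto_sqrt_atTop.comp (tendsto_natCast_atTop_atTop.const_mul_atTop (by norm_num))
  exact h.const_div_atTop Real.pi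

theorem eventually_tilt_lt {η : ℝ} (hη : 0 < η) : ∀ᶠ n in atTop, 0 < tilt n ∧ tilt n < η := by
  filter_upwards [tendsto_tilt.eventually_lt_const hη, eventually_gt_atTop 0] with n h1 h2
  exact ⟨tilt_pos h2, h1⟩

theorem one_le_tilt_sq_mul {n : ℕ} (hn : 0 < n) : 1 ≤ tilt n ^ 2 * n := by
  rw [tilt_sq_mul hn]
  nlinarith [Real.pi_gt_three]

/-- The order of magnitude of the probability that the total size is `n`. -/
noncomputable def tiltScale (n : ℕ) : ℝ := tilt n * √(tilt n)

theorem tiltScale_pos {n : ℕ} (hn : 0 < n) : 0 < tiltScale n :=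
  mul_pos (tilt_pos hn) (Real.sqrt_pos.2 (tilt_pos hn))

theorem tiltScale_sq {n : ℕ} (hn : 0 < n) : tiltScale n ^ 2 = tilt n ^ 3 := by
  rw [tiltScale, mul_pow, Real.sq_sqrt (tilt_pos hn).le]; ring

theorem one_le_tilt_mul {n : ℕ} (hn : 0 < n) (h : tilt n ≤ 1) : 1 ≤ tilt n * n := by
  have h1 := one_le_tilt_sq_mul hn
  have h2 := tilt_pos hn
  have h3 : (0 : ℝ) < n := by exact_mod_cast hn
  nlinarith [mul_pos h2 h3]

/-- The lower half of a local limit theorem: `n` is within `O(1 / t)` of the mean, so the mass there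
has the order of the inverse standard deviation. -/
theorem eventually_le_boltzMass : ∃ κ > 0, ∀ᶠ n : ℕ in atTop,
    κ * tiltScale n ≤ boltzMass (tilt n) (oddsUpTo n) n := by
  have hpi := Real.pi_pos
  have hD := charConst_pos
  set e := Real.exp (-800) with he
  have he0 : 0 < e := Real.exp_pos _
  -- First the window `A σ` is taken wide enough that the tail costs at most a quarter of the main
  -- term `2 e σ`. Then `t` is taken small, depending on `A`, so that the Gaussian error `K √t σ`
  -- costs at most another quarter.
  obtain ⟨A, hA1, hA⟩ : ∃ A : ℝ, 1 ≤ A ∧ charConst * Real.pi / (1 + A ^ 2) ≤ e / 2 := by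
    refine ⟨1 + 2 * charConst * Real.pi / e, le_add_of_nonneg_right (by positivity), ?_⟩
    set y := 2 * charConst * Real.pi / e with hy
    have hy0 : 0 < y := by positivity
    rw [div_le_iff₀ (by positivity)]
    have : charConst * Real.pi = e / 2 * y := by rw [hy]; field_simp
    rw [this]
    gcongr
    nlinarith
  set K : ℝ := 2 * A * (1600 * A ^ 3 + 7 * A) with hK
  have hK0 : 0 < K := by positivity
  have hη : 0 < min (1 / 16) (min (Real.pi / A) ((e / (2 * K)) ^ 2)) := by positivity
  refine ⟨e / (2 * Real.pi), by positivity, ?_⟩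
  filter_upwards [eventually_tilt_lt hη, eventually_gt_atTop 0] with n ht hn
  obtain ⟨ht0, ht⟩ := ht
  rw [lt_min_iff, lt_min_iff] at ht
  obtain ⟨ht1, ht2, ht3⟩ := ht
  set t := tilt n with htdef
  have hσ := tiltScale_pos hn
  have hσt := tiltScale_sq hn
  set σ := tiltScale n with hσdef
  have hS : ∀ k ∈ oddsUpTo n, 0 < k := fun k hk => pos_of_mem_oddsUpTo hk
  have hsq : √t ≤ e / (2 * K) := by
    rw [← Real.sqrt_sq (show 0 ≤ e / (2 * K) by positivity)]
    exact Real.sqrt_le_sqrt ht3.le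
  have hst : 0 < √t := Real.sqrt_pos.2 ht0
  have hsqt : √t ^ 2 = t := Real.sq_sqrt ht0.le
  have hσe : σ = t * √t := rfl
  have hσt1 : σ ≤ t := by
    have : √t ≤ 1 := Real.sqrt_le_one.2 (by linarith)
    rw [hσe]; nlinarith
  have h := le_re_boltzCoeff ht0 hS (n := n) hσ hσt (a := A * σ) (A := A) rfl hA1
    (by
      rw [lt_div_iff₀ (by linarith)] at ht2
      nlinarith) hD.le
    (fun θ hθ => by
      have := norm_boltzChar_sdiff_le ht0 ht1.le (one_le_tilt_mul hn (by linarith)) (R := ∅)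
        (by simp) hθ
      rwa [Finset.sdiff_empty, ← hσt] at this)
    (abs_boltzMean_sub_le ht0 hn (tilt_sq_mul hn))
  rw [boltzCoeff_eq ht0 hS, Complex.ofReal_re] at h
  have e1 : 2 * (A * σ) * (1600 / t ^ 4 * (A * σ) ^ 3 + A * σ * (7 / t)) = σ * (K * √t) := by
    have h3 : σ ^ 3 = t ^ 4 * √t := by
      rw [pow_succ, hσt, hσe]; ring
    rw [mul_pow, h3, hK]
    have h4 : A * σ * (7 / t) = 7 * A * √t := by rw [hσe]; field_simp
    rw [h4]
    field_simp
  have e2 : charConst * Real.pi * σ / (1 + A ^ 2) ≤ σ * (e / 2) := by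
    rw [mul_comm σ (e / 2), mul_div_right_comm]
    gcongr
  have e3 : σ * (K * √t) ≤ σ * (e / 2) := by
    have : K * √t ≤ K * (e / (2 * K)) := by gcongr
    rw [show K * (e / (2 * K)) = e / 2 by field_simp] at this
    gcongr
  rw [e1] at h
  rw [div_mul_eq_mul_div, div_le_iff₀ (by positivity)]
  linarith

/-- The probability that no part exceeds a large multiple of the typical scale. -/
theorem eventually_boltzNorm_le {L : ℝ} (hL : 0 < L) : ∃ c > 0, ∀ᶠ n : ℕ in atTop,
    boltzNorm (tilt n) (oddsUpTo n \ oddsUpTo ⌊L / tilt n⌋₊) ≤ Real.exp (-(c / tilt n)) := by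
  -- More than `L / t` odd numbers `k` beyond `L / t` satisfy `t k ≤ 4 (L + 1)`, and each
  -- contributes a factor at most `exp (-2 exp (-4 (L + 1)))`.
  refine ⟨2 * L * Real.exp (-(4 * (L + 1))), by positivity, ?_⟩
  have hη : 0 < min 1 (1 / (4 * (L + 1))) := by positivity
  filter_upwards [eventually_tilt_lt hη, eventually_gt_atTop 0] with n ht hn
  obtain ⟨ht0, ht⟩ := ht
  rw [lt_min_iff] at ht
  obtain ⟨ht1, ht2⟩ := ht
  set t := tilt n with htdef
  set I := ⌊L / t⌋₊ + 1 with hI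
  have hI1 : L / t < I := by rw [hI]; push_cast; exact Nat.lt_floor_add_one _
  have hI2 : (I : ℝ) ≤ L / t + 1 := by
    rw [hI]; push_cast
    have := Nat.floor_le (show 0 ≤ L / t by positivity)
    linarith
  have htI : t * I ≤ L + 1 := by
    have : t * I ≤ t * (L / t + 1) := by gcongr
    rw [mul_add, mul_div_cancel₀ _ ht0.ne'] at this
    linarith
  have hIn : 4 * I ≤ n := by
    have h1 := one_le_tilt_sq_mul hn
    rw [lt_div_iff₀ (by positivity)] at ht2
    have h2 : t ^ 2 * (4 * I) ≤ t ^ 2 * n := by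
      calc t ^ 2 * (4 * I) = t * (4 * (t * I)) := by ring
        _ ≤ t * (4 * (L + 1)) := by gcongr
        _ ≤ 1 := by linarith
        _ ≤ _ := h1
    have h3 := le_of_mul_le_mul_left h2 (by positivity)
    exact_mod_cast h3
  have hinj : Set.InjOn (fun i : ℕ => 2 * i + 1) (Finset.Ico I (2 * I)) :=
    fun a _ b _ h => by simpa using h
  have hsub : (Finset.Ico I (2 * I)).image (fun i => 2 * i + 1)
      ⊆ oddsUpTo n \ oddsUpTo ⌊L / t⌋₊ := by
    intro k hk
    obtain ⟨i, hi, rfl⟩ := Finset.mem_image.1 hk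
    rw [Finset.mem_Ico] at hi
    rw [Finset.mem_sdiff, mem_oddsUpTo, mem_oddsUpTo]
    refine ⟨⟨by omega, i, rfl⟩, fun h => ?_⟩
    have := h.1
    omega
  have hpos : ∀ k ∈ oddsUpTo n \ oddsUpTo ⌊L / t⌋₊, 0 < k :=
    fun k hk => pos_of_mem_oddsUpTo (Finset.mem_sdiff.1 hk).1
  refine (boltzNorm_anti ht0 hpos hsub).trans ?_
  rw [boltzNorm, Finset.prod_image hinj]
  calc _ ≤ ∏ _i ∈ Finset.Ico I (2 * I), Real.exp (-(2 * Real.exp (-(4 * (L + 1))))) := by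
        refine Finset.prod_le_prod (fun _ _ => sq_nonneg _) fun i hi => ?_
        rw [Finset.mem_Ico] at hi
        have h1 := one_sub_exp_neg_mem ht0 (show 0 < 2 * i + 1 by omega)
        have h2 : Real.exp (-(4 * (L + 1))) ≤ Real.exp (-(t * (2 * i + 1 : ℕ))) := by
          rw [Real.exp_le_exp]
          have : ((2 * i + 1 : ℕ) : ℝ) ≤ 4 * I := by exact_mod_cast (by omega : 2 * i + 1 ≤ 4 * I)
          nlinarith
        have h3 := Real.add_one_le_exp (-(Real.exp (-(t * (2 * i + 1 : ℕ)))))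
        have h4 : 1 - Real.exp (-(t * (2 * i + 1 : ℕ)))
            ≤ Real.exp (-(Real.exp (-(t * (2 * i + 1 : ℕ))))) := by linarith
        calc _ ≤ Real.exp (-(Real.exp (-(t * (2 * i + 1 : ℕ))))) ^ 2 := by
              gcongr; exact h1.1.le
          _ ≤ _ := by
              rw [← Real.exp_nat_mul, Real.exp_le_exp]
              push_cast at h2 ⊢
              linarith
    _ ≤ _ := by
        rw [Finset.prod_const, ← Real.exp_nat_mul, Real.exp_le_exp, Nat.card_Ico,
          show 2 * I - I = I by omega]
        have h5 := Real.exp_pos (-(4 * (L + 1)))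
        rw [show 2 * L * Real.exp (-(4 * (L + 1))) / t
          = (L / t) * (2 * Real.exp (-(4 * (L + 1)))) by ring]
        nlinarith

/-- Each term is the probability that `c` occurs on the left and nothing larger occurs on either
side. These events are disjoint. The induction step is `x + (1 - x)^2 ≤ 1`. -/
theorem sum_exp_mul_boltzNorm_le {t : ℝ} (ht : 0 < t) (n : ℕ) :
    ∑ c ∈ oddsUpTo n, Real.exp (-(t * c)) * boltzNorm t (oddsUpTo n \ oddsUpTo c) ≤ 1 := by
  induction n with
  | zero => simp [oddsUpTo, Finset.filter_singleton]
  | succ n ih =>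
    by_cases hodd : Odd (n + 1)
    · have hnO : n + 1 ∉ oddsUpTo n := fun h => by have := (mem_oddsUpTo.1 h).1; omega
      have hsum : ∑ c ∈ oddsUpTo n, Real.exp (-(t * c)) * boltzNorm t (oddsUpTo (n + 1) \ oddsUpTo c)
          = (1 - Real.exp (-(t * (n + 1 : ℕ)))) ^ 2
            * ∑ c ∈ oddsUpTo n, Real.exp (-(t * c)) * boltzNorm t (oddsUpTo n \ oddsUpTo c) := by
        rw [Finset.mul_sum]
        refine Finset.sum_congr rfl fun c hc => ?_
        have h1 : n + 1 ∉ oddsUpTo c := fun h => by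
          have := (mem_oddsUpTo.1 h).1
          have := (mem_oddsUpTo.1 hc).1
          omega
        have h2 : n + 1 ∉ oddsUpTo n \ oddsUpTo c := fun h => hnO (Finset.mem_sdiff.1 h).1
        rw [oddsUpTo_succ_of_odd hodd, Finset.insert_sdiff_of_notMem _ h1, boltzNorm,
          Finset.prod_insert h2, ← boltzNorm]
        ring
      have hlast : boltzNorm t (oddsUpTo (n + 1) \ oddsUpTo (n + 1)) = 1 := by
        simp [boltzNorm]
      rw [oddsUpTo_succ_of_odd hodd, Finset.sum_insert hnO, ← oddsUpTo_succ_of_odd hodd, hlast,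
        hsum]
      have h1 := one_sub_exp_neg_mem ht (Nat.succ_pos n)
      rw [Nat.succ_eq_add_one] at h1
      set x := Real.exp (-(t * (n + 1 : ℕ)))
      have h3 : (1 - x) ^ 2 * ∑ c ∈ oddsUpTo n,
          Real.exp (-(t * c)) * boltzNorm t (oddsUpTo n \ oddsUpTo c) ≤ (1 - x) ^ 2 * 1 := by
        gcongr
      nlinarith
    · rw [oddsUpTo_succ_of_not_odd hodd]
      exact ih

theorem oddsUpTo_subset {a b : ℕ} (h : a ≤ b) : oddsUpTo a ⊆ oddsUpTo b := fun k hk => by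
  rw [mem_oddsUpTo] at hk ⊢
  exact ⟨hk.1.trans h, hk.2⟩

/-! ### Pairs with tied maxima are negligible -/

/-- The number of pairs of multisets of odd numbers, of total sum `n`, with a common maximum. -/
def tiedCount (n : ℕ) : ℕ :=
  ∑ c ∈ oddsUpTo n, if 2 * c ≤ n then (multisetPairs (oddsUpTo c) (n - 2 * c)).card else 0

/-- The right side is `ε t^(5/2)`, beaten by the cubic term in the series of `exp (c / t)`. -/
theorem eventually_exp_neg_div_le {c ε : ℝ} (hc : 0 < c) (hε : 0 < ε) : ∀ᶠ n : ℕ in atTop,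
    Real.exp (-(c / tilt n)) ≤ ε * (tilt n * tiltScale n) := by
  have hη : 0 < min 1 (ε * c ^ 3 / 6) ^ 2 := by positivity
  filter_upwards [eventually_tilt_lt hη, eventually_gt_atTop 0] with n ht hn
  obtain ⟨ht0, ht⟩ := ht
  set t := tilt n with htdef
  have hst : 0 < √t := Real.sqrt_pos.2 ht0
  have hsqt : √t ^ 2 = t := Real.sq_sqrt ht0.le
  have h1 : √t ≤ ε * c ^ 3 / 6 := by
    refine le_trans ?_ (min_le_right 1 _)
    rw [← Real.sqrt_sq (show 0 ≤ min 1 (ε * c ^ 3 / 6) by positivity)]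
    exact Real.sqrt_le_sqrt ht.le
  have h2 := Real.pow_div_factorial_le_exp (x := c / t) (by positivity) 3
  rw [Real.exp_neg, inv_le_comm₀ (Real.exp_pos _) (by unfold tiltScale; rw [← htdef]; positivity)]
  refine le_trans ?_ h2
  unfold tiltScale
  rw [← htdef]
  rw [show ((Nat.factorial 3 : ℕ) : ℝ) = 6 by norm_num [Nat.factorial], div_pow, div_div,
    inv_eq_one_div, div_le_div_iff₀ (by positivity) (by positivity)]
  have h3 : t ^ 3 * 6 = (t * (t * √t)) * (6 * √t) := by
    calc t ^ 3 * 6 = t ^ 2 * t * 6 := by ring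
      _ = t ^ 2 * √t ^ 2 * 6 := by rw [hsqt]
      _ = _ := by ring
  rw [one_mul, h3]
  calc (t * (t * √t)) * (6 * √t) ≤ (t * (t * √t)) * (6 * (ε * c ^ 3 / 6)) := by gcongr
    _ = _ := by ring

/-- Each of the two removed copies of `c` carries a weight `exp (-t c)`: one will give smallness for
large `c`, the other makes the remaining weights summable through `sum_exp_mul_boltzNorm_le`. -/
theorem exp_mul_boltzMass_term {t : ℝ} {n c : ℕ} (hcn : c ≤ n) (hc : 2 * c ≤ n) :
    ((multisetPairs (oddsUpTo c) (n - 2 * c)).card : ℝ) * (Real.exp (-(t * n))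
        * boltzNorm t (oddsUpTo n))
      = Real.exp (-(t * c)) * boltzMass t (oddsUpTo c) (n - 2 * c)
        * (Real.exp (-(t * c)) * boltzNorm t (oddsUpTo n \ oddsUpTo c)) := by
  rw [← boltzNorm_sdiff_mul (oddsUpTo_subset hcn), boltzMass]
  have : Real.exp (-(t * n)) = Real.exp (-(t * (n - 2 * c : ℕ))) * Real.exp (-(t * c))
      * Real.exp (-(t * c)) := by
    rw [← Real.exp_add, ← Real.exp_add]
    push_cast [Nat.cast_sub hc]
    ring_nf
  rw [this]
  ring

/-- A common maximum `c ≤ L / t` has exponentially small weight. Beyond that, `exp (-t c) ≤ exp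
(-L)`, the mass at the required size is `O(σ)`, and the other factors sum to at most `1`; `L` is
chosen large in terms of `ε`. -/
theorem eventually_tiedCount_le {ε : ℝ} (hε : 0 < ε) : ∀ᶠ n : ℕ in atTop,
    (tiedCount n : ℝ) * (Real.exp (-(tilt n * n)) * boltzNorm (tilt n) (oddsUpTo n))
      ≤ ε * tiltScale n := by
  have hD := charConst_pos
  obtain ⟨L, hL1, hL⟩ : ∃ L : ℝ, 1 ≤ L ∧ charConst * Real.exp (-L) ≤ ε / 2 := by
    refine ⟨1 + 2 * charConst / ε, le_add_of_nonneg_right (by positivity), ?_⟩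
    rw [Real.exp_neg, ← div_eq_mul_inv, div_le_iff₀ (Real.exp_pos _)]
    have h1 := Real.add_one_le_exp (1 + 2 * charConst / ε)
    calc charConst = ε / 2 * (2 * charConst / ε) := by field_simp
      _ ≤ _ := by gcongr; linarith
  have hL0 : 0 < L := by linarith
  obtain ⟨c₀, hc₀, hnorm⟩ := eventually_boltzNorm_le hL0
  filter_upwards [hnorm, eventually_exp_neg_div_le hc₀ (show 0 < ε / (4 * L) by positivity),
    eventually_tilt_lt (show (0 : ℝ) < 1 / 16 by norm_num), eventually_gt_atTop 0]
    with n hnorm hexp ht hn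
  obtain ⟨ht0, ht1⟩ := ht
  have hσ := tiltScale_pos hn
  have hσt := tiltScale_sq hn
  set t := tilt n with htdef
  set σ := tiltScale n with hσdef
  set ρ := ⌊L / t⌋₊ with hρ
  have hS : ∀ {m : ℕ}, ∀ k ∈ oddsUpTo m, 0 < k := fun k hk => pos_of_mem_oddsUpTo hk
  have hle1 : ∀ x : ℕ, Real.exp (-(t * x)) ≤ 1 := fun x =>
    Real.exp_le_one_iff.2 (neg_nonpos.2 (by positivity))
  have hpos : ∀ {m : ℕ}, ∀ k ∈ oddsUpTo n \ oddsUpTo m, 0 < k :=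
    fun k hk => hS k (Finset.mem_sdiff.1 hk).1
  have hterm : ∀ c ∈ oddsUpTo n,
      ((if 2 * c ≤ n then (multisetPairs (oddsUpTo c) (n - 2 * c)).card else 0 : ℕ) : ℝ)
        * (Real.exp (-(t * n)) * boltzNorm t (oddsUpTo n))
      ≤ (if c ≤ ρ then Real.exp (-(c₀ / t)) else 0)
        + ε / 2 * σ * (Real.exp (-(t * c)) * boltzNorm t (oddsUpTo n \ oddsUpTo c)) := by
    intro c hc
    have hcn := (mem_oddsUpTo.1 hc).1
    have hn0 := boltzNorm_nonneg t (oddsUpTo n \ oddsUpTo c)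
    have h0 : 0 ≤ ε / 2 * σ * (Real.exp (-(t * c)) * boltzNorm t (oddsUpTo n \ oddsUpTo c)) := by
      positivity
    by_cases h2 : 2 * c ≤ n
    · rw [if_pos h2, exp_mul_boltzMass_term hcn h2]
      have hm0 := boltzMass_nonneg t (oddsUpTo c) (n - 2 * c)
      split_ifs with hcρ
      · have h1 : boltzNorm t (oddsUpTo n \ oddsUpTo c) ≤ Real.exp (-(c₀ / t)) :=
          (boltzNorm_anti ht0 hpos (Finset.sdiff_subset_sdiff le_rfl (oddsUpTo_subset hcρ))).trans hnorm
        have h3 := boltzMass_le_one ht0 hS (n - 2 * c) (S := oddsUpTo c)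
        have h4 : Real.exp (-(t * c)) * boltzMass t (oddsUpTo c) (n - 2 * c)
            * (Real.exp (-(t * c)) * boltzNorm t (oddsUpTo n \ oddsUpTo c))
            ≤ 1 * 1 * (1 * Real.exp (-(c₀ / t))) := by
          gcongr
          · exact hle1 c
          · exact hle1 c
        linarith
      · rw [zero_add]
        have hcL : L ≤ t * c := by
          have h5 : L / t < ρ + 1 := Nat.lt_floor_add_one _
          have h6 : (ρ : ℝ) + 1 ≤ c := by exact_mod_cast (by omega : ρ + 1 ≤ c)
          rw [div_lt_iff₀ ht0] at h5
          nlinarith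
        have h3 := boltzMass_le ht0 ht1.le (by linarith : 1 ≤ t * c) hσ hσt (n - 2 * c)
        have h4 : Real.exp (-(t * c)) ≤ Real.exp (-L) := Real.exp_le_exp.2 (by linarith)
        have h5 : Real.exp (-(t * c)) * boltzMass t (oddsUpTo c) (n - 2 * c) ≤ ε / 2 * σ := by
          calc _ ≤ Real.exp (-L) * (charConst * σ) := by gcongr
            _ = charConst * Real.exp (-L) * σ := by ring
            _ ≤ _ := by gcongr
        gcongr
    · rw [if_neg h2]
      have : 0 ≤ (if c ≤ ρ then Real.exp (-(c₀ / t)) else 0) := by split_ifs <;> positivity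
      push_cast
      linarith
  rw [tiedCount, Nat.cast_sum, Finset.sum_mul]
  refine (Finset.sum_le_sum hterm).trans ?_
  rw [Finset.sum_add_distrib, ← Finset.mul_sum]
  have h1 := sum_exp_mul_boltzNorm_le ht0 n
  have h2 : ∑ c ∈ oddsUpTo n, (if c ≤ ρ then Real.exp (-(c₀ / t)) else 0) ≤ ε / 2 * σ := by
    rw [← Finset.sum_filter, Finset.sum_const, nsmul_eq_mul]
    have h3 : ((oddsUpTo n).filter (· ≤ ρ)).card ≤ ρ + 1 := by
      rw [← Finset.card_range (ρ + 1)]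
      refine Finset.card_le_card fun k hk => ?_
      have := (Finset.mem_filter.1 hk).2
      simp only [Finset.mem_range]
      omega
    have h4 : (((oddsUpTo n).filter (· ≤ ρ)).card : ℝ) ≤ 2 * (L / t) := by
      have h5 : (ρ : ℝ) ≤ L / t := Nat.floor_le (by positivity)
      have h6 : (((oddsUpTo n).filter (· ≤ ρ)).card : ℝ) ≤ ρ + 1 := by exact_mod_cast h3
      have h7 : 1 ≤ L / t := by rw [le_div_iff₀ ht0]; linarith
      linarith
    calc _ ≤ 2 * (L / t) * (ε / (4 * L) * (t * σ)) := by gcongr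
      _ = _ := by field_simp; norm_num
  have h3 : ε / 2 * σ * ∑ c ∈ oddsUpTo n,
      Real.exp (-(t * c)) * boltzNorm t (oddsUpTo n \ oddsUpTo c) ≤ ε / 2 * σ * 1 := by
    gcongr
  linarith

/-! ### Local comparison with the product of geometric laws -/

namespace OddUnimodalSeq

/-- Telescoping with nothing removed and starting from the empty set of parts, which has no pair of
positive total size. -/
theorem two_mul_ncard_ofSize_le {n : ℕ} (hn : 0 < n) :
    2 * (ofSize n).ncard ≤ (multisetPairs (oddsUpTo n) n).card + tiedCount n := by
  have h1 := ncard_ofSize_le n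
  have h2 := card_multisetPairs_telescope (R := ∅) (ρ := 0) (by simp) n (Nat.zero_le n)
  have e : (oddsUpTo n).filter (0 < ·) = oddsUpTo n :=
    Finset.filter_true_of_mem fun k hk => pos_of_mem_oddsUpTo hk
  have e0 : (multisetPairs (oddsUpTo 0) n).card = 0 := by
    rw [Finset.card_eq_zero]
    refine Finset.eq_empty_of_forall_notMem fun p hp => ?_
    rw [mem_multisetPairs fun k hk => pos_of_mem_oddsUpTo hk] at hp
    have hz : oddsUpTo 0 = ∅ := by simp [oddsUpTo, Finset.filter_singleton]
    rw [hz] at hp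
    have h1 : p.1 = 0 := Multiset.eq_zero_of_forall_notMem fun a ha => by simpa using hp.1 a ha
    have h2 : p.2 = 0 := Multiset.eq_zero_of_forall_notMem fun a ha => by simpa using hp.2.1 a ha
    have h3 := hp.2.2
    rw [h1, h2] at h3
    simp at h3
    omega
  have e1 : ∑ c ∈ oddsUpTo n, (if c ≤ n then (multisetPairs (oddsUpTo c) (n - c)).card else 0)
      = ∑ c ∈ oddsUpTo n, (multisetPairs (oddsUpTo c) (n - c)).card :=
    Finset.sum_congr rfl fun c hc => if_pos (mem_oddsUpTo.1 hc).1
  simp only [Finset.sdiff_empty, e, e0, e1, zero_add] at h2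
  rw [tiedCount]
  omega

/-- Telescoping from `ρ` with `R` removed; the tied term has a favourable sign here and is dropped.
-/
theorem card_le_two_mul_ncard {R : Finset ℕ} {ρ n : ℕ} (hR : ∀ k ∈ R, k ≤ ρ)
    (hRo : ∀ k ∈ R, Odd k) (hρ : ρ ≤ n) (x : Side → ℕ → ℕ) {m : ℕ}
    (hm : ∑ k ∈ R, k * x Side.L k + ∑ k ∈ R, k * x Side.R k = m) (hmn : m ≤ n) :
    (multisetPairs (oddsUpTo n \ R) (n - m)).card
      ≤ 2 * (ofSize n ∩ {s | ∀ k ∈ R, ∀ j, X j k s = x j k}).ncard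
        + (multisetPairs (oddsUpTo ρ \ R) (n - m)).card := by
  have h1 := sum_card_le_ncard (n := n) hR hRo x (hm.le.trans hmn)
  have h2 := card_multisetPairs_telescope hR (n - m) hρ
  rw [hm] at h1
  omega

/-- The total size of the parts in `R`. -/
def blockSize (R : Finset ℕ) (x : Side → ℕ → ℕ) : ℕ :=
  ∑ k ∈ R, k * x Side.L k + ∑ k ∈ R, k * x Side.R k

set_option maxHeartbeats 1000000 in
/-- Local comparison of the law of the multiplicities with a product of geometric laws. -/
theorem eventually_le_P_real {R : ℕ → Finset ℕ} {C : ℝ} (hRo : ∀ n, ∀ k ∈ R n, Odd k)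
    (hRC : ∀ᶠ n in atTop, ∀ k ∈ R n, tilt n * k ≤ C)
    (hRcard : Tendsto (fun n => ((R n).card : ℝ) * √(tilt n)) atTop (𝓝 0)) {ε : ℝ} (hε : 0 < ε) :
    ∃ δ > 0, ∀ᶠ n : ℕ in atTop, ∀ x : Side → ℕ → ℕ, blockSize (R n) x * tiltScale n ≤ δ →
      (1 - ε) * (Real.exp (-(tilt n * blockSize (R n) x)) * boltzNorm (tilt n) (R n))
        ≤ (P n).real {s | ∀ k ∈ R n, ∀ j, X j k s = x j k} := by
  have hD := charConst_pos
  obtain ⟨κ, hκ, hmass⟩ := eventually_le_boltzMass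
  -- Thus `R n` lies below `ρ = ⌊L / t⌋`, while pairs with all parts at most `ρ` are exponentially
  -- rare.
  set L := max C 1 with hL
  have hL0 : 0 < L := lt_of_lt_of_le one_pos (le_max_right _ _)
  obtain ⟨c₀, hc₀, hnorm⟩ := eventually_boltzNorm_le hL0
  set η := ε * κ / 4 with hη
  have hη0 : 0 < η := by positivity
  -- The bound `m σ ≤ 1` forces `m ≤ n`, because `1 ≤ t^2 n ≤ σ n`; the bound by `η / charConst`
  -- controls the effect of the shift by `m`.
  refine ⟨min 1 (η / charConst), by positivity, ?_⟩
  have hc1 : ∀ᶠ n in atTop, ((R n).card : ℝ) * √(tilt n) < min (1 / 64) (η / (2 * charConst)) :=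
    hRcard.eventually_lt_const (by positivity)
  filter_upwards [hRC, hmass, hnorm, eventually_exp_neg_div_le hc₀ hη0, hc1,
    eventually_tilt_lt (show 0 < min (1 / 16) (1 / L) by positivity), eventually_tiedCount_le hη0,
    eventually_gt_atTop 0] with n hRC hmass hnorm hexp hcard ht htied hn x hx
  obtain ⟨ht0, ht1⟩ := ht
  rw [lt_min_iff] at ht1 hcard
  rw [le_min_iff] at hx
  obtain ⟨ht1, htL⟩ := ht1
  obtain ⟨hcard1, hcard2⟩ := hcard
  obtain ⟨hx1, hx2⟩ := hx
  have hσ := tiltScale_pos hn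
  have hσt := tiltScale_sq hn
  have hσdef : tiltScale n = tilt n * √(tilt n) := rfl
  set t := tilt n with htdef
  set σ := tiltScale n
  set m := blockSize (R n) x with hm
  set ρ := ⌊L / t⌋₊ with hρ
  have hst : 0 < √t := Real.sqrt_pos.2 ht0
  have hsqt : √t ^ 2 = t := Real.sq_sqrt ht0.le
  have hst1 : √t ≤ 1 := Real.sqrt_le_one.2 (by linarith)
  have ht2n := one_le_tilt_sq_mul hn
  rw [← htdef] at ht2n
  have htn := one_le_tilt_mul hn (by rw [← htdef]; linarith)
  rw [← htdef] at htn
  have hmn : m ≤ n := by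
    have h1 : (m : ℝ) * σ ≤ n * σ := by
      refine hx1.trans (ht2n.trans ?_)
      rw [hσdef, mul_comm (n : ℝ)]
      gcongr
      rw [pow_two]
      gcongr
      nlinarith
    exact_mod_cast le_of_mul_le_mul_right h1 hσ
  have hρn : ρ ≤ n := by
    have h1 : (ρ : ℝ) ≤ L / t := Nat.floor_le (by positivity)
    rw [lt_div_iff₀ hL0] at htL
    have h2 : L / t ≤ n := by
      rw [div_le_iff₀ ht0]
      have h3 : t * L ≤ t * (n * t) := by nlinarith
      exact le_of_mul_le_mul_left h3 ht0
    exact_mod_cast h1.trans h2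
  have hRρ : ∀ k ∈ R n, k ≤ ρ := by
    intro k hk
    refine Nat.le_floor ?_
    rw [le_div_iff₀ ht0, mul_comm]
    exact (hRC k hk).trans (le_max_left _ _)
  have hRsub : R n ⊆ oddsUpTo ρ := fun k hk => mem_oddsUpTo.2 ⟨hRρ k hk, hRo n k hk⟩
  have hRn : R n ⊆ oddsUpTo n := hRsub.trans (oddsUpTo_subset hρn)
  have hS : ∀ {m : ℕ}, ∀ k ∈ oddsUpTo m, 0 < k := fun k hk => pos_of_mem_oddsUpTo hk
  have hdiff := abs_boltzMass_sdiff_sub_le ht0 ht1.le htn hRn (by nlinarith) hσ hσt hmn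
  have hdiff2 : (m + 2 * (R n).card / t) * (charConst * σ ^ 2) ≤ 2 * η * σ := by
    have h1 : (m : ℝ) * σ * charConst ≤ η := by rwa [le_div_iff₀ hD] at hx2
    have h2 : ((R n).card : ℝ) * √t * (2 * charConst) ≤ η := by
      rw [lt_div_iff₀ (by positivity)] at hcard2
      exact hcard2.le
    have e : (m + 2 * (R n).card / t) * (charConst * σ ^ 2)
        = (m * σ * charConst + (R n).card * √t * (2 * charConst)) * σ := by
      have : 2 * ((R n).card : ℝ) / t * σ = 2 * ((R n).card * √t) := by
        rw [hσdef]; field_simp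
      calc _ = m * σ * charConst * σ + (2 * (R n).card / t * σ) * charConst * σ := by ring
        _ = _ := by rw [this]; ring
    rw [e]
    gcongr
    linarith
  set N := (ofSize n ∩ {s | ∀ k ∈ R n, ∀ j, X j k s = x j k}).ncard with hN
  have hlow := card_le_two_mul_ncard hRρ (hRo n) hρn x hm.symm hmn
  have hupp := two_mul_ncard_ofSize_le hn
  set U := (ofSize n).ncard with hU
  have hlow' : ((multisetPairs (oddsUpTo n \ R n) (n - m)).card : ℝ)
      ≤ 2 * N + (multisetPairs (oddsUpTo ρ \ R n) (n - m)).card := by exact_mod_cast hlow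
  have hupp' : 2 * (U : ℝ) ≤ (multisetPairs (oddsUpTo n) n).card + tiedCount n := by
    exact_mod_cast hupp
  set f := boltzMass t (oddsUpTo n) n with hf
  set W := Real.exp (-(t * n)) * boltzNorm t (oddsUpTo n) with hW
  have hW0 : 0 < W := mul_pos (Real.exp_pos _) (boltzNorm_pos ht0 hS)
  set q := Real.exp (-(t * m)) * boltzNorm t (R n) with hq
  have hq0 : 0 < q := mul_pos (Real.exp_pos _) (boltzNorm_pos ht0 fun k hk => hS k (hRn hk))
  set V := Real.exp (-(t * (n - m : ℕ))) * boltzNorm t (oddsUpTo n \ R n) with hV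
  have hV0 : 0 ≤ V := mul_nonneg (Real.exp_pos _).le (boltzNorm_nonneg _ _)
  -- The weight of a pair of size `n` factors into that of its parts outside `R n` and the
  -- probability `q` of the prescribed block. In the quotient of counts `V` cancels and `q` remains.
  have hWV : W = V * q := by
    have : Real.exp (-(t * n)) = Real.exp (-(t * (n - m : ℕ))) * Real.exp (-(t * m)) := by
      rw [← Real.exp_add]
      push_cast [Nat.cast_sub hmn]
      ring_nf
    rw [hW, hV, hq, ← boltzNorm_sdiff_mul hRn, this]
    ring
  have hfirst : ((multisetPairs (oddsUpTo n \ R n) (n - m)).card : ℝ) * V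
      = boltzMass t (oddsUpTo n \ R n) (n - m) := by rw [hV, boltzMass]; ring
  have hsecond : ((multisetPairs (oddsUpTo ρ \ R n) (n - m)).card : ℝ) * V ≤ η * σ := by
    have e1 : (oddsUpTo n \ R n) \ (oddsUpTo ρ \ R n) = oddsUpTo n \ oddsUpTo ρ := by
      ext k
      simp only [Finset.mem_sdiff]
      have : k ∈ R n → k ∈ oddsUpTo ρ := fun h => hRsub h
      tauto
    have e2 : ((multisetPairs (oddsUpTo ρ \ R n) (n - m)).card : ℝ) * V
        = boltzMass t (oddsUpTo ρ \ R n) (n - m) * boltzNorm t (oddsUpTo n \ oddsUpTo ρ) := by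
      rw [hV, boltzMass, ← boltzNorm_sdiff_mul
        (Finset.sdiff_subset_sdiff (oddsUpTo_subset hρn) le_rfl : oddsUpTo ρ \ R n ⊆ _), e1]
      ring
    rw [e2]
    calc _ ≤ 1 * Real.exp (-(c₀ / t)) := by
          gcongr
          · exact boltzNorm_nonneg _ _
          · exact boltzMass_le_one ht0 (fun k hk => hS k (Finset.mem_sdiff.1 hk).1) _
      _ ≤ η * (t * σ) := by rw [one_mul]; exact hexp
      _ ≤ η * (1 * σ) := by gcongr; linarith
      _ = _ := by ring
  have hNV : f - 3 * η * σ ≤ 2 * N * V := by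
    have h1 := mul_le_mul_of_nonneg_right hlow' hV0
    rw [add_mul, hfirst] at h1
    have h2 := (abs_le.1 (hdiff.trans hdiff2)).1
    linarith
  have hUW : 2 * U * W ≤ f + η * σ := by
    have h1 := mul_le_mul_of_nonneg_right hupp' hW0.le
    rw [add_mul] at h1
    have : ((multisetPairs (oddsUpTo n) n).card : ℝ) * W = f := by rw [hW, hf, boltzMass]; ring
    linarith
  have hU0 : (0 : ℝ) < U := by
    exact_mod_cast (Set.ncard_pos (finite_ofSize n)).2 (nonempty_ofSize hn)
  rw [P_real_apply, le_div_iff₀ hU0]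
  have hf0 : 0 < f := lt_of_lt_of_le (by positivity) hmass
  -- The four errors, three in the numerator and one in the denominator, together are at most `ε f`
  -- by the choice of `η`, whence `(1 - ε) (f + ησ) ≤ f - 3ησ`.
  have h4 : 4 * (η * σ) ≤ ε * f := by
    calc 4 * (η * σ) = ε * (κ * σ) := by rw [hη]; ring
      _ ≤ _ := by gcongr
  have hησ : 0 < η * σ := by positivity
  rcases le_or_gt 1 ε with h1 | h1
  · have : (1 - ε) * q * U ≤ 0 :=
      mul_nonpos_of_nonpos_of_nonneg
        (mul_nonpos_of_nonpos_of_nonneg (by linarith) hq0.le) hU0.le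
    exact this.trans (Nat.cast_nonneg _)
  · have hVpos : 0 < V := by
      by_contra h
      have : V = 0 := le_antisymm (not_lt.1 h) hV0
      rw [hWV, this, zero_mul] at hW0
      exact lt_irrefl _ hW0
    have h2 : (1 - ε) * (2 * U * W) ≤ 2 * N * V := by
      calc (1 - ε) * (2 * U * W) ≤ (1 - ε) * (f + η * σ) := by
            gcongr
        _ ≤ f - 3 * η * σ := by nlinarith
        _ ≤ _ := hNV
    rw [hWV] at h2
    have h3 : 2 * V * ((1 - ε) * q * U) ≤ 2 * V * N := by linarith
    exact le_of_mul_le_mul_left h3 (by positivity)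

end OddUnimodalSeq

/-! ### Approximation in total variation -/

/-- A lower bound for the point masses of a probability measure on a set that carries most of the
mass of another one bounds their distance in total variation. -/
theorem abs_measureReal_sub_le_of_singleton {α : Type*} [Countable α] [MeasurableSpace α]
    [MeasurableSingletonClass α] (μ ν : Measure α) [IsProbabilityMeasure μ]
    [IsProbabilityMeasure ν] {G : Set α} {ε : ℝ} (hε : 0 ≤ ε)
    (h : ∀ x ∈ G, (1 - ε) * ν.real {x} ≤ μ.real {x}) (E : Set α) :
    |μ.real E - ν.real E| ≤ ε + ν.real Gᶜ := by
  have key : ∀ E : Set α, ν.real E - ε - ν.real Gᶜ ≤ μ.real E := by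
    intro E
    have hmeas : ∀ s : Set α, MeasurableSet s := fun s => s.to_countable.measurableSet
    have h1 : ENNReal.ofReal (1 - ε) * ν (E ∩ G) ≤ μ E := by
      refine le_trans ?_ (measure_mono (Set.inter_subset_left : E ∩ G ⊆ E))
      rw [← ν.tsum_indicator_apply_singleton _ (hmeas _),
        ← μ.tsum_indicator_apply_singleton _ (hmeas _), ← ENNReal.tsum_mul_left]
      refine ENNReal.tsum_le_tsum fun x => ?_
      by_cases hx : x ∈ E ∩ G
      · rw [Set.indicator_of_mem hx, Set.indicator_of_mem hx]
        have h2 := ENNReal.ofReal_le_ofReal (h x hx.2)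
        rwa [ENNReal.ofReal_mul' measureReal_nonneg, ofReal_measureReal, ofReal_measureReal] at h2
      · rw [Set.indicator_of_notMem hx, mul_zero]
        exact zero_le
    have h2 : (1 - ε) * ν.real (E ∩ G) ≤ μ.real E := by
      have h3 := ENNReal.toReal_mono (measure_ne_top μ E) h1
      rw [ENNReal.toReal_mul] at h3
      refine (mul_le_mul_of_nonneg_right ?_ measureReal_nonneg).trans h3
      rw [ENNReal.toReal_ofReal']
      exact le_max_left _ _
    have h4 : ν.real E ≤ ν.real (E ∩ G) + ν.real Gᶜ := by
      refine (measureReal_mono ?_).trans (measureReal_union_le _ _)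
      intro x hx
      by_cases hG : x ∈ G
      · exact Or.inl ⟨hx, hG⟩
      · exact Or.inr hG
    have h5 : ν.real (E ∩ G) ≤ 1 := measureReal_le_one
    nlinarith [measureReal_nonneg (μ := ν) (s := E ∩ G)]
  -- Both laws have total mass `1`, so the one-sided bound for the complement is the missing upper
  -- bound for `E`.
  have hE := key E
  have hEc := key Eᶜ
  have hm : MeasurableSet E := E.to_countable.measurableSet
  rw [probReal_compl_eq_one_sub hm, probReal_compl_eq_one_sub hm] at hEc
  rw [abs_le]
  constructor <;> linarith

/-- The geometric law on `ℕ` with failure probability `exp (- |x|)`. -/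
noncomputable def geomLaw (x : ℝ) : Measure ℕ :=
  geometricMeasure (unitInterval.symm ⟨Real.exp (-|x|), (Real.exp_pos _).le,
    Real.exp_le_one_iff.2 (neg_nonpos.2 (abs_nonneg x))⟩)

instance (x : ℝ) : IsProbabilityMeasure (geomLaw x) := by unfold geomLaw; infer_instance

theorem geomLaw_real_singleton {x : ℝ} (hx : 0 < x) (j : ℕ) :
    (geomLaw x).real {j} = Real.exp (-(x * j)) * (1 - Real.exp (-x)) := by
  have hlt : Real.exp (-x) < 1 := Real.exp_lt_one_iff.2 (by linarith)
  rw [geomLaw, geometricMeasure_real_singleton]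
  · simp only [unitInterval.coe_symm_eq, abs_of_pos hx, sub_sub_cancel]
    rw [← Real.exp_nat_mul]
    ring_nf
  · intro h
    have := congrArg Subtype.val h
    simp only [unitInterval.coe_symm_eq, abs_of_pos hx] at this
    norm_num at this
    linarith

theorem geomLaw_real_Iic {x : ℝ} (hx : 0 < x) (v : ℕ) :
    (geomLaw x).real (Set.Iic v) = 1 - Real.exp (-(x * (v + 1))) := by
  have e : Set.Iic v = ((Finset.range (v + 1) : Finset ℕ) : Set ℕ) := by
    ext j; simp
  rw [e, ← sum_measureReal_singleton]
  simp_rw [geomLaw_real_singleton hx]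
  rw [← Finset.sum_mul]
  have h1 : ∀ j : ℕ, Real.exp (-(x * j)) = Real.exp (-x) ^ j := fun j => by
    rw [← Real.exp_nat_mul]; ring_nf
  simp_rw [h1]
  rw [geom_sum_mul_neg, ← h1]
  push_cast
  rfl

theorem lintegral_geomLaw_le {x : ℝ} (hx : 0 < x) :
    ∫⁻ j, (j : ENNReal) ∂(geomLaw x) ≤ ENNReal.ofReal (1 / x) := by
  have hlt : Real.exp (-x) < 1 := Real.exp_lt_one_iff.2 (by linarith)
  have h1 : ∀ j : ℕ, Real.exp (-(x * j)) = Real.exp (-x) ^ j := fun j => by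
    rw [← Real.exp_nat_mul]; ring_nf
  have hsum := (hasSum_coe_mul_geometric_of_norm_lt_one (𝕜 := ℝ) (r := Real.exp (-x))
    (by rw [Real.norm_of_nonneg (Real.exp_pos _).le]; exact hlt)).mul_right (1 - Real.exp (-x))
  rw [lintegral_countable']
  have h2 : ∀ j : ℕ, (j : ENNReal) * geomLaw x {j}
      = ENNReal.ofReal (j * Real.exp (-x) ^ j * (1 - Real.exp (-x))) := by
    intro j
    rw [← ofReal_measureReal, geomLaw_real_singleton hx, h1, ← ENNReal.ofReal_natCast,
      ← ENNReal.ofReal_mul (by positivity), mul_assoc]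
  simp_rw [h2]
  rw [← ENNReal.ofReal_tsum_of_nonneg (fun j => mul_nonneg (by positivity) (by linarith))
    hsum.summable, hsum.tsum_eq]
  refine ENNReal.ofReal_le_ofReal ?_
  have h3 : 0 < 1 - Real.exp (-x) := by linarith
  have h4 : Real.exp (-x) / (1 - Real.exp (-x)) ^ 2 * (1 - Real.exp (-x)) = meanOcc x := by
    have h5 : 1 - Real.exp (-x) = (Real.exp x - 1) / Real.exp x := by
      rw [Real.exp_neg]; field_simp
    have h6 : 0 < Real.exp x - 1 := by linarith [Real.add_one_lt_exp hx.ne']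
    rw [h5, meanOcc, Real.exp_neg]
    field_simp
  rw [h4]
  exact meanOcc_le hx

namespace OddUnimodalSeq

/-- Independent geometric multiplicities for the parts in `R` on the two sides. -/
noncomputable def blockLaw (t : ℝ) (R : Finset ℕ) : Measure (↥R × Side → ℕ) :=
  Measure.pi fun p => geomLaw (t * (p.1 : ℕ))

instance (t : ℝ) (R : Finset ℕ) : IsProbabilityMeasure (blockLaw t R) := by
  unfold blockLaw; infer_instance

/-- The multiplicities of the parts in `R`. -/
def mult (R : Finset ℕ) (s : OddUnimodalSeq) : ↥R × Side → ℕ := fun p => X p.2 p.1 s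

theorem measurable_mult (R : Finset ℕ) : Measurable (mult R) := fun _ _ => trivial

/-- Extension of a family of multiplicities by zero. -/
def extendMult {R : Finset ℕ} (x : ↥R × Side → ℕ) (j : Side) (k : ℕ) : ℕ :=
  if h : k ∈ R then x (⟨k, h⟩, j) else 0

theorem extendMult_coe {R : Finset ℕ} (x : ↥R × Side → ℕ) (p : ↥R × Side) :
    extendMult x p.2 p.1 = x p := by
  rw [extendMult, dif_pos p.1.2]

theorem prod_side {M : Type*} [CommMonoid M] (f : Side → M) :
    ∏ j : Side, f j = f Side.L * f Side.R := by
  change ∏ j ∈ {Side.L, Side.R}, f j = _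
  rw [Finset.prod_pair (by decide)]

theorem sum_side {M : Type*} [AddCommMonoid M] (f : Side → M) :
    ∑ j : Side, f j = f Side.L + f Side.R := by
  change ∑ j ∈ {Side.L, Side.R}, f j = _
  rw [Finset.sum_pair (by decide)]

theorem blockSize_extendMult {R : Finset ℕ} (x : ↥R × Side → ℕ) :
    blockSize R (extendMult x) = ∑ p : ↥R × Side, (p.1 : ℕ) * x p := by
  rw [Fintype.sum_prod_type, blockSize, ← Finset.sum_add_distrib, ← Finset.sum_coe_sort R]
  refine Finset.sum_congr rfl fun k _ => ?_
  rw [sum_side, ← extendMult_coe x (k, Side.L), ← extendMult_coe x (k, Side.R)]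

theorem blockLaw_real_pi {t : ℝ} {R : Finset ℕ} (A : ↥R × Side → Set ℕ) :
    (blockLaw t R).real (Set.univ.pi A) = ∏ p : ↥R × Side, (geomLaw (t * (p.1 : ℕ))).real (A p) := by
  rw [measureReal_def, blockLaw, Measure.pi_pi, ENNReal.toReal_prod]
  rfl

theorem blockLaw_real_singleton {t : ℝ} (ht : 0 < t) {R : Finset ℕ} (hR : ∀ k ∈ R, 0 < k)
    (x : ↥R × Side → ℕ) : (blockLaw t R).real {x}
      = Real.exp (-(t * blockSize R (extendMult x))) * boltzNorm t R := by
  have hpos : ∀ p : ↥R × Side, 0 < t * ((p.1 : ℕ) : ℝ) := fun p => by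
    have : (0 : ℝ) < (p.1 : ℕ) := by exact_mod_cast hR _ p.1.2
    positivity
  rw [← Set.univ_pi_singleton x, blockLaw_real_pi]
  simp_rw [fun p => geomLaw_real_singleton (hpos p)]
  rw [Finset.prod_mul_distrib, ← Real.exp_sum, blockSize_extendMult, Finset.sum_neg_distrib,
    Fintype.prod_prod_type]
  congr 1
  · congr 2
    push_cast
    rw [Finset.mul_sum]
    exact Finset.sum_congr rfl fun p _ => by ring
  · rw [boltzNorm, ← Finset.prod_coe_sort R]
    exact Finset.prod_congr rfl fun k _ => by rw [prod_side, pow_two]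

/-- Markov's inequality: for each of the `2 |R|` coordinates, `k` times the multiplicity has
expectation at most `1 / t`, whatever `k` is. -/
theorem blockLaw_real_size_gt_le {t : ℝ} (ht : 0 < t) {R : Finset ℕ} (hR : ∀ k ∈ R, 0 < k) {a : ℝ}
    (ha : 0 < a) : (blockLaw t R).real {x | a < blockSize R (extendMult x)}
      ≤ 2 * R.card / t / a := by
  have hint : ∫⁻ x, (blockSize R (extendMult x) : ENNReal) ∂(blockLaw t R)
      ≤ ENNReal.ofReal (2 * R.card / t) := by
    have hmeas : ∀ p : ↥R × Side, Measurable fun x : ↥R × Side → ℕ => ((x p : ℕ) : ENNReal) :=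
      fun p => Measurable.of_discrete.comp (measurable_pi_apply p)
    have hp : ∀ p : ↥R × Side, ∫⁻ x, ((p.1 : ℕ) : ENNReal) * ((x p : ℕ) : ENNReal) ∂(blockLaw t R)
        ≤ ENNReal.ofReal (1 / t) := by
      intro p
      have hk : (0 : ℝ) < (p.1 : ℕ) := by exact_mod_cast hR _ p.1.2
      rw [lintegral_const_mul _ (hmeas p)]
      have h1 := (measurePreserving_eval (fun p : ↥R × Side => geomLaw (t * (p.1 : ℕ))) p).lintegral_comp
        (f := fun j : ℕ => (j : ENNReal)) Measurable.of_discrete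
      have h2 : ∫⁻ x, ((x p : ℕ) : ENNReal) ∂(blockLaw t R)
          ≤ ENNReal.ofReal (1 / (t * (p.1 : ℕ))) :=
        (le_of_eq h1).trans (lintegral_geomLaw_le (by positivity))
      calc _ ≤ ((p.1 : ℕ) : ENNReal) * ENNReal.ofReal (1 / (t * (p.1 : ℕ))) := by gcongr
        _ = ENNReal.ofReal (1 / t) := by
          rw [← ENNReal.ofReal_natCast, ← ENNReal.ofReal_mul hk.le]
          congr 1
          field_simp
    have e : ∀ x : ↥R × Side → ℕ, (blockSize R (extendMult x) : ENNReal)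
        = ∑ p : ↥R × Side, ((p.1 : ℕ) : ENNReal) * ((x p : ℕ) : ENNReal) := by
      intro x
      rw [blockSize_extendMult]
      push_cast
      rfl
    simp_rw [e]
    rw [lintegral_finsetSum _ fun p _ => (hmeas p).const_mul _]
    refine (Finset.sum_le_sum fun p _ => hp p).trans ?_
    rw [Finset.sum_const, Finset.card_univ, Fintype.card_prod, Fintype.card_coe,
      show Fintype.card Side = 2 from rfl, nsmul_eq_mul, ← ENNReal.ofReal_natCast,
      ← ENNReal.ofReal_mul (by positivity)]
    refine ENNReal.ofReal_le_ofReal (le_of_eq ?_)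
    push_cast
    ring
  have hmark := mul_meas_ge_le_lintegral₀ (μ := blockLaw t R)
    (f := fun x => (blockSize R (extendMult x) : ENNReal))
    Measurable.of_discrete.aemeasurable (ENNReal.ofReal a)
  have hsub : {x : ↥R × Side → ℕ | a < blockSize R (extendMult x)}
      ⊆ {x | ENNReal.ofReal a ≤ (blockSize R (extendMult x) : ENNReal)} := by
    intro x hx
    have hx : a < blockSize R (extendMult x) := hx
    change ENNReal.ofReal a ≤ _
    rw [← ENNReal.ofReal_natCast]
    exact ENNReal.ofReal_le_ofReal hx.le
  have h1 : ENNReal.ofReal a * blockLaw t R {x | a < blockSize R (extendMult x)}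
      ≤ ENNReal.ofReal (2 * R.card / t) :=
    (mul_le_mul_right (measure_mono hsub) _).trans (hmark.trans hint)
  have h2 := ENNReal.toReal_mono ENNReal.ofReal_ne_top h1
  rw [ENNReal.toReal_mul, ENNReal.toReal_ofReal ha.le, ENNReal.toReal_ofReal (by positivity)] at h2
  rw [le_div_iff₀ ha, mul_comm]
  exact h2

/-- The joint law of the multiplicities of the parts in `R n` is asymptotically a product of
geometric laws, in total variation. -/
theorem tendsto_P_real_sub_blockLaw {R : ℕ → Finset ℕ} {C : ℝ} (hRo : ∀ n, ∀ k ∈ R n, Odd k)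
    (hRC : ∀ᶠ n in atTop, ∀ k ∈ R n, tilt n * k ≤ C)
    (hRcard : Tendsto (fun n => ((R n).card : ℝ) * √(tilt n)) atTop (𝓝 0))
    (E : ∀ n, Set (↥(R n) × Side → ℕ)) :
    Tendsto (fun n => (P n).real (mult (R n) ⁻¹' E n) - (blockLaw (tilt n) (R n)).real (E n))
      atTop (𝓝 0) := by
  rw [Metric.tendsto_nhds]
  intro ε hε
  obtain ⟨δ, hδ, hev⟩ := eventually_le_P_real hRo hRC hRcard (show 0 < ε / 3 by positivity)
  have hc : ∀ᶠ n in atTop, ((R n).card : ℝ) * √(tilt n) < ε * δ / 6 :=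
    hRcard.eventually_lt_const (by positivity)
  filter_upwards [hev, hc, eventually_gt_atTop 0] with n hn hcard hn0
  have ht := tilt_pos hn0
  have hσ := tiltScale_pos hn0
  have := isProbabilityMeasure_P hn0
  have : IsProbabilityMeasure ((P n).map (mult (R n))) :=
    Measure.isProbabilityMeasure_map (measurable_mult _).aemeasurable
  have hpos : ∀ k ∈ R n, 0 < k := fun k hk => (hRo n k hk).pos
  have hmap : ∀ A : Set (↥(R n) × Side → ℕ),
      ((P n).map (mult (R n))).real A = (P n).real (mult (R n) ⁻¹' A) := fun A =>
    map_measureReal_apply (measurable_mult _) A.to_countable.measurableSet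
  have h := abs_measureReal_sub_le_of_singleton ((P n).map (mult (R n))) (blockLaw (tilt n) (R n))
    (G := {x | (blockSize (R n) (extendMult x) : ℝ) ≤ δ / tiltScale n}) (ε := ε / 3)
    (by positivity) (fun x hx => by
      have hx : (blockSize (R n) (extendMult x) : ℝ) ≤ δ / tiltScale n := hx
      rw [le_div_iff₀ hσ] at hx
      rw [blockLaw_real_singleton ht hpos, hmap]
      refine (hn (extendMult x) hx).trans (le_of_eq ?_)
      congr 1
      ext s
      simp only [Set.mem_ofPred_eq, Set.mem_preimage, Set.mem_singleton_iff]
      constructor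
      · intro hs
        funext p
        rw [← extendMult_coe x p]
        exact hs p.1 p.1.2 p.2
      · rintro rfl k hk j
        exact (extendMult_coe (mult (R n) s) (⟨k, hk⟩, j)).symm) (E n)
  rw [hmap] at h
  have hG : (blockLaw (tilt n) (R n)).real
      {x | (blockSize (R n) (extendMult x) : ℝ) ≤ δ / tiltScale n}ᶜ ≤ ε / 3 := by
    have e : {x : ↥(R n) × Side → ℕ | (blockSize (R n) (extendMult x) : ℝ) ≤ δ / tiltScale n}ᶜ
        = {x | δ / tiltScale n < blockSize (R n) (extendMult x)} := by
      ext x; simp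
    rw [e]
    refine (blockLaw_real_size_gt_le ht hpos (by positivity)).trans ?_
    -- The threshold is `δ / σ`, so Markov's bound equals `2 |R| √t / δ` and vanishes under the same
    -- condition on `|R|` as the local comparison.
    have e2 : 2 * ((R n).card : ℝ) / tilt n / (δ / tiltScale n)
        = 2 * ((R n).card * √(tilt n)) / δ := by
      rw [tiltScale]; field_simp
    rw [e2, div_le_iff₀ hδ]
    linarith
  rw [Real.dist_eq, sub_zero]
  linarith

theorem tendsto_P_real_box {R : ℕ → Finset ℕ} {C : ℝ} (hRo : ∀ n, ∀ k ∈ R n, Odd k)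
    (hRC : ∀ᶠ n in atTop, ∀ k ∈ R n, tilt n * k ≤ C)
    (hRcard : Tendsto (fun n => ((R n).card : ℝ) * √(tilt n)) atTop (𝓝 0))
    (w : ℕ → ℕ → Side → ℕ) :
    Tendsto (fun n => (P n).real {s | ∀ k ∈ R n, ∀ j, X j k s ≤ w n k j}
        - ∏ k ∈ R n, ∏ j : Side, (1 - Real.exp (-(tilt n * k * (w n k j + 1))))) atTop (𝓝 0) := by
  have h := tendsto_P_real_sub_blockLaw hRo hRC hRcard
    (fun n => Set.univ.pi fun p => Set.Iic (w n p.1 p.2))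
  refine h.congr' ?_
  filter_upwards [eventually_gt_atTop 0] with n hn
  have ht := tilt_pos hn
  congr 1
  · congr 1
    ext s
    simp only [Set.mem_preimage, Set.mem_pi, Set.mem_univ, true_imp_iff, Set.mem_Iic,
      Set.mem_ofPred_eq, mult]
    exact ⟨fun hs k hk j => hs (⟨k, hk⟩, j), fun hs p => hs p.1 p.1.2 p.2⟩
  · rw [blockLaw_real_pi, Fintype.prod_prod_type, ← Finset.prod_coe_sort (R n)]
    refine Finset.prod_congr rfl fun k _ => Finset.prod_congr rfl fun j _ => ?_
    have hk : (0 : ℝ) < (k : ℕ) := by exact_mod_cast (hRo n k k.2).pos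
    rw [geomLaw_real_Iic (by positivity)]

end OddUnimodalSeq

/-! ### From geometric laws to the stated limits -/

theorem abs_prod_sub_prod_le {ι : Type*} (S : Finset ι) (f g : ι → ℝ)
    (hf : ∀ i ∈ S, |f i| ≤ 1) (hg : ∀ i ∈ S, |g i| ≤ 1) :
    |∏ i ∈ S, f i - ∏ i ∈ S, g i| ≤ ∑ i ∈ S, |f i - g i| := by
  classical
  induction S using Finset.induction_on with
  | empty => simp
  | insert k S hk ih =>
    have ih := ih (fun i hi => hf i (Finset.mem_insert_of_mem hi))
      fun i hi => hg i (Finset.mem_insert_of_mem hi)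
    have hfk := hf k (Finset.mem_insert_self k S)
    rw [Finset.prod_insert hk, Finset.prod_insert hk, Finset.sum_insert hk]
    have hP : |∏ i ∈ S, g i| ≤ 1 := by
      rw [Finset.abs_prod]
      exact Finset.prod_le_one (fun _ _ => abs_nonneg _) fun i hi =>
        hg i (Finset.mem_insert_of_mem hi)
    have e : f k * ∏ i ∈ S, f i - g k * ∏ i ∈ S, g i
        = f k * (∏ i ∈ S, f i - ∏ i ∈ S, g i) + (f k - g k) * ∏ i ∈ S, g i := by ring
    rw [e]
    have h1 : |f k * (∏ i ∈ S, f i - ∏ i ∈ S, g i)| ≤ 1 * ∑ i ∈ S, |f i - g i| := by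
      rw [abs_mul]; gcongr
    have h2 : |(f k - g k) * ∏ i ∈ S, g i| ≤ |f k - g k| * 1 := by
      rw [abs_mul]; gcongr
    refine (abs_add_le _ _).trans ?_
    linarith

namespace OddUnimodalSeq

theorem B_pos : 0 < B := by unfold B; positivity

theorem tilt_eq (n : ℕ) : tilt n = 1 / (B * √(n : ℝ)) := by
  rw [tilt, B, Real.sqrt_mul (by norm_num)]
  field_simp

theorem tilt_mul_sqrt {n : ℕ} (hn : 0 < n) : tilt n * √(n : ℝ) = 1 / B := by
  have : (0 : ℝ) < √(n : ℝ) := Real.sqrt_pos.2 (by exact_mod_cast hn)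
  have := B_pos
  rw [tilt_eq]
  field_simp

/-- The number of copies of `k` allowed by a bound on the rescaled multiplicity. -/
theorem mul_div_le_iff_le_floor {n k m : ℕ} (hn : 0 < n) (hk : 0 < k) {v : ℝ} (hv : 0 ≤ v) :
    (k : ℝ) * m / (B * √(n : ℝ)) ≤ v ↔ m ≤ ⌊v / (tilt n * k)⌋₊ := by
  have ht := tilt_pos hn
  have hk' : (0 : ℝ) < k := by exact_mod_cast hk
  rw [Nat.le_floor_iff (by positivity), le_div_iff₀ (by positivity), ← mul_one_div, ← tilt_eq]
  ring_nf

/-- Rounding moves `v` by at most `x`, and `y ↦ exp (-y)` is 1-Lipschitz for `y ≥ 0`. This is the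
error in replacing a geometric distribution function by the exponential one. -/
theorem abs_one_sub_exp_floor_sub_le {x v : ℝ} (hx : 0 < x) (hv : 0 ≤ v) :
    |(1 - Real.exp (-(x * (⌊v / x⌋₊ + 1)))) - (1 - Real.exp (-v))| ≤ x := by
  have h1 : v ≤ x * (⌊v / x⌋₊ + 1) := by
    have := (Nat.lt_floor_add_one (v / x)).le
    rw [div_le_iff₀ hx] at this
    linarith
  have h2 : x * (⌊v / x⌋₊ + 1) ≤ v + x := by
    have := Nat.floor_le (show 0 ≤ v / x by positivity)
    rw [le_div_iff₀ hx] at this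
    linarith
  set y := x * (⌊v / x⌋₊ + 1 : ℝ)
  have h3 : Real.exp (-y) ≤ Real.exp (-v) := Real.exp_le_exp.2 (by linarith)
  have h4 : Real.exp (-v) - Real.exp (-y) ≤ x := by
    have h5 : Real.exp (-y) = Real.exp (-v) * Real.exp (-(y - v)) := by
      rw [← Real.exp_add]; ring_nf
    have h6 := Real.add_one_le_exp (-(y - v))
    have h7 : Real.exp (-v) ≤ 1 := Real.exp_le_one_iff.2 (by linarith)
    have h8 := Real.exp_pos (-v)
    rw [h5]
    nlinarith
  rw [abs_le]
  constructor <;> linarith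

theorem abs_one_sub_exp_neg_le_one {y : ℝ} (hy : 0 ≤ y) : |1 - Real.exp (-y)| ≤ 1 := by
  have h1 := Real.exp_pos (-y)
  have h2 : Real.exp (-y) ≤ 1 := Real.exp_le_one_iff.2 (by linarith)
  rw [abs_le]; constructor <;> linarith

theorem tendsto_mul_sqrt_tilt {k : ℕ → ℕ}
    (hk : (fun n => (k n : ℝ)) =o[atTop] fun n => (n : ℝ) ^ (1 / 4 : ℝ)) :
    Tendsto (fun n => (k n : ℝ) * √(tilt n)) atTop (𝓝 0) := by
  have h := (hk.tendsto_div_nhds_zero).mul_const (√(1 / B))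
  rw [zero_mul] at h
  refine h.congr' ?_
  filter_upwards [eventually_gt_atTop 0] with n hn
  have hn' : (0 : ℝ) < n := by exact_mod_cast hn
  have e : (n : ℝ) ^ (1 / 4 : ℝ) = √(√(n : ℝ)) := by
    rw [Real.sqrt_eq_rpow, Real.sqrt_eq_rpow, ← Real.rpow_mul hn'.le]
    norm_num
  have hs : 0 < √(√(n : ℝ)) := Real.sqrt_pos.2 (Real.sqrt_pos.2 hn')
  rw [← tilt_mul_sqrt hn, Real.sqrt_mul (tilt_pos hn).le, e]
  field_simp

theorem tendsto_tilt_mul {k : ℕ → ℕ}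
    (hk : (fun n => (k n : ℝ)) =o[atTop] fun n => (n : ℝ) ^ (1 / 2 : ℝ)) :
    Tendsto (fun n => tilt n * (k n : ℝ)) atTop (𝓝 0) := by
  have h := (hk.tendsto_div_nhds_zero).mul_const (1 / B)
  rw [zero_mul] at h
  refine h.congr' ?_
  filter_upwards [eventually_gt_atTop 0] with n hn
  have hs : (0 : ℝ) < √(n : ℝ) := Real.sqrt_pos.2 (by exact_mod_cast hn)
  rw [← tilt_mul_sqrt hn, ← Real.sqrt_eq_rpow]
  field_simp

theorem tendsto_sqrt_tilt : Tendsto (fun n => √(tilt n)) atTop (𝓝 0) := by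
  have := (Real.continuous_sqrt.tendsto 0).comp tendsto_tilt
  simpa [Function.comp_def] using this

theorem integral_exp_neg_zero (v : ℝ) : ∫ u in (0 : ℝ)..v, Real.exp (-u) = 1 - Real.exp (-v) := by
  rw [intervalIntegral.integral_comp_neg (fun u => Real.exp u), integral_exp]
  simp

theorem tendsto_joint_small_parts {k : ℕ → ℕ}
    (hk : (fun n => (k n : ℝ)) =o[atTop] fun n => (n : ℝ) ^ (1 / 4 : ℝ))
    {v : ℕ → ℕ → Side → ℝ} (hv : ∀ n, ∀ i ∈ Finset.Icc 1 (k n), ∀ j, 0 ≤ v n i j) :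
    Tendsto (fun n : ℕ => (P n).real {s | ∀ i ∈ Finset.Icc 1 (k n), ∀ j : Side,
        (2 * (i : ℝ) - 1) * (X j (2 * i - 1) s : ℝ) / (B * √(n : ℝ)) ≤ v n i j}
      - ∏ i ∈ Finset.Icc 1 (k n), ∏ j : Side, ∫ u in (0 : ℝ)..(v n i j), Real.exp (-u))
      atTop (𝓝 0) := by
  have hks := tendsto_mul_sqrt_tilt hk
  have hinj : ∀ n, Set.InjOn (fun i => 2 * i - 1) (Finset.Icc 1 (k n)) := by
    intro n a ha b hb h
    have ha := Finset.mem_Icc.1 (Finset.mem_coe.1 ha)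
    have hb := Finset.mem_Icc.1 (Finset.mem_coe.1 hb)
    simp only at h
    omega
  set R : ℕ → Finset ℕ := fun n => (Finset.Icc 1 (k n)).image fun i => 2 * i - 1 with hR
  have hRcard : ∀ n, (R n).card = k n := fun n => by
    rw [hR, Finset.card_image_of_injOn (hinj n), Nat.card_Icc, Nat.add_sub_cancel]
  have hcast : ∀ {n i : ℕ}, i ∈ Finset.Icc 1 (k n) → ((2 * i - 1 : ℕ) : ℝ) = 2 * i - 1 := by
    intro n i hi
    have := (Finset.mem_Icc.1 hi).1
    push_cast [Nat.cast_sub (show 1 ≤ 2 * i by omega)]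
    ring
  have hle : ∀ {n i : ℕ}, 0 < n → i ∈ Finset.Icc 1 (k n) →
      tilt n * (2 * i - 1 : ℕ) ≤ 2 * (tilt n * k n) := by
    intro n i hn hi
    have h1 := (Finset.mem_Icc.1 hi).2
    have h2 : ((2 * i - 1 : ℕ) : ℝ) ≤ 2 * k n := by exact_mod_cast (by omega : 2 * i - 1 ≤ 2 * k n)
    have := tilt_pos hn
    nlinarith
  have htk : Tendsto (fun n => tilt n * (k n : ℝ)) atTop (𝓝 0) := by
    have h := hks.mul tendsto_sqrt_tilt
    rw [zero_mul] at h
    refine h.congr' ?_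
    filter_upwards [eventually_gt_atTop 0] with n hn
    rw [mul_assoc, Real.mul_self_sqrt (tilt_pos hn).le, mul_comm]
  have hbox := tendsto_P_real_box (R := R) (C := 1)
    (fun n a ha => by
      obtain ⟨i, hi, rfl⟩ := Finset.mem_image.1 ha
      have := (Finset.mem_Icc.1 hi).1
      exact ⟨i - 1, by omega⟩)
    (by
      filter_upwards [htk.eventually_lt_const (show (0 : ℝ) < 1 / 2 by norm_num),
        eventually_gt_atTop 0] with n h1 hn a ha
      obtain ⟨i, hi, rfl⟩ := Finset.mem_image.1 ha
      have := hle hn hi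
      linarith)
    (by simp_rw [hRcard]; exact hks)
    -- The box is indexed by the odd number `a = 2 i - 1`, and `(a + 1) / 2` recovers `i`.
    (fun n a j => ⌊v n ((a + 1) / 2) j / (tilt n * a)⌋₊)
  have hdiff : Tendsto (fun n =>
      ∏ a ∈ R n, ∏ j : Side, (1 - Real.exp (-(tilt n * a
        * ((⌊v n ((a + 1) / 2) j / (tilt n * a)⌋₊ : ℕ) + 1))))
      - ∏ i ∈ Finset.Icc 1 (k n), ∏ j : Side, ∫ u in (0 : ℝ)..(v n i j), Real.exp (-u))
      atTop (𝓝 0) := by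
    -- Each of the `2 k` factors has rounding error at most `2 t k`, so the product is off by at
    -- most `4 k^2 t`. This too tends to zero exactly when `k √t` does.
    have hsq : Tendsto (fun n => 4 * ((k n : ℝ) * √(tilt n)) ^ 2) atTop (𝓝 0) := by
      have := (hks.pow 2).const_mul 4
      simpa using this
    refine squeeze_zero_norm' ?_ hsq
    filter_upwards [eventually_gt_atTop 0] with n hn
    have ht := tilt_pos hn
    rw [Finset.prod_image (hinj n), ← Finset.prod_product', ← Finset.prod_product',
      Real.norm_eq_abs]
    have hpos : ∀ p ∈ Finset.Icc 1 (k n) ×ˢ (Finset.univ : Finset Side),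
        0 < tilt n * (2 * p.1 - 1 : ℕ) ∧ 0 ≤ v n p.1 p.2 ∧ (2 * p.1 - 1 + 1) / 2 = p.1 := by
      intro p hp
      have hp1 := (Finset.mem_product.1 hp).1
      have h1 := (Finset.mem_Icc.1 hp1).1
      have h2 : (0 : ℝ) < (2 * p.1 - 1 : ℕ) := by exact_mod_cast (by omega : 0 < 2 * p.1 - 1)
      exact ⟨by positivity, hv n _ hp1 _, by omega⟩
    refine (abs_prod_sub_prod_le _ _ _ (fun p hp => ?_) fun p hp => ?_).trans ?_
    · obtain ⟨h1, h2, h3⟩ := hpos p hp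
      exact abs_one_sub_exp_neg_le_one (by positivity)
    · rw [integral_exp_neg_zero]
      exact abs_one_sub_exp_neg_le_one (hpos p hp).2.1
    · refine (Finset.sum_le_sum fun p hp => (show _ ≤ 2 * (tilt n * k n) from ?_)).trans ?_
      · obtain ⟨h1, h2, h3⟩ := hpos p hp
        have h4 := abs_one_sub_exp_floor_sub_le h1 h2
        rw [h3, integral_exp_neg_zero (v n p.1 p.2)]
        exact h4.trans (hle hn (Finset.mem_product.1 hp).1)
      rw [Finset.sum_const, Finset.card_product, Nat.card_Icc, Nat.add_sub_cancel,
        show (Finset.univ : Finset Side).card = 2 from rfl, nsmul_eq_mul, mul_pow,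
        Real.sq_sqrt ht.le]
      push_cast
      refine le_of_eq ?_
      ring
  have hsum := hbox.add hdiff
  rw [add_zero] at hsum
  refine hsum.congr' ?_
  filter_upwards [eventually_gt_atTop 0] with n hn
  rw [sub_add_sub_cancel]
  congr 2
  ext s
  simp only [hR, Set.mem_ofPred_eq, Finset.forall_mem_image]
  refine forall₂_congr fun i hi => forall_congr' fun j => ?_
  have h1 := (Finset.mem_Icc.1 hi).1
  rw [← hcast hi, mul_div_le_iff_le_floor hn (by omega) (hv n i hi j),
    show (2 * i - 1 + 1) / 2 = i by omega]

theorem tendsto_single_part {k : ℕ → ℕ} {a : ℝ} (hko : ∀ n, Odd (k n))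
    (hka : ∀ᶠ n in atTop, tilt n * k n ≤ a) (w : ℕ → Side → ℕ) :
    Tendsto (fun n => (P n).real {s | X Side.L (k n) s ≤ w n Side.L ∧ X Side.R (k n) s ≤ w n Side.R}
        - (1 - Real.exp (-(tilt n * k n * (w n Side.L + 1))))
          * (1 - Real.exp (-(tilt n * k n * (w n Side.R + 1))))) atTop (𝓝 0) := by
  have h := tendsto_P_real_box (R := fun n => {k n}) (C := a)
    (fun n b hb => by rw [Finset.mem_singleton.1 hb]; exact hko n)
    (by
      filter_upwards [hka] with n hn b hb
      rw [Finset.mem_singleton.1 hb]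
      exact hn)
    (by simpa using tendsto_sqrt_tilt) (fun n _ j => w n j)
  refine h.congr fun n => ?_
  congr 1
  · congr 1
    ext s
    simp only [Finset.mem_singleton, forall_eq, Set.mem_ofPred_eq]
    exact ⟨fun hs => ⟨hs Side.L, hs Side.R⟩, fun hs j => by cases j; exacts [hs.1, hs.2]⟩
  · rw [Finset.prod_singleton, prod_side]

theorem tendsto_single_small_part {k : ℕ → ℕ} (hk1 : ∀ n, 1 ≤ k n)
    (hk : (fun n => (k n : ℝ)) =o[atTop] fun n => (n : ℝ) ^ (1 / 2 : ℝ)) (vL vR : ℝ) :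
    Tendsto (fun n : ℕ => (P n).real
        {s | (2 * (k n : ℝ) - 1) * (X Side.L (2 * k n - 1) s : ℝ) / (B * √(n : ℝ)) ≤ vL ∧
          (2 * (k n : ℝ) - 1) * (X Side.R (2 * k n - 1) s : ℝ) / (B * √(n : ℝ)) ≤ vR})
      atTop (𝓝 ((1 - Real.exp (-max vL 0)) * (1 - Real.exp (-max vR 0)))) := by
  have hcast : ∀ n, ((2 * k n - 1 : ℕ) : ℝ) = 2 * k n - 1 := by
    intro n
    have := hk1 n
    push_cast [Nat.cast_sub (show 1 ≤ 2 * k n by omega)]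
    ring
  have hnn : ∀ (n : ℕ) (j : Side) (s : OddUnimodalSeq),
      0 ≤ (2 * (k n : ℝ) - 1) * (X j (2 * k n - 1) s : ℝ) / (B * √(n : ℝ)) := by
    intro n j s
    have := B_pos
    rw [← hcast]
    positivity
  -- A rescaled multiplicity is nonnegative, so a negative bound gives an empty event, matching the
  -- factor `1 - exp 0 = 0`.
  rcases lt_or_ge vL 0 with hL | hL
  · have h0 : ∀ n, (P n).real
        {s | (2 * (k n : ℝ) - 1) * (X Side.L (2 * k n - 1) s : ℝ) / (B * √(n : ℝ)) ≤ vL ∧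
          (2 * (k n : ℝ) - 1) * (X Side.R (2 * k n - 1) s : ℝ) / (B * √(n : ℝ)) ≤ vR} = 0 := by
      intro n
      convert measureReal_empty (μ := P n)
      exact Set.eq_empty_of_forall_notMem fun s hs => absurd (hs.1.trans_lt hL) (hnn n _ s).not_gt
    simp_rw [h0, max_eq_right hL.le]
    simp
  rcases lt_or_ge vR 0 with hR | hR
  · have h0 : ∀ n, (P n).real
        {s | (2 * (k n : ℝ) - 1) * (X Side.L (2 * k n - 1) s : ℝ) / (B * √(n : ℝ)) ≤ vL ∧
          (2 * (k n : ℝ) - 1) * (X Side.R (2 * k n - 1) s : ℝ) / (B * √(n : ℝ)) ≤ vR} = 0 := by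
      intro n
      convert measureReal_empty (μ := P n)
      exact Set.eq_empty_of_forall_notMem fun s hs => absurd (hs.2.trans_lt hR) (hnn n _ s).not_gt
    simp_rw [h0, max_eq_right hR.le]
    simp
  rw [max_eq_left hL, max_eq_left hR]
  have htk := tendsto_tilt_mul hk
  have htk2 : Tendsto (fun n => tilt n * ((2 * k n - 1 : ℕ) : ℝ)) atTop (𝓝 0) := by
    have h2 := htk.const_mul 2
    rw [mul_zero] at h2
    refine squeeze_zero' ?_ ?_ h2
    · filter_upwards [eventually_gt_atTop 0] with n hn
      have := tilt_pos hn
      positivity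
    · filter_upwards [eventually_gt_atTop 0] with n hn
      have := tilt_pos hn
      rw [hcast]
      nlinarith
  set v : Side → ℝ := fun j => match j with | Side.L => vL | Side.R => vR with hvdef
  have hv : ∀ j, 0 ≤ v j := fun j => by cases j; exacts [hL, hR]
  have hbox := tendsto_single_part (k := fun n => 2 * k n - 1) (a := 1)
    (fun n => ⟨k n - 1, by have := hk1 n; omega⟩)
    ((htk2.eventually_lt_const one_pos).mono fun n hn => hn.le)
    (fun n j => ⌊v j / (tilt n * ((2 * k n - 1 : ℕ) : ℝ))⌋₊)
  have hlim : ∀ j, Tendsto (fun n => 1 - Real.exp (-(tilt n * ((2 * k n - 1 : ℕ) : ℝ)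
      * ((⌊v j / (tilt n * ((2 * k n - 1 : ℕ) : ℝ))⌋₊ : ℕ) + 1)))) atTop
      (𝓝 (1 - Real.exp (-v j))) := by
    intro j
    rw [tendsto_iff_dist_tendsto_zero]
    refine squeeze_zero' (Eventually.of_forall fun n => dist_nonneg) ?_ htk2
    filter_upwards [eventually_gt_atTop 0] with n hn
    have h1 : (0 : ℝ) < (2 * k n - 1 : ℕ) := by
      have := hk1 n
      exact_mod_cast (by omega : 0 < 2 * k n - 1)
    rw [Real.dist_eq]
    exact abs_one_sub_exp_floor_sub_le (mul_pos (tilt_pos hn) h1) (hv j)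
  have hsum := hbox.add ((hlim Side.L).mul (hlim Side.R))
  rw [zero_add] at hsum
  refine hsum.congr' ?_
  filter_upwards [eventually_gt_atTop 0] with n hn
  rw [sub_add_cancel]
  congr 1
  ext s
  have h1 := hk1 n
  simp only [Set.mem_ofPred_eq]
  rw [← hcast n, mul_div_le_iff_le_floor hn (by omega) hL,
    mul_div_le_iff_le_floor hn (by omega) hR]

theorem tendsto_tilt_mul_floor {c : ℝ} (hc : 0 < c) :
    Tendsto (fun n : ℕ => tilt n * (⌊c * √(n : ℝ)⌋₊ : ℝ)) atTop (𝓝 (c / B)) := by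
  have h1 : Tendsto (fun n : ℕ => c / B - tilt n) atTop (𝓝 (c / B)) := by
    simpa using (tendsto_const_nhds (x := c / B)).sub tendsto_tilt
  refine tendsto_of_tendsto_of_tendsto_of_le_of_le' h1 tendsto_const_nhds ?_ ?_
  all_goals
    filter_upwards [eventually_gt_atTop 0] with n hn
    have ht := tilt_pos hn
    have h2 := Nat.floor_le (show 0 ≤ c * √(n : ℝ) by positivity)
    have h3 := (Nat.lt_floor_add_one (c * √(n : ℝ))).le
    have h4 : tilt n * (c * √(n : ℝ)) = c / B := by
      rw [mul_left_comm, tilt_mul_sqrt hn, mul_one_div]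
    nlinarith

theorem tendsto_single_large_part {c : ℝ} (hc : 0 < c) (vL vR : ℕ) :
    Tendsto (fun n : ℕ => (P n).real
        {s | X Side.L ⌊c * √(n : ℝ)⌋₊ s ≤ vL ∧ X Side.R ⌊c * √(n : ℝ)⌋₊ s ≤ vR})
      (atTop ⊓ 𝓟 {n : ℕ | Odd ⌊c * √(n : ℝ)⌋₊})
      (𝓝 ((1 - Real.exp (-(c / B) * ((vL : ℝ) + 1)))
        * (1 - Real.exp (-(c / B) * ((vR : ℝ) + 1))))) := by
  classical
  -- The value `1` at even floors makes the sequence odd throughout, as `tendsto_single_part`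
  -- demands; the restricted filter ignores these `n`.
  set k : ℕ → ℕ := fun n => if Odd ⌊c * √(n : ℝ)⌋₊ then ⌊c * √(n : ℝ)⌋₊ else 1 with hk
  have hfl := tendsto_tilt_mul_floor hc
  have hcB : 0 < c / B := div_pos hc B_pos
  have hbox := tendsto_single_part (k := k) (a := c / B + 1)
    (fun n => by
      simp only [hk]
      split_ifs with h
      · exact h
      · exact odd_one)
    (by
      filter_upwards [hfl.eventually_lt_const (show c / B < c / B + 1 by linarith),
        tendsto_tilt.eventually_lt_const (show (0 : ℝ) < c / B + 1 by linarith)] with n h1 h2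
      simp only [hk]
      split_ifs
      · exact h1.le
      · simpa using h2.le)
    (fun _ j => match j with | Side.L => vL | Side.R => vR)
  have hlim : ∀ v : ℕ, Tendsto (fun n : ℕ => 1 - Real.exp (-(tilt n * (⌊c * √(n : ℝ)⌋₊ : ℝ)
      * ((v : ℝ) + 1)))) atTop (𝓝 (1 - Real.exp (-(c / B) * ((v : ℝ) + 1)))) := by
    intro v
    rw [neg_mul]
    exact ((Real.continuous_exp.tendsto _).comp (hfl.mul_const _).neg).const_sub 1
  have hsum := (hbox.mono_left inf_le_left).add
    (((hlim vL).mul (hlim vR)).mono_left (inf_le_left (b := 𝓟 {n : ℕ | Odd ⌊c * √(n : ℝ)⌋₊})))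
  rw [zero_add] at hsum
  refine hsum.congr' ?_
  rw [EventuallyEq, eventually_inf_principal]
  refine Eventually.of_forall fun n hn => ?_
  have hkn : k n = ⌊c * √(n : ℝ)⌋₊ := if_pos hn
  rw [hkn, sub_add_cancel]

end OddUnimodalSeq

theorem theorem1p5 :
    -- joint law of the multiplicities of the `k n` smallest odd numbers, on both sides
    (∀ k : ℕ → ℕ, (fun n => (k n : ℝ)) =o[atTop] (fun n => (n : ℝ) ^ (1 / 4 : ℝ)) →
      ∀ v : ℕ → ℕ → Side → ℝ, (∀ n, ∀ i ∈ Finset.Icc 1 (k n), ∀ j, 0 ≤ v n i j) →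
        Tendsto
          (fun n : ℕ =>
            (OddUnimodalSeq.P n).real
              {s | ∀ i ∈ Finset.Icc 1 (k n), ∀ j : Side,
                (2 * (i : ℝ) - 1) * (OddUnimodalSeq.X j (2 * i - 1) s : ℝ)
                  / (OddUnimodalSeq.B * √(n : ℝ)) ≤ v n i j}
            - ∏ i ∈ Finset.Icc 1 (k n), ∏ j : Side, ∫ u in (0 : ℝ)..(v n i j), Real.exp (-u))
          atTop (𝓝 0)) ∧
    -- a single odd number of size `o(√n)`
    (∀ k : ℕ → ℕ, (∀ n, 1 ≤ k n) →
      (fun n => (k n : ℝ)) =o[atTop] (fun n => (n : ℝ) ^ (1 / 2 : ℝ)) →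
      ∀ vL vR : ℝ,
        Tendsto
          (fun n : ℕ =>
            (OddUnimodalSeq.P n).real
              {s | (2 * (k n : ℝ) - 1) * (OddUnimodalSeq.X Side.L (2 * k n - 1) s : ℝ)
                    / (OddUnimodalSeq.B * √(n : ℝ)) ≤ vL ∧
                  (2 * (k n : ℝ) - 1) * (OddUnimodalSeq.X Side.R (2 * k n - 1) s : ℝ)
                    / (OddUnimodalSeq.B * √(n : ℝ)) ≤ vR})
          atTop (𝓝 ((1 - Real.exp (-max vL 0)) * (1 - Real.exp (-max vR 0))))) ∧
    -- an odd number equal to `⌊c √n⌋`, along those `n` for which this integer is odd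
    (∀ c : ℝ, 0 < c → ∀ vL vR : ℕ,
        Tendsto
          (fun n : ℕ =>
            (OddUnimodalSeq.P n).real
              {s | OddUnimodalSeq.X Side.L ⌊c * √(n : ℝ)⌋₊ s ≤ vL ∧
                  OddUnimodalSeq.X Side.R ⌊c * √(n : ℝ)⌋₊ s ≤ vR})
          (atTop ⊓ 𝓟 {n : ℕ | Odd ⌊c * √(n : ℝ)⌋₊})
          (𝓝 ((1 - Real.exp (-(c / OddUnimodalSeq.B) * ((vL : ℝ) + 1)))
            * (1 - Real.exp (-(c / OddUnimodalSeq.B) * ((vR : ℝ) + 1)))))) :=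
  ⟨fun _ hk _ hv => OddUnimodalSeq.tendsto_joint_small_parts hk hv,
    fun _ hk1 hk vL vR => OddUnimodalSeq.tendsto_single_small_part hk1 hk vL vR,
    fun _ hc vL vR => OddUnimodalSeq.tendsto_single_large_part hc vL vR⟩
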